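/- **Setting.** Let $\lambda>0$ and let $B$ be a random variable with $B>0$ almost surely. Jumps occur at the times of a Poisson process of rate $\lambda$, and their sizes are iid copies of $B$, independent of the jump times. Let $S_t$ be the sum of the jump sizes up to time $t$. Put $X_t=S_t-t$ (*M/G/1 case*) or $X_t=t-S_t$ (*spectrally negative case*). The queue is $Q_t=X_t+\max\{Q_0,-\inf_{0\le s\le t}X_s\}$, where $Q_0\ge 0$ is independent of $X$ and has law $\mu_0$; let $\mu_t$ be the law of $Q_t$. Let $\mathrm{WD}(\mu,\nu)=\inf_\gamma\int|x-y|\,d\gamma(x,y)\in[0,\infty]$, the infimum over all couplings $\gamma$ of $\mu$ and $\nu$. **Discrete chain.** Let $\Delta>0$ and $M=N\Delta$ with an integer $N\ge1$. The states are $0,\dots,N$ in the M/G/1 case and $1,\dots,N$ in the spectrally negative case. Let $F_B$ be the distribution function of $B$ and $$\check P(i,j)=e^{-\lambda\Delta}\Big(\mathbf 1_{i\to j}+\lambda\Delta\big(F^{[i]}(j\Delta)-F^{[i]}((j-1)\Delta)\big)\Big).$$ In the M/G/1 case $\mathbf 1_{i\to j}$ is the indicator of "$j=i-1$ or $i=j=0$",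 and $F^{[0]}(y)=\frac1\Delta\int_y^{y+\Delta}F_B(s)\,ds$, $F^{[1]}(y)=\frac2{\Delta^2}\int_y^{y+\Delta}(y+\Delta-s)F_B(s)\,ds$, $F^{[i]}(y)=\frac1\Delta\int_{y-(i-1)\Delta}^{y-(i-2)\Delta}F_B(s)\,ds$ for $i\ge2$. In the spectrally negative case $\mathbf 1_{i\to j}$ is the indicator of $j=i+1$, and $F^{[i]}(y)=\min\{1,\frac y\Delta\}\big(1-\frac1\Delta\int_{i\Delta-y}^{(i+1)\Delta-y}F_B(s)\,ds\big)$. Let $P=\check P+D$, with $D$ the diagonal matrix that makes all row sums equal to $1$. For a probability vector $p_0$ on the states let $p_k^{\mathsf T}=p_0^{\mathsf T}P^k$ and $$\tilde\mu_k=p_k(0)\,\delta_0+\sum_{i=1}^{N}p_k(i)\,U\big((i-1)\Delta,i\Delta\big)$$ (without the first term in the spectrally negative case), where $U(a,b)$ is the uniform distribution on $[a,b]$. **Error terms.** - $e_{\rm jmpagg}=\lambda\Delta^2$. If $B\ge\Delta/2$ almost surely, all bounds below also hold with the smaller value $e_{\rm jmpagg}=\lambda\Delta^2e^{-\lambda\Delta}$.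 - M/G/1 case: $e_{\rm jmpcut}=\lambda\Delta(1-e^{-\lambda\Delta})E[B]$ and $e_{\rm trunc}(i)=\lambda\Delta e^{-\lambda\Delta}E[B\,\mathbf 1_{B>M-i\Delta}]$. - Spectrally negative case: $e_{\rm jmpcut}=\min\{\lambda\Delta(1-e^{-\lambda\Delta})E[B],\ (1-(1+\lambda\Delta)e^{-\lambda\Delta})(M+\Delta)\}$, where $E[B]=\infty$ is allowed; $e_{\rm trunc}(N)=\Delta e^{-\lambda\Delta}$ and $e_{\rm trunc}(i)=0$ for $i<N$. **Claim.** In both cases: 1. For every law $\nu$ on $[0,\infty)$ and every $t\ge0$, the laws at time $t$ of the queues started from $\mu_0$ and from $\nu$ have Wasserstein distance at most $\mathrm{WD}(\mu_0,\nu)$. 2. If $Q'$ is the queue started from $\tilde\mu_0$, then $\mathrm{WD}(\mathrm{Law}(Q'_\Delta),\tilde\mu_1)\le\sum_ip_0(i)\big(e_{\rm jmpagg}+e_{\rm jmpcut}+e_{\rm trunc}(i)\big)$. 3. For every $k\ge0$, $\mathrm{WD}(\mu_{(k+1)\Delta},\tilde\mu_{k+1})\le\mathrm{WD}(\mu_{k\Delta},\tilde\mu_k)+\sum_ip_k(i)\big(e_{\rm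 jmpagg}+e_{\rm jmpcut}+e_{\rm trunc}(i)\big)$. 4. For every $k\ge0$, $\mathrm{WD}(\mu_{k\Delta},\tilde\mu_k)\le\mathrm{WD}(\mu_0,\tilde\mu_0)+k\,(e_{\rm jmpagg}+e_{\rm jmpcut})+\sum_{m<k}\sum_ip_m(i)\,e_{\rm trunc}(i)$. 5. Truncation aside, this bound is $O(\Delta)$ at a fixed time. If $E[B]<\infty$, then for every $T$ there is a constant $C$, depending only on $T$, $\lambda$, the law of $B$ and the case, with $k(\lambda\Delta^2+e_{\rm jmpcut})\le C\Delta$ whenever $k\Delta\le T$. In the spectrally negative case the same holds without $E[B]<\infty$, with $C$ depending also on $M$. Moreover, if $\mu_0$ is supported on $[0,M]$ and $p_0(0)=\mu_0(\{0\})$, $p_0(i)=\mu_0(((i-1)\Delta,i\Delta])$ for $i\ge1$ (in the spectrally negative case $p_0(1)=\mu_0([0,\Delta])$), then $p_0$ is a probability vector and $\mathrm{WD}(\mu_0,\tilde\mu_0)\le\Delta$. -/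

import Mathlib

open MeasureTheory ProbabilityTheory
open scoped ENNReal

namespace LevyQueue

noncomputable section

/-! ### The Wasserstein distance on the real line -/

/-- The Wasserstein (`L¹`) distance of two measures on `ℝ`: the infimum of `∫ |x - y| dγ(x, y)` over
all couplings `γ`, with values in `[0, ∞]`. -/
def WD (μ ν : Measure ℝ) : ℝ≥0∞ :=
  ⨅ (γ : Measure (ℝ × ℝ)) (_ : γ.map Prod.fst = μ ∧ γ.map Prod.snd = ν),
    ∫⁻ z, ENNReal.ofReal |z.1 - z.2| ∂γ

/-! ### The queues -/

/-- The two kinds of queues: the workload of an M/G/1 queue (upward jumps, drift `-1`), and the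
queue fed by a spectrally negative compound Poisson process (downward jumps, drift `+1`). -/
inductive QueueKind
  | mg1
  | specNeg

/-- Sample points of the noise driving a queue: the sequence of gaps between consecutive jump times
and the sequence of jump sizes. -/
abbrev Noise : Type := (ℕ → ℝ) × (ℕ → ℝ)

/-- The law of the noise: the gaps are iid exponential with rate `lam`, the jump sizes are iid with
law `B`, and the two sequences are independent. -/
def noiseLaw (lam : ℝ) (B : Measure ℝ) : Measure Noise :=
  (Measure.infinitePi fun _ : ℕ => expMeasure lam).prod (Measure.infinitePi fun _ : ℕ => B)

/-- The time of the `n`-th jump (counted from `n = 0`). -/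
def jumpTime (ω : Noise) (n : ℕ) : ℝ := ∑ m ∈ Finset.range (n + 1), ω.1 m

/-- The sum of all jump sizes up to and including time `t`; almost surely, only finitely many
summands are nonzero. -/
def jumpSum (ω : Noise) (t : ℝ) : ℝ := ∑' n, if jumpTime ω n ≤ t then ω.2 n else 0

/-- The net input process `X_t`. -/
def netInput : QueueKind → Noise → ℝ → ℝ
  | .mg1, ω, t => jumpSum ω t - t
  | .specNeg, ω, t => t - jumpSum ω t

/-- The queue with net input path `X`, started at `q`:
`Q_t = X_t + max {q, - inf_{0 ≤ s ≤ t} X_s}`. -/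
def workload (X : ℝ → ℝ) (q t : ℝ) : ℝ := X t + max q (-sInf (X '' Set.Icc 0 t))

/-- The law of `Q_t` when `Q_0` has law `ν` and is independent of the net input process. -/
def queueLaw (κ : QueueKind) (lam : ℝ) (B ν : Measure ℝ) (t : ℝ) : Measure ℝ :=
  (ν.prod (noiseLaw lam B)).map fun z => workload (netInput κ z.2) z.1 t

/-! ### The discrete chain -/

/-- The smallest state of the chain: state `0` is dropped in the spectrally negative case. -/
def QueueKind.firstState : QueueKind → ℕ
  | .mg1 => 0
  | .specNeg => 1

/-- The states of the chain with truncation point `M = N Δ`: `0, …, N` for the M/G/1 queue and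
`1, …, N` in the spectrally negative case. -/
abbrev State (κ : QueueKind) (N : ℕ) : Type := ↥(Finset.Icc κ.firstState N)

/-- The measure represented by the discrete state `i`: the Dirac measure in `0` for `i = 0`, and the
uniform distribution on `[(i - 1) Δ, i Δ]` for `i ≥ 1`. -/
def cell (Δ : ℝ) (i : ℕ) : Measure ℝ :=
  if i = 0 then Measure.dirac 0 else cond volume (Set.Icc (((i : ℝ) - 1) * Δ) (i * Δ))

/-- The piecewise uniform measure represented by a vector `p` on the states. -/
def lift {κ : QueueKind} {N : ℕ} (Δ : ℝ) (p : State κ N → ℝ) : Measure ℝ :=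
  ∑ i, ENNReal.ofReal (p i) • cell Δ i

/-- The value at `y` of the distribution function of `Q_Δ`, given exactly one jump in `[0, Δ]` and
given that `Q_0` has law `cell Δ i`, in terms of the distribution function of `B`. -/
def oneJumpCdf (κ : QueueKind) (Δ : ℝ) (B : Measure ℝ) (i : ℕ) (y : ℝ) : ℝ :=
  match κ with
  | .mg1 =>
    if i = 0 then 1 / Δ * ∫ s in y..(y + Δ), cdf B s
    else if i = 1 then 2 / Δ ^ 2 * ∫ s in y..(y + Δ), (y + Δ - s) * cdf B s
    else 1 / Δ * ∫ s in (y - ((i : ℝ) - 1) * Δ)..(y - ((i : ℝ) - 2) * Δ), cdf B s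
  | .specNeg =>
    min 1 (y / Δ) * (1 - 1 / Δ * ∫ s in (i * Δ - y)..(((i : ℝ) + 1) * Δ - y), cdf B s)

/-- The move of the chain if there is no jump in `[0, Δ]`. -/
def NoJumpMove : QueueKind → ℕ → ℕ → Prop
  | .mg1, i, j => j + 1 = i ∨ (i = 0 ∧ j = 0)
  | .specNeg, i, j => j = i + 1

open Classical in
/-- The substochastic matrix that ignores two or more jumps and exits from the truncated space. -/
def subMatrix (κ : QueueKind) (lam Δ : ℝ) (B : Measure ℝ) (N : ℕ) :
    Matrix (State κ N) (State κ N) ℝ :=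
  Matrix.of fun i j =>
    Real.exp (-(lam * Δ)) *
      ((if NoJumpMove κ i j then 1 else 0) +
        lam * Δ * (oneJumpCdf κ Δ B i ((j : ℕ) * Δ) - oneJumpCdf κ Δ B i ((((j : ℕ) : ℝ) - 1) * Δ)))

/-- The transition matrix: `subMatrix` with the missing row mass added on the diagonal. -/
def transMatrix (κ : QueueKind) (lam Δ : ℝ) (B : Measure ℝ) (N : ℕ) :
    Matrix (State κ N) (State κ N) ℝ :=
  subMatrix κ lam Δ B N + Matrix.diagonal fun i => 1 - ∑ j, subMatrix κ lam Δ B N i j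

/-- The distribution of the chain after `k` steps when started with distribution `p`. -/
def chainDist (κ : QueueKind) (lam Δ : ℝ) (B : Measure ℝ) (N : ℕ) (p : State κ N → ℝ) (k : ℕ) :
    State κ N → ℝ :=
  Matrix.vecMul p (transMatrix κ lam Δ B N ^ k)

/-- The canonical initial vector: the masses that `μ₀` gives to `{0}` and to the intervals
`((i - 1) Δ, i Δ]`. If state `0` is dropped, then the first interval is `[0, Δ]`. -/
def initDist (κ : QueueKind) (Δ : ℝ) (N : ℕ) (μ₀ : Measure ℝ) (i : State κ N) : ℝ :=
  if (i : ℕ) = 0 then μ₀.real {0}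
  else if (i : ℕ) = κ.firstState then μ₀.real (Set.Icc 0 Δ)
  else μ₀.real (Set.Ioc ((((i : ℕ) : ℝ) - 1) * Δ) ((i : ℕ) * Δ))

/-! ### The error terms -/

/-- The expectation of a nonnegative random variable with law `B`, in `[0, ∞]`. -/
def meanJump (B : Measure ℝ) : ℝ≥0∞ := ∫⁻ b, ENNReal.ofReal b ∂B

/-- The error caused by ignoring two or more jumps in one step. -/
def jmpCut (κ : QueueKind) (lam Δ : ℝ) (B : Measure ℝ) (N : ℕ) : ℝ≥0∞ :=
  match κ with
  | .mg1 => ENNReal.ofReal (lam * Δ * (1 - Real.exp (-(lam * Δ)))) * meanJump B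
  | .specNeg =>
    min (ENNReal.ofReal (lam * Δ * (1 - Real.exp (-(lam * Δ)))) * meanJump B)
      (ENNReal.ofReal ((1 - (1 + lam * Δ) * Real.exp (-(lam * Δ))) * (N * Δ + Δ)))

/-- The truncation error in one step from state `i`. -/
def trunc (κ : QueueKind) (lam Δ : ℝ) (B : Measure ℝ) (N i : ℕ) : ℝ≥0∞ :=
  match κ with
  | .mg1 =>
    ENNReal.ofReal (lam * Δ * Real.exp (-(lam * Δ))) *
      ∫⁻ b in Set.Ioi (N * Δ - i * Δ), ENNReal.ofReal b ∂B
  | .specNeg => if i = N then ENNReal.ofReal (Δ * Real.exp (-(lam * Δ))) else 0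

/-- Admissible values of the error caused by the uniform redistribution within the intervals:
`lam Δ²` always, and `lam Δ² exp (-lam Δ)` if all jumps have size at least `Δ / 2`. -/
def IsJmpAgg (lam Δ : ℝ) (B : Measure ℝ) (e : ℝ) : Prop :=
  e = lam * Δ ^ 2 ∨ (e = lam * Δ ^ 2 * Real.exp (-(lam * Δ)) ∧ ∀ᵐ b ∂B, Δ / 2 ≤ b)

end

end LevyQueue

/-!
The queue is a Markov process that contracts the Wasserstein distance, so the theorem reduces to
the error of one step of the chain started from a single cell.

*Contraction and Markov property.* For a fixed input path, `workload X q t` is `1`-Lipschitz in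
`q`. Hence a coupling of the initial laws, run with common noise, couples the laws at time `t`
(`wd_queueLaw_le`). For the Markov property (`queueLaw_queueLaw`), the law at time `t` is split
according to the number `n` of jumps. On the event of `n` jumps the workload equals a composition
of deterministic maps, drift and jump alternating (`workload_eq_afterJumps`). Splitting off the
first gap and the first jump size from the noise gives a recursion in `n` for the expectations
`jumpOp` on these events, and the memorylessness of the exponential distribution turns this
recursion, by induction on `n`, into the semigroup property graded by the number of jumps
(`jumpOp_add`). The same recursion shows that the number of jumps has a Poisson distribution, and
in particular is finite almost surely. With the triangle inequality for `WD`, which holds by gluing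
couplings (`wd_triangle`), the errors of the single steps add up.

*One step from a cell.* The law of `Q_Δ` is the sum of three parts (`queueLaw_eq_add`), and the row
of the transition matrix is split in the same way (`lift_transMatrix`). Without a jump, a cell is
moved exactly to another cell, unless it is the last one in the spectrally negative case
(`wd_noJump_le`). With exactly one jump, its time is uniform on `[0, Δ]`. The entries of the matrix
are the masses that the resulting law gives to the cells (`oneJumpCdf_sub_eq_initDist`). Making the
mass uniform within each cell costs at most `Δ` per unit of mass (`wd_lift_initDist_le`), and the
mass beyond `N Δ` is sent back to the starting cell (`wd_excess_mg1_le`, `wd_excess_specNeg_le`).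
With two or more jumps, the chain stays in its cell, and `Q_Δ` is compared with `Q_0`. Their
distance is at most the sum `S` of the jump sizes, plus `Δ` if `S < Δ` is possible; here the sum
has mean `λ Δ (1 - exp (-λ Δ)) E[B]` on the event of two or more jumps
(`wd_manyJumpsLaw_le_meanJump`). In the spectrally negative case the queue stays in `[0, N Δ + Δ]`,
which bounds the distance without `E[B]` (`wd_manyJumpsLaw_specNeg_le`). The extra `Δ` together
with the redistribution error of one jump amounts to `Δ (1 - exp (-λ Δ)) ≤ λ Δ²`.
-/

namespace LevyQueue

noncomputable section

/-! ### Couplings and the Wasserstein distance -/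

theorem wd_le_of_coupling {μ ν : Measure ℝ} (γ : Measure (ℝ × ℝ)) (h₁ : γ.map Prod.fst = μ)
    (h₂ : γ.map Prod.snd = ν) : WD μ ν ≤ ∫⁻ z, ENNReal.ofReal |z.1 - z.2| ∂γ :=
  iInf₂_le γ ⟨h₁, h₂⟩

/-- Two random variables on a common space form a coupling of their laws. -/
theorem wd_map_le {Ω : Type*} [MeasurableSpace Ω] (ρ : Measure Ω) {X Y : Ω → ℝ}
    (hX : AEMeasurable X ρ) (hY : AEMeasurable Y ρ) :
    WD (ρ.map X) (ρ.map Y) ≤ ∫⁻ ω, ENNReal.ofReal |X ω - Y ω| ∂ρ := by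
  refine (wd_le_of_coupling (ρ.map fun ω => (X ω, Y ω)) ?_ ?_).trans ?_
  · rw [AEMeasurable.map_map_of_aemeasurable (by fun_prop) (hX.prodMk hY)]; rfl
  · rw [AEMeasurable.map_map_of_aemeasurable (by fun_prop) (hX.prodMk hY)]; rfl
  · exact lintegral_map_le _ _

theorem wd_self (μ : Measure ℝ) : WD μ μ = 0 := by
  have := wd_map_le μ (X := id) (Y := id) aemeasurable_id aemeasurable_id
  simpa using this

theorem wd_add_le (μ₁ μ₂ ν₁ ν₂ : Measure ℝ) :
    WD (μ₁ + μ₂) (ν₁ + ν₂) ≤ WD μ₁ ν₁ + WD μ₂ ν₂ := by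
  refine ENNReal.le_iInf₂_add_iInf₂ fun γ₁ h₁ γ₂ h₂ => ?_
  refine (wd_le_of_coupling (γ₁ + γ₂) ?_ ?_).trans (lintegral_add_measure _ _ _).le
  · rw [Measure.map_add _ _ measurable_fst, h₁.1, h₂.1]
  · rw [Measure.map_add _ _ measurable_snd, h₁.2, h₂.2]

theorem wd_sum_le {ι : Type*} (s : Finset ι) (μ ν : ι → Measure ℝ) :
    WD (∑ i ∈ s, μ i) (∑ i ∈ s, ν i) ≤ ∑ i ∈ s, WD (μ i) (ν i) := by
  classical
  induction s using Finset.induction_on with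
  | empty => simp [wd_self]
  | insert i s hi ih =>
    simp only [Finset.sum_insert hi]
    exact (wd_add_le _ _ _ _).trans (add_le_add le_rfl ih)

theorem wd_smul_le {c : ℝ≥0∞} (hc : c ≠ ⊤) (μ ν : Measure ℝ) :
    WD (c • μ) (c • ν) ≤ c * WD μ ν := by
  rcases eq_or_ne c 0 with rfl | h0
  · simp [wd_self]
  rw [WD, WD, ENNReal.mul_iInf_of_ne h0 hc]
  simp only [ENNReal.mul_iInf_of_ne h0 hc]
  refine le_iInf₂ fun γ h => ?_
  refine (wd_le_of_coupling (c • γ) ?_ ?_).trans (by rw [lintegral_smul_measure, smul_eq_mul])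
  · rw [Measure.map_smul, h.1]
  · rw [Measure.map_smul, h.2]

/-- The bound given by the product coupling. -/
theorem wd_prod_le (ρ σ : Measure ℝ) [IsFiniteMeasure ρ] [IsProbabilityMeasure σ] :
    WD ρ (ρ Set.univ • σ) ≤ ∫⁻ x, ∫⁻ y, ENNReal.ofReal |x - y| ∂σ ∂ρ := by
  refine (wd_le_of_coupling (ρ.prod σ) ?_ ?_).trans ?_
  · simp [Measure.map_fst_prod]
  · simp [Measure.map_snd_prod]
  · rw [lintegral_prod _ (by fun_prop)]

/-- The triangle inequality: two couplings with a common marginal are glued along it, by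
disintegrating the second one. -/
theorem wd_triangle (μ ν ρ : Measure ℝ) [IsProbabilityMeasure ν] :
    WD μ ρ ≤ WD μ ν + WD ν ρ := by
  refine ENNReal.le_iInf₂_add_iInf₂ fun γ₁ h₁ γ₂ h₂ => ?_
  have : IsProbabilityMeasure γ₁ := by
    constructor
    rw [← Set.preimage_univ (f := Prod.snd), ← Measure.map_apply measurable_snd .univ, h₁.2,
      measure_univ]
  have : IsProbabilityMeasure γ₂ := by
    constructor
    rw [← Set.preimage_univ (f := Prod.fst), ← Measure.map_apply measurable_fst .univ, h₂.1,
      measure_univ]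
  have hk : ∀ f : ℝ × ℝ → ℝ≥0∞, Measurable f →
      ∫⁻ y, ∫⁻ z, f (y, z) ∂γ₂.condKernel y ∂ν = ∫⁻ w, f w ∂γ₂ := by
    intro f hf
    conv_rhs => rw [← γ₂.disintegrate γ₂.condKernel]
    rw [Measure.lintegral_compProd hf, Measure.fst, h₂.1]
  let κ : Kernel (ℝ × ℝ) ℝ := γ₂.condKernel.comap Prod.snd measurable_snd
  let γ : Measure ((ℝ × ℝ) × ℝ) := γ₁ ⊗ₘ κ
  have hγ₂ : γ.map (fun w => (w.1.2, w.2)) = γ₂ := by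
    refine Measure.ext_of_lintegral _ fun f hf => ?_
    rw [lintegral_map hf (by fun_prop), Measure.lintegral_compProd (by fun_prop), ← hk f hf, ← h₁.2,
      lintegral_map (Measurable.lintegral_kernel_prod_right' hf) measurable_snd]
    rfl
  have hγ₁ : γ.map Prod.fst = γ₁ := Measure.fst_compProd _ _
  refine (wd_le_of_coupling (γ.map fun w => (w.1.1, w.2)) ?_ ?_).trans ?_
  · rw [Measure.map_map measurable_fst (by fun_prop), ← h₁.1, ← hγ₁,
      Measure.map_map measurable_fst (by fun_prop)]
    rfl
  · rw [Measure.map_map measurable_snd (by fun_prop), ← h₂.2, ← hγ₂,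
      Measure.map_map measurable_snd (by fun_prop)]
    rfl
  · rw [lintegral_map (by fun_prop) (by fun_prop)]
    conv_rhs => rw [← hγ₁, ← hγ₂]
    rw [lintegral_map (by fun_prop) (by fun_prop), lintegral_map (by fun_prop) (by fun_prop),
      ← lintegral_add_left (by fun_prop)]
    refine lintegral_mono fun w => ?_
    rw [← ENNReal.ofReal_add (abs_nonneg _) (abs_nonneg _)]
    exact ENNReal.ofReal_le_ofReal (abs_sub_le _ _ _)

/-! ### Splitting off the first jump -/

/-- Prepend a term to a sequence. -/
def consSeq (x : ℝ) (a : ℕ → ℝ) (n : ℕ) : ℝ := Nat.casesOn n x a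

@[simp] theorem consSeq_zero (x : ℝ) (a : ℕ → ℝ) : consSeq x a 0 = x := rfl

@[simp] theorem consSeq_succ (x : ℝ) (a : ℕ → ℝ) (n : ℕ) : consSeq x a (n + 1) = a n := rfl

theorem measurable_consSeq : Measurable fun z : ℝ × (ℕ → ℝ) => consSeq z.1 z.2 := by
  refine measurable_pi_lambda _ fun n => ?_
  cases n with
  | zero => exact measurable_fst
  | succ n => exact (measurable_pi_apply n).comp measurable_snd

/-- An iid sequence is an independent first term followed by an iid sequence. -/
theorem infinitePi_eq_map_consSeq (m : Measure ℝ) [IsProbabilityMeasure m] :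
    Measure.infinitePi (fun _ : ℕ => m) =
      (m.prod (Measure.infinitePi fun _ : ℕ => m)).map fun z => consSeq z.1 z.2 := by
  refine (Measure.eq_infinitePi _ fun s t ht => ?_).symm
  obtain ⟨n, hn⟩ : ∃ n, s ⊆ Finset.range (n + 1) :=
    ⟨s.sup id, fun i hi => Finset.mem_range.2 (Nat.lt_succ_of_le (Finset.le_sup (f := id) hi))⟩
  let t' : ℕ → Set ℝ := fun i => if i ∈ s then t i else Set.univ
  have ht' : ∀ i, MeasurableSet (t' i) := fun i => by
    by_cases h : i ∈ s <;> simp [t', h, ht]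
  have hpi : Set.pi (s : Set ℕ) t = Set.pi (Finset.range (n + 1) : Set ℕ) t' := by
    ext x
    simp only [Set.mem_pi, Finset.mem_coe, t']
    refine ⟨fun h i _ => ?_, fun h i hi => ?_⟩
    · by_cases hs : i ∈ s <;> simp [hs, h i]
    · simpa [hi] using h i (hn hi)
  have hprod : ∏ i ∈ s, m (t i) = ∏ i ∈ Finset.range (n + 1), m (t' i) := by
    rw [← Finset.prod_subset hn]
    · exact Finset.prod_congr rfl fun i hi => by simp [t', hi]
    · intro i _ hi
      simp [t', hi]
  have hpre : (fun z : ℝ × (ℕ → ℝ) => consSeq z.1 z.2) ⁻¹'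
      Set.pi (Finset.range (n + 1) : Set ℕ) t' =
      t' 0 ×ˢ Set.pi (Finset.range n : Set ℕ) (fun i => t' (i + 1)) := by
    ext z
    simp only [Set.mem_preimage, Set.mem_pi, Finset.mem_coe, Finset.mem_range, Set.mem_prod]
    refine ⟨fun h => ⟨h 0 (by omega), fun i hi => h (i + 1) (by omega)⟩, fun h i hi => ?_⟩
    cases i with
    | zero => exact h.1
    | succ i => exact h.2 i (by omega)
  rw [hpi, hprod, Measure.map_apply measurable_consSeq
    (MeasurableSet.pi (Finset.countable_toSet _) fun i _ => ht' i), hpre, Measure.prod_prod,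
    Measure.infinitePi_pi _ (fun i _ => ht' (i + 1)), Finset.prod_range_succ', mul_comm]

/-- The first gap and the first jump size are split off from the noise. This is the source of
every recursion over the number of jumps. -/
theorem lintegral_noiseLaw_cons {lam : ℝ} (hlam : 0 < lam) (B : Measure ℝ) [IsProbabilityMeasure B]
    {F : Noise → ℝ≥0∞} (hF : Measurable F) :
    ∫⁻ ω, F ω ∂noiseLaw lam B =
      ∫⁻ u, ∫⁻ b, ∫⁻ ω, F (consSeq u ω.1, consSeq b ω.2) ∂noiseLaw lam B ∂B ∂expMeasure lam := by
  have := isProbabilityMeasure_expMeasure hlam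
  have hc : ∀ {α : Type} [MeasurableSpace α] {f : α → ℝ} {g : α → ℕ → ℝ}, Measurable f →
      Measurable g → Measurable fun x => consSeq (f x) (g x) := fun hf hg =>
    measurable_consSeq.comp (hf.prodMk hg)
  unfold noiseLaw
  conv_lhs => rw [infinitePi_eq_map_consSeq (expMeasure lam), infinitePi_eq_map_consSeq B,
    Measure.map_prod_map _ _ measurable_consSeq measurable_consSeq]
  rw [lintegral_map hF (measurable_consSeq.prodMap measurable_consSeq)]
  have m1 : Measurable fun w : (ℝ × (ℕ → ℝ)) × (ℝ × (ℕ → ℝ)) =>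
      F (consSeq w.1.1 w.1.2, consSeq w.2.1 w.2.2) :=
    hF.comp ((hc (by fun_prop) (by fun_prop)).prodMk (hc (by fun_prop) (by fun_prop)))
  rw [lintegral_prod _ (by exact m1.aemeasurable)]
  have m2 : Measurable fun w : (ℝ × (ℕ → ℝ)) =>
     ∫⁻ y, F (consSeq w.1 w.2, consSeq y.1 y.2) ∂(B.prod (Measure.infinitePi fun _ : ℕ => B)) :=
    Measurable.lintegral_prod_right' m1
  rw [lintegral_prod _ (by exact m2.aemeasurable)]
  refine lintegral_congr fun u => ?_
  have m3 : Measurable fun w : (ℕ → ℝ) × (ℝ × (ℕ → ℝ)) =>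
      F (consSeq u w.1, consSeq w.2.1 w.2.2) :=
    hF.comp ((hc (by fun_prop) (by fun_prop)).prodMk (hc (by fun_prop) (by fun_prop)))
  have m4 : Measurable fun w : (ℕ → ℝ) × ℝ × (ℕ → ℝ) =>
      F (consSeq u w.1, consSeq w.2.1 w.2.2) := m3
  calc _ = ∫⁻ a, ∫⁻ b, ∫⁻ c, F (consSeq u a, consSeq b c) ∂(Measure.infinitePi fun _ : ℕ => B) ∂B
          ∂(Measure.infinitePi fun _ : ℕ => expMeasure lam) := by
        refine lintegral_congr fun a => ?_
        exact lintegral_prod _ (m4.comp measurable_prodMk_left).aemeasurable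
    _ = ∫⁻ b, ∫⁻ a, ∫⁻ c, F (consSeq u a, consSeq b c) ∂(Measure.infinitePi fun _ : ℕ => B)
          ∂(Measure.infinitePi fun _ : ℕ => expMeasure lam) ∂B := by
        refine lintegral_lintegral_swap (Measurable.aemeasurable ?_)
        exact Measurable.lintegral_prod_right' (f := fun w : ((ℕ → ℝ) × ℝ) × (ℕ → ℝ) =>
          F (consSeq u w.1.1, consSeq w.1.2 w.2)) (hF.comp ((hc (by fun_prop) (by fun_prop)).prodMk
            (hc (by fun_prop) (by fun_prop))))
    _ = _ := by
        refine lintegral_congr fun b => ?_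
        rw [lintegral_prod]
        exact (hF.comp ((hc (by fun_prop) (by fun_prop)).prodMk
          (hc (by fun_prop) (by fun_prop)))).aemeasurable

/-! ### Recursive description of the queue -/

/-- The content of a queue with content `q` after a period of length `t` without jumps. -/
def drift (κ : QueueKind) (t q : ℝ) : ℝ :=
  match κ with
  | .mg1 => max (q - t) 0
  | .specNeg => q + t

/-- The content of a queue with content `q` after a jump of size `b`. -/
def jump (κ : QueueKind) (q b : ℝ) : ℝ :=
  match κ with
  | .mg1 => q + b
  | .specNeg => max (q - b) 0

/-- With gaps `g` between the jump times, there are exactly `n` jumps up to time `t`. -/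
def HasJumps : ℕ → (ℕ → ℝ) → ℝ → Prop
  | 0, g, t => t < g 0
  | n + 1, g, t => g 0 ≤ t ∧ HasJumps n (fun m => g (m + 1)) (t - g 0)

/-- The content at time `t` of a queue started at `q`, if there are exactly `n` jumps up to `t`. -/
def afterJumps (κ : QueueKind) : ℕ → Noise → ℝ → ℝ → ℝ
  | 0, _, q, t => drift κ t q
  | n + 1, ω, q, t => afterJumps κ n (fun m => ω.1 (m + 1), fun m => ω.2 (m + 1))
      (jump κ (drift κ (ω.1 0) q) (ω.2 0)) (t - ω.1 0)

theorem measurable_drift (κ : QueueKind) : Measurable fun z : ℝ × ℝ => drift κ z.1 z.2 := by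
  cases κ <;> (unfold drift; fun_prop)

theorem measurable_jump (κ : QueueKind) : Measurable fun z : ℝ × ℝ => jump κ z.1 z.2 := by
  cases κ <;> (unfold jump; fun_prop)

theorem measurableSet_hasJumps (n : ℕ) :
    MeasurableSet {z : (ℕ → ℝ) × ℝ | HasJumps n z.1 z.2} := by
  induction n with
  | zero =>
    exact measurableSet_lt (by fun_prop) ((measurable_pi_apply 0).comp measurable_fst)
  | succ n ih =>
    refine MeasurableSet.inter (measurableSet_le ((measurable_pi_apply 0).comp measurable_fst)
      measurable_snd) ?_
    refine ih.preimage (f := fun z : (ℕ → ℝ) × ℝ => (fun m => z.1 (m + 1), z.2 - z.1 0)) ?_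
    fun_prop

theorem measurable_afterJumps (κ : QueueKind) (n : ℕ) :
    Measurable fun z : Noise × ℝ × ℝ => afterJumps κ n z.1 z.2.1 z.2.2 := by
  induction n with
  | zero => exact (measurable_drift κ).comp (by fun_prop :
      Measurable fun z : Noise × ℝ × ℝ => (z.2.2, z.2.1))
  | succ n ih =>
    refine ih.comp (f := fun z : Noise × ℝ × ℝ =>
      (((fun m => z.1.1 (m + 1), fun m => z.1.2 (m + 1)),
      jump κ (drift κ (z.1.1 0) z.2.1) (z.1.2 0), z.2.2 - z.1.1 0) : Noise × ℝ × ℝ)) ?_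
    have h1 : Measurable fun z : Noise × ℝ × ℝ => drift κ (z.1.1 0) z.2.1 :=
      (measurable_drift κ).comp (by fun_prop : Measurable fun z : Noise × ℝ × ℝ => (z.1.1 0, z.2.1))
    have h2 : Measurable fun z : Noise × ℝ × ℝ => jump κ (drift κ (z.1.1 0) z.2.1) (z.1.2 0) :=
      (measurable_jump κ).comp (h1.prodMk (by fun_prop))
    fun_prop

theorem drift_nonneg (κ : QueueKind) {t q : ℝ} (ht : 0 ≤ t) (hq : 0 ≤ q) : 0 ≤ drift κ t q := by
  cases κ
  · exact le_max_right _ _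
  · exact add_nonneg hq ht

theorem jump_nonneg (κ : QueueKind) {q b : ℝ} (hq : 0 ≤ q) (hb : 0 ≤ b) : 0 ≤ jump κ q b := by
  cases κ
  · exact add_nonneg hq hb
  · exact le_max_right _ _

theorem drift_add (κ : QueueKind) {s t : ℝ} (ht : 0 ≤ t) (q : ℝ) :
    drift κ (s + t) q = drift κ t (drift κ s q) := by
  cases κ
  · simp only [drift]
    rcases le_total (q - s) 0 with h | h
    · rw [max_eq_right h, max_eq_right (by linarith), max_eq_right (by linarith)]
    · rw [max_eq_left h, sub_sub]
  · simp only [drift, add_assoc]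

theorem afterJumps_nonneg (κ : QueueKind) {n : ℕ} {ω : Noise} {q t : ℝ} (hg : ∀ m, 0 ≤ ω.1 m)
    (hb : ∀ m, 0 ≤ ω.2 m) (hq : 0 ≤ q) (ht : 0 ≤ t) (h : HasJumps n ω.1 t) :
    0 ≤ afterJumps κ n ω q t := by
  induction n generalizing ω q t with
  | zero => exact drift_nonneg κ ht hq
  | succ n ih =>
    exact ih (fun m => hg (m + 1)) (fun m => hb (m + 1))
      (jump_nonneg κ (drift_nonneg κ (hg 0) hq) (hb 0)) (sub_nonneg.2 h.1) h.2

theorem HasJumps.eq {n m : ℕ} {g : ℕ → ℝ} {t : ℝ} (hn : HasJumps n g t) (hm : HasJumps m g t) :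
    n = m := by
  induction n generalizing m g t with
  | zero =>
    cases m with
    | zero => rfl
    | succ m => exact absurd hm.1 (not_le.2 hn)
  | succ n ih =>
    cases m with
    | zero => exact absurd hn.1 (not_le.2 hm)
    | succ m => rw [ih hn.2 hm.2]

/-! ### The path of the queue between and at jumps -/

theorem jumpTime_succ (ω : Noise) (n : ℕ) :
    jumpTime ω (n + 1) = ω.1 0 + jumpTime (fun m => ω.1 (m + 1), fun m => ω.2 (m + 1)) n := by
  rw [jumpTime, Finset.sum_range_succ', add_comm]
  rfl

theorem HasJumps.lt_jumpTime {n : ℕ} {ω : Noise} {t : ℝ} (hg : ∀ m, 0 < ω.1 m)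
    (h : HasJumps n ω.1 t) {m : ℕ} (hm : n ≤ m) : t < jumpTime ω m := by
  induction n generalizing ω t m with
  | zero =>
    refine lt_of_lt_of_le h ?_
    rw [jumpTime, Finset.sum_range_succ']
    exact le_add_of_nonneg_left (Finset.sum_nonneg fun i _ => (hg _).le)
  | succ n ih =>
    cases m with
    | zero => omega
    | succ m =>
      rw [jumpTime_succ]
      have := ih (ω := (fun m => ω.1 (m + 1), fun m => ω.2 (m + 1))) (fun m => hg (m + 1)) h.2
        (m := m) (by omega)
      linarith

theorem HasJumps.jumpSum_eq {n : ℕ} {ω : Noise} {t s : ℝ} (hg : ∀ m, 0 < ω.1 m)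
    (h : HasJumps n ω.1 t) (hs : s ≤ t) :
    jumpSum ω s = ∑ m ∈ Finset.range n, if jumpTime ω m ≤ s then ω.2 m else 0 := by
  refine tsum_eq_sum fun m hm => if_neg ?_
  have := h.lt_jumpTime hg (m := m) (by simpa using hm)
  linarith

theorem jumpSum_of_lt {ω : Noise} (hg : ∀ m, 0 < ω.1 m) {s : ℝ} (hs : s < ω.1 0) :
    jumpSum ω s = 0 := by
  have h : HasJumps 0 ω.1 s := hs
  simpa using h.jumpSum_eq hg le_rfl

theorem HasJumps.jumpSum_add {n : ℕ} {ω : Noise} {t s : ℝ} (hg : ∀ m, 0 < ω.1 m)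
    (h : HasJumps (n + 1) ω.1 t) (hs : 0 ≤ s) (hst : s ≤ t - ω.1 0) :
    jumpSum ω (ω.1 0 + s) =
      ω.2 0 + jumpSum (fun m => ω.1 (m + 1), fun m => ω.2 (m + 1)) s := by
  rw [h.jumpSum_eq hg (by linarith), Finset.sum_range_succ', HasJumps.jumpSum_eq (n := n)
    (t := t - ω.1 0) (fun m => hg (m + 1)) h.2 hst, add_comm]
  congr 1
  · rw [if_pos]
    simpa [jumpTime] using hs
  · refine Finset.sum_congr rfl fun m _ => ?_
    simp only [jumpTime_succ, add_le_add_iff_left]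

theorem HasJumps.jumpSum_mem {n : ℕ} {ω : Noise} {t s : ℝ} (hg : ∀ m, 0 < ω.1 m)
    (hb : ∀ m, 0 < ω.2 m) (h : HasJumps n ω.1 t) (hs : s ≤ t) :
    jumpSum ω s ∈ Set.Icc 0 (∑ m ∈ Finset.range n, ω.2 m) := by
  rw [h.jumpSum_eq hg hs]
  constructor
  · refine Finset.sum_nonneg fun m _ => ?_
    split_ifs
    exacts [(hb m).le, le_rfl]
  · refine Finset.sum_le_sum fun m _ => ?_
    split_ifs
    exacts [le_rfl, (hb m).le]

theorem HasJumps.bddBelow_netInput (κ : QueueKind) {n : ℕ} {ω : Noise} {t : ℝ}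
    (hg : ∀ m, 0 < ω.1 m) (hb : ∀ m, 0 < ω.2 m) (h : HasJumps n ω.1 t) :
    BddBelow (netInput κ ω '' Set.Icc 0 t) := by
  refine ⟨-t - ∑ m ∈ Finset.range n, ω.2 m, ?_⟩
  rintro _ ⟨s, hs, rfl⟩
  have hj := h.jumpSum_mem hg hb hs.2
  have h1 := hs.1
  have h2 := hs.2
  have h3 := hj.1
  have h4 := hj.2
  cases κ <;> simp only [netInput] <;> linarith

/-- The queue restarts at the time of its first jump. -/
theorem workload_eq_afterJumps (κ : QueueKind) {n : ℕ} {ω : Noise} {q t : ℝ}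
    (hg : ∀ m, 0 < ω.1 m) (hb : ∀ m, 0 < ω.2 m) (hq : 0 ≤ q) (ht : 0 ≤ t)
    (h : HasJumps n ω.1 t) : workload (netInput κ ω) q t = afterJumps κ n ω q t := by
  induction n generalizing ω q t with
  | zero =>
    have h0 : ∀ s ≤ t, jumpSum ω s = 0 := fun s hs => jumpSum_of_lt hg (lt_of_le_of_lt hs h)
    cases κ
    · have himg : netInput .mg1 ω '' Set.Icc 0 t = Set.Icc (-t) 0 := by
        rw [Set.image_congr (g := fun s => -s) fun s hs => by simp [netInput, h0 s hs.2]]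
        simp
      simp only [workload, himg, csInf_Icc (neg_nonpos.2 ht), afterJumps, drift, netInput,
        h0 t le_rfl]
      rcases le_total q t with hqt | hqt
      · rw [max_eq_right (by linarith), max_eq_right (by linarith)]; ring
      · rw [max_eq_left (by linarith), max_eq_left (by linarith)]; ring
    · have himg : netInput .specNeg ω '' Set.Icc 0 t = Set.Icc 0 t := by
        rw [Set.image_congr (g := fun s => s) fun s hs => by simp [netInput, h0 s hs.2]]
        simp
      simp only [workload, himg, csInf_Icc ht, afterJumps, drift, netInput, h0 t le_rfl]
      rw [max_eq_left (by linarith)]; ring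
  | succ n ih =>
    set ω' : Noise := (fun m => ω.1 (m + 1), fun m => ω.2 (m + 1)) with hω'
    have hg' : ∀ m, 0 < ω'.1 m := fun m => hg (m + 1)
    have hb' : ∀ m, 0 < ω'.2 m := fun m => hb (m + 1)
    have hgt : ω.1 0 ≤ t := h.1
    have ht' : 0 ≤ t - ω.1 0 := sub_nonneg.2 h.1
    have h' : HasJumps n ω'.1 (t - ω.1 0) := h.2
    have hg0 := hg 0
    have hb0 := hb 0
    have hih := ih hg' hb' (jump_nonneg κ (drift_nonneg κ hg0.le hq) hb0.le) ht' h'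
    change _ = afterJumps κ n ω' (jump κ (drift κ (ω.1 0) q) (ω.2 0)) (t - ω.1 0)
    rw [← hih]
    -- the path after the first jump is a shifted copy of the path of the shifted noise
    set c : ℝ := netInput κ ω (ω.1 0) with hc
    have hS0 : jumpSum ω (ω.1 0) = ω.2 0 := by
      have h0 := h.jumpSum_add hg le_rfl ht'
      rw [add_zero] at h0
      rw [h0, jumpSum_of_lt hg' (hg' 0), add_zero]
    have hshift : ∀ s, 0 ≤ s → s ≤ t - ω.1 0 →
        netInput κ ω (ω.1 0 + s) = c + netInput κ ω' s := by
      intro s hs hst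
      have h1 := h.jumpSum_add hg hs hst
      cases κ <;> simp only [hc, netInput, hS0, h1] <;> ring
    have himg : netInput κ ω '' Set.Icc 0 t = netInput κ ω '' Set.Ico 0 (ω.1 0) ∪
        OrderIso.addLeft c '' (netInput κ ω' '' Set.Icc 0 (t - ω.1 0)) := by
      rw [← Set.Ico_union_Icc_eq_Icc hg0.le hgt, Set.image_union]
      congr 1
      have : Set.Icc (ω.1 0) t = (fun s => ω.1 0 + s) '' Set.Icc 0 (t - ω.1 0) := by
        simp
      rw [this, Set.image_image, Set.image_image]
      exact Set.image_congr fun s hs => hshift s hs.1 hs.2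
    have hbdd := h'.bddBelow_netInput κ hg' hb'
    have hne : (netInput κ ω' '' Set.Icc 0 (t - ω.1 0)).Nonempty :=
      (Set.nonempty_Icc.2 ht').image _
    have hne0 : (netInput κ ω '' Set.Ico 0 (ω.1 0)).Nonempty :=
      (Set.nonempty_Ico.2 hg0).image _
    have hall := h.bddBelow_netInput κ hg hb
    rw [himg] at hall
    have hinf : sInf (netInput κ ω '' Set.Icc 0 t) =
        min (sInf (netInput κ ω '' Set.Ico 0 (ω.1 0)))
          (c + sInf (netInput κ ω' '' Set.Icc 0 (t - ω.1 0))) := by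
      rw [himg, csInf_union (hall.mono Set.subset_union_left) hne0
        (hall.mono Set.subset_union_right) (hne.image _), ← OrderIso.map_csInf' _ hne hbdd]
      rfl
    have hXt : netInput κ ω t = c + netInput κ ω' (t - ω.1 0) := by
      rw [← hshift _ ht' le_rfl]; ring_nf
    have hI : sInf (netInput κ ω' '' Set.Icc 0 (t - ω.1 0)) ≤ 0 := by
      refine csInf_le_of_le hbdd ⟨0, ⟨le_rfl, ht'⟩, rfl⟩ ?_
      cases κ <;> simp [netInput, jumpSum_of_lt hg' (hg' 0)]
    simp only [workload, hinf, hXt]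
    generalize sInf (netInput κ ω' '' Set.Icc 0 (t - ω.1 0)) = I at hI
    generalize netInput κ ω' (t - ω.1 0) = Y
    cases κ
    · have h1 : netInput .mg1 ω '' Set.Ico 0 (ω.1 0) = Set.Ioc (-ω.1 0) 0 := by
        rw [Set.image_congr (g := fun s => -s) fun s hs => by
          simp [netInput, jumpSum_of_lt hg hs.2]]
        simp
      rw [h1, csInf_Ioc (by linarith)]
      simp only [hc, netInput, hS0, jump, drift]
      rw [add_comm (_ - _) Y, add_assoc]
      congr 1
      rw [← max_neg_neg, neg_neg, ← max_assoc]
      rw [← max_add_add_left]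
      congr 1
      · rw [← max_add_add_left, ← max_add_add_right]
        congr 1 <;> ring
      · ring
    · have h1 : netInput .specNeg ω '' Set.Ico 0 (ω.1 0) = Set.Ico 0 (ω.1 0) := by
        rw [Set.image_congr (g := fun s => s) fun s hs => by
          simp [netInput, jumpSum_of_lt hg hs.2]]
        simp
      rw [h1, csInf_Ico hg0]
      simp only [hc, netInput, hS0, jump, drift]
      rw [add_comm (_ - _) Y, add_assoc]
      congr 1
      rw [← max_neg_neg, neg_zero, ← max_assoc, max_eq_left hq, max_assoc,
        max_eq_right (by linarith : (0:ℝ) ≤ -I), ← max_add_add_left]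
      congr 1 <;> ring

/-! ### The exponential distribution -/

theorem expMeasure_Ioi {lam : ℝ} (hlam : 0 < lam) {t : ℝ} (ht : 0 ≤ t) :
    expMeasure lam (Set.Ioi t) = ENNReal.ofReal (Real.exp (-(lam * t))) := by
  have := isProbabilityMeasure_expMeasure hlam
  have h1 : 0 ≤ 1 - Real.exp (-(lam * t)) := by
    rw [sub_nonneg, Real.exp_le_one_iff]
    have := mul_nonneg hlam.le ht
    linarith
  rw [← Set.compl_Iic, prob_compl_eq_one_sub measurableSet_Iic, ← ofReal_cdf,
    cdf_expMeasure_eq hlam, if_pos ht, ← ENNReal.ofReal_one, ← ENNReal.ofReal_sub _ h1]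
  congr 1
  ring

theorem expMeasure_eq_withDensity (lam : ℝ) :
    expMeasure lam = volume.withDensity (exponentialPDF lam) := rfl

theorem measurable_exponentialPDF (lam : ℝ) : Measurable (exponentialPDF lam) :=
  (measurable_exponentialPDFReal lam).ennreal_ofReal

theorem setLIntegral_expMeasure (lam : ℝ) {s : Set ℝ} (hs : MeasurableSet s)
    (h0 : ∀ u ∈ s, 0 ≤ u) (f : ℝ → ℝ≥0∞) (hf : Measurable f) :
    ∫⁻ u in s, f u ∂expMeasure lam =
      ∫⁻ u in s, ENNReal.ofReal (lam * Real.exp (-(lam * u))) * f u := by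
  rw [expMeasure_eq_withDensity, setLIntegral_withDensity_eq_setLIntegral_mul _
    (measurable_exponentialPDF lam) hf hs]
  refine setLIntegral_congr_fun hs fun u hu => ?_
  simp only [Pi.mul_apply, exponentialPDF_of_nonneg (h0 u hu)]

theorem expMeasure_Iic_zero {lam : ℝ} (hlam : 0 < lam) : expMeasure lam (Set.Iic 0) = 0 := by
  have := isProbabilityMeasure_expMeasure hlam
  rw [← ofReal_cdf, cdf_expMeasure_eq hlam]
  simp

theorem setLIntegral_expMeasure_Iic {lam : ℝ} (hlam : 0 < lam) {t : ℝ} (ht : 0 ≤ t)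
    (f : ℝ → ℝ≥0∞) (hf : Measurable f) :
    ∫⁻ u in Set.Iic t, f u ∂expMeasure lam =
      ∫⁻ u in Set.Ioc 0 t, ENNReal.ofReal (lam * Real.exp (-(lam * u))) * f u := by
  rw [← setLIntegral_expMeasure lam measurableSet_Ioc (fun u hu => hu.1.le) f hf,
    ← Set.Iic_union_Ioc_eq_Iic ht]
  refine setLIntegral_congr ?_
  refine union_ae_eq_right_of_ae_eq_empty ?_
  exact ae_eq_empty.2 (expMeasure_Iic_zero hlam)

/-- The exponential distribution is memoryless. -/
theorem setLIntegral_expMeasure_Ioc_add {lam : ℝ} (hlam : 0 < lam) {s t : ℝ} (hs : 0 ≤ s)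
    (ht : 0 ≤ t) (f : ℝ → ℝ≥0∞) (hf : Measurable f) :
    ∫⁻ u in Set.Ioc s (s + t), f u ∂expMeasure lam =
      expMeasure lam (Set.Ioi s) * ∫⁻ v in Set.Iic t, f (s + v) ∂expMeasure lam := by
  rw [setLIntegral_expMeasure_Iic hlam ht _ (by fun_prop),
    setLIntegral_expMeasure lam measurableSet_Ioc (fun u hu => hs.trans hu.1.le) f hf,
    expMeasure_Ioi hlam hs, ← lintegral_const_mul _ (by fun_prop),
    ← lintegral_indicator measurableSet_Ioc, ← lintegral_indicator measurableSet_Ioc,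
    ← lintegral_add_left_eq_self _ s]
  refine lintegral_congr fun v => ?_
  have : s + v ∈ Set.Ioc s (s + t) ↔ v ∈ Set.Ioc 0 t := by simp
  by_cases hv : v ∈ Set.Ioc 0 t
  · rw [Set.indicator_of_mem (this.2 hv), Set.indicator_of_mem hv, ← mul_assoc,
      ← ENNReal.ofReal_mul (Real.exp_nonneg _)]
    congr 2
    rw [mul_add, neg_add, Real.exp_add]
    ring
  · rw [Set.indicator_of_notMem (mt this.1 hv), Set.indicator_of_notMem hv]

/-! ### The distribution of the queue on the event of `n` jumps -/

/-- The expectation of `f (Q_t)` on the event of exactly `n` jumps up to time `t`, for the queue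
started at `q`. -/
def jumpOp (κ : QueueKind) (lam : ℝ) (B : Measure ℝ) (n : ℕ) (t : ℝ) (f : ℝ → ℝ≥0∞) (q : ℝ) :
    ℝ≥0∞ :=
  ∫⁻ ω, {ω : Noise | HasJumps n ω.1 t}.indicator (fun ω => f (afterJumps κ n ω q t)) ω
    ∂noiseLaw lam B

theorem isProbabilityMeasure_noiseLaw {lam : ℝ} (hlam : 0 < lam) (B : Measure ℝ)
    [IsProbabilityMeasure B] : IsProbabilityMeasure (noiseLaw lam B) := by
  have := isProbabilityMeasure_expMeasure hlam
  unfold noiseLaw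
  infer_instance

theorem measurableSet_hasJumps_noise (n : ℕ) (t : ℝ) :
    MeasurableSet {ω : Noise | HasJumps n ω.1 t} :=
  (measurableSet_hasJumps n).preimage (by fun_prop : Measurable fun ω : Noise => (ω.1, t))

theorem indicator_hasJumps {n : ℕ} {t : ℝ} {ω : Noise} (h : HasJumps n ω.1 t)
    (F : Noise → ℝ≥0∞) : {ω : Noise | HasJumps n ω.1 t}.indicator F ω = F ω :=
  Set.indicator_of_mem (s := {ω : Noise | HasJumps n ω.1 t}) h F

theorem indicator_not_hasJumps {n : ℕ} {t : ℝ} {ω : Noise} (h : ¬HasJumps n ω.1 t)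
    (F : Noise → ℝ≥0∞) : {ω : Noise | HasJumps n ω.1 t}.indicator F ω = 0 :=
  Set.indicator_of_notMem (s := {ω : Noise | HasJumps n ω.1 t}) h F

theorem measurable_indicator_afterJumps (κ : QueueKind) (n : ℕ) {f : ℝ → ℝ≥0∞}
    (hf : Measurable f) : Measurable fun z : (ℝ × ℝ) × Noise =>
      {ω : Noise | HasJumps n ω.1 z.1.1}.indicator
        (fun ω => f (afterJumps κ n ω z.1.2 z.1.1)) z.2 := by
  have hs : MeasurableSet {z : (ℝ × ℝ) × Noise | HasJumps n z.2.1 z.1.1} :=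
    (measurableSet_hasJumps n).preimage
      (by fun_prop : Measurable fun z : (ℝ × ℝ) × Noise => (z.2.1, z.1.1))
  exact (hf.comp ((measurable_afterJumps κ n).comp
    (by fun_prop : Measurable fun z : (ℝ × ℝ) × Noise => (z.2, z.1.2, z.1.1)))).indicator hs

theorem measurable_indicator_afterJumps_right (κ : QueueKind) (n : ℕ) {f : ℝ → ℝ≥0∞}
    (hf : Measurable f) (t q : ℝ) : Measurable
      ({ω : Noise | HasJumps n ω.1 t}.indicator (fun ω => f (afterJumps κ n ω q t))) :=
  (measurable_indicator_afterJumps κ n hf).comp (measurable_prodMk_left (x := (t, q)))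

theorem measurable_jumpOp (κ : QueueKind) {lam : ℝ} (hlam : 0 < lam) (B : Measure ℝ)
    [IsProbabilityMeasure B] (n : ℕ) {f : ℝ → ℝ≥0∞} (hf : Measurable f) :
    Measurable fun z : ℝ × ℝ => jumpOp κ lam B n z.1 f z.2 := by
  have := isProbabilityMeasure_noiseLaw hlam B
  exact Measurable.lintegral_prod_right' (measurable_indicator_afterJumps κ n hf)

theorem measurable_jumpOp_right (κ : QueueKind) {lam : ℝ} (hlam : 0 < lam) (B : Measure ℝ)
    [IsProbabilityMeasure B] (n : ℕ) (t : ℝ) {f : ℝ → ℝ≥0∞} (hf : Measurable f) :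
    Measurable fun q : ℝ => jumpOp κ lam B n t f q :=
  (measurable_jumpOp κ hlam B n hf).comp measurable_prodMk_left


theorem jumpOp_zero (κ : QueueKind) {lam : ℝ} (hlam : 0 < lam) (B : Measure ℝ)
    [IsProbabilityMeasure B]
    (t : ℝ) {f : ℝ → ℝ≥0∞} (hf : Measurable f) (q : ℝ) :
    jumpOp κ lam B 0 t f q = expMeasure lam (Set.Ioi t) * f (drift κ t q) := by
  have := isProbabilityMeasure_noiseLaw hlam B
  rw [jumpOp, lintegral_noiseLaw_cons hlam B
    (measurable_indicator_afterJumps_right κ 0 hf t q)]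
  have : ∀ u : ℝ, (∫⁻ b, ∫⁻ ω, {ω : Noise | HasJumps 0 ω.1 t}.indicator
      (fun ω => f (afterJumps κ 0 ω q t)) (consSeq u ω.1, consSeq b ω.2) ∂noiseLaw lam B ∂B) =
      (Set.Ioi t).indicator (fun _ => f (drift κ t q)) u := by
    intro u
    by_cases hu : t < u
    · rw [Set.indicator_of_mem (Set.mem_Ioi.2 hu)]
      simp only [fun (b : ℝ) (ω : Noise) => indicator_hasJumps
        (show HasJumps 0 (consSeq u ω.1, consSeq b ω.2).1 t from hu)
        fun ω => f (afterJumps κ 0 ω q t)]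
      simp [afterJumps]
    · rw [Set.indicator_of_notMem (mt Set.mem_Ioi.1 hu)]
      simp only [fun (b : ℝ) (ω : Noise) => indicator_not_hasJumps
        (show ¬HasJumps 0 (consSeq u ω.1, consSeq b ω.2).1 t from hu)
        fun ω => f (afterJumps κ 0 ω q t)]
      simp
  simp only [this]
  rw [lintegral_indicator_const measurableSet_Ioi, mul_comm]

/-- Conditioning on the time and the size of the first jump. -/
theorem jumpOp_succ (κ : QueueKind) {lam : ℝ} (hlam : 0 < lam) (B : Measure ℝ)
    [IsProbabilityMeasure B]
    (n : ℕ) (t : ℝ) {f : ℝ → ℝ≥0∞} (hf : Measurable f) (q : ℝ) :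
    jumpOp κ lam B (n + 1) t f q =
      ∫⁻ u in Set.Iic t, ∫⁻ b, jumpOp κ lam B n (t - u) f (jump κ (drift κ u q) b) ∂B
        ∂expMeasure lam := by
  have := isProbabilityMeasure_noiseLaw hlam B
  rw [jumpOp, lintegral_noiseLaw_cons hlam B
    (measurable_indicator_afterJumps_right κ (n + 1) hf t q),
    ← lintegral_indicator measurableSet_Iic]
  refine lintegral_congr fun u => ?_
  by_cases hu : u ∈ Set.Iic t
  · rw [Set.indicator_of_mem hu]
    refine lintegral_congr fun b => lintegral_congr fun ω => ?_
    by_cases h : HasJumps n ω.1 (t - u)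
    · rw [indicator_hasJumps h, indicator_hasJumps
        (show HasJumps (n + 1) (consSeq u ω.1, consSeq b ω.2).1 t from ⟨hu, h⟩)]
      rfl
    · rw [indicator_not_hasJumps h, indicator_not_hasJumps
        (show ¬HasJumps (n + 1) (consSeq u ω.1, consSeq b ω.2).1 t from fun h' => h h'.2)]
  · rw [Set.indicator_of_notMem hu]
    simp only [fun (b : ℝ) (ω : Noise) => indicator_not_hasJumps
      (show ¬HasJumps (n + 1) (consSeq u ω.1, consSeq b ω.2).1 t from fun h => hu h.1)
      fun ω => f (afterJumps κ (n + 1) ω q t)]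
    simp

theorem measurable_lintegral_jumpOp (κ : QueueKind) {lam : ℝ} (hlam : 0 < lam) (B : Measure ℝ)
    [IsProbabilityMeasure B]
    (n : ℕ) {f : ℝ → ℝ≥0∞} (hf : Measurable f) (t q : ℝ) :
    Measurable fun u : ℝ => ∫⁻ b, jumpOp κ lam B n (t - u) f (jump κ (drift κ u q) b) ∂B := by
  have h : Measurable fun z : ℝ × ℝ => jumpOp κ lam B n (t - z.1) f
      (jump κ (drift κ z.1 q) z.2) := by
    refine (measurable_jumpOp κ hlam B n hf).comp (Measurable.prodMk (by fun_prop) ?_)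
    exact (measurable_jump κ).comp (((measurable_drift κ).comp (by fun_prop :
      Measurable fun z : ℝ × ℝ => (z.1, q))).prodMk measurable_snd)
  exact Measurable.lintegral_prod_right' h

/-- The Markov property, graded by the number of jumps in the two time intervals. -/
theorem jumpOp_add (κ : QueueKind) {lam : ℝ} (hlam : 0 < lam) (B : Measure ℝ)
    [IsProbabilityMeasure B]
    (n : ℕ) {s t : ℝ} (hs : 0 ≤ s) (ht : 0 ≤ t) {f : ℝ → ℝ≥0∞}
    (hf : Measurable f) (q : ℝ) :
    jumpOp κ lam B n (s + t) f q = ∑ kl ∈ Finset.HasAntidiagonal.antidiagonal n,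
      jumpOp κ lam B kl.1 s (jumpOp κ lam B kl.2 t f) q := by
  induction n generalizing s q with
  | zero =>
    rw [Finset.Nat.antidiagonal_zero, Finset.sum_singleton,
      jumpOp_zero κ hlam B _ (measurable_jumpOp_right κ hlam B _ _ hf), jumpOp_zero κ hlam B _ hf,
      jumpOp_zero κ hlam B _ hf, drift_add κ ht, ← mul_assoc, expMeasure_Ioi hlam hs,
      expMeasure_Ioi hlam ht, expMeasure_Ioi hlam (add_nonneg hs ht),
      ← ENNReal.ofReal_mul (Real.exp_nonneg _), ← Real.exp_add]
    congr 3
    ring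
  | succ n ih =>
    have hm := fun l => measurable_jumpOp_right κ hlam B l t hf
    rw [Finset.Nat.sum_antidiagonal_succ, jumpOp_succ κ hlam B _ _ hf,
      jumpOp_zero κ hlam B _ (hm _),
      ← Set.Iic_union_Ioc_eq_Iic (le_add_of_nonneg_right ht : s ≤ s + t),
      lintegral_union measurableSet_Ioc (Set.Iic_disjoint_Ioc le_rfl), add_comm]
    congr 1
    · -- the first jump happens after time `s`
      rw [setLIntegral_expMeasure_Ioc_add hlam hs ht _
        (measurable_lintegral_jumpOp κ hlam B n hf _ _),
        jumpOp_succ κ hlam B _ _ hf, setLIntegral_expMeasure_Iic hlam ht,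
        setLIntegral_expMeasure_Iic hlam ht]
      · congr 1
        refine setLIntegral_congr_fun measurableSet_Ioc fun v hv => ?_
        simp only [add_sub_add_left_eq_sub, drift_add κ hv.1.le]
      · exact measurable_lintegral_jumpOp κ hlam B n hf _ _
      · exact (measurable_lintegral_jumpOp κ hlam B n hf _ _).comp (by fun_prop)
    · -- the first jump happens before time `s`
      have h1 : ∀ kl ∈ Finset.HasAntidiagonal.antidiagonal n,
          jumpOp κ lam B (kl.1 + 1) s (jumpOp κ lam B kl.2 t f) q
          = ∫⁻ u in Set.Iic s, ∫⁻ b, jumpOp κ lam B kl.1 (s - u) (jumpOp κ lam B kl.2 t f)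
            (jump κ (drift κ u q) b) ∂B ∂expMeasure lam :=
        fun kl _ => jumpOp_succ κ hlam B _ _ (hm _) _
      rw [Finset.sum_congr rfl h1, ← lintegral_finsetSum _ fun kl _ =>
        measurable_lintegral_jumpOp κ hlam B _ (hm _) _ _]
      refine setLIntegral_congr_fun measurableSet_Iic fun u hu => ?_
      rw [← lintegral_finsetSum _ fun kl _ => ?_]
      · refine lintegral_congr fun b => ?_
        rw [← ih (sub_nonneg.2 hu), sub_add_eq_add_sub]
      · exact (measurable_jumpOp_right κ hlam B _ _ (hm _)).comp
          ((measurable_jump κ).comp measurable_prodMk_left)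

/-- The number of jumps up to time `t` has the Poisson distribution of parameter `lam * t`. -/
theorem jumpOp_const_one (κ : QueueKind) {lam : ℝ} (hlam : 0 < lam) (B : Measure ℝ)
    [IsProbabilityMeasure B]
    (n : ℕ) {t : ℝ} (ht : 0 ≤ t) (q : ℝ) :
    jumpOp κ lam B n t (fun _ => 1) q =
      ENNReal.ofReal (Real.exp (-(lam * t)) * (lam * t) ^ n / n.factorial) := by
  induction n generalizing t q with
  | zero =>
    rw [jumpOp_zero κ hlam B _ measurable_const, expMeasure_Ioi hlam ht]
    simp
  | succ n ih =>
    rw [jumpOp_succ κ hlam B _ _ measurable_const, setLIntegral_expMeasure_Iic hlam ht _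
      (measurable_lintegral_jumpOp κ hlam B n measurable_const _ _)]
    have hcong : ∀ u ∈ Set.Ioc 0 t, ENNReal.ofReal (lam * Real.exp (-(lam * u))) *
        (∫⁻ b, jumpOp κ lam B n (t - u) (fun _ => 1) (jump κ (drift κ u q) b) ∂B) =
        ENNReal.ofReal (Real.exp (-(lam * t)) * lam ^ (n + 1) / n.factorial * (t - u) ^ n) := by
      intro u hu
      simp only [ih (sub_nonneg.2 hu.2), lintegral_const, measure_univ, mul_one]
      rw [← ENNReal.ofReal_mul (by positivity)]
      congr 1
      have : Real.exp (-(lam * t)) = Real.exp (-(lam * u)) * Real.exp (-(lam * (t - u))) := by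
        rw [← Real.exp_add]; ring_nf
      rw [this, mul_pow]
      ring
    rw [setLIntegral_congr_fun measurableSet_Ioc hcong, ← ofReal_integral_eq_lintegral_ofReal]
    · congr 1
      rw [← intervalIntegral.integral_of_le ht, intervalIntegral.integral_const_mul,
        intervalIntegral.integral_comp_sub_left (fun x => x ^ n) t, integral_pow,
        Nat.factorial_succ]
      push_cast
      field_simp
      simp [mul_pow]
    · exact (Continuous.integrableOn_Icc (by fun_prop)).mono_set Set.Ioc_subset_Icc_self
    · filter_upwards [ae_restrict_mem measurableSet_Ioc] with u hu
      have := sub_nonneg.2 hu.2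
      positivity

theorem noiseLaw_hasJumps {lam : ℝ} (hlam : 0 < lam) (B : Measure ℝ) [IsProbabilityMeasure B]
    (n : ℕ) {t : ℝ} (ht : 0 ≤ t) :
    noiseLaw lam B {ω | HasJumps n ω.1 t} =
      ENNReal.ofReal (Real.exp (-(lam * t)) * (lam * t) ^ n / n.factorial) := by
  rw [← jumpOp_const_one .mg1 hlam B n ht 0, jumpOp,
    lintegral_indicator_const (measurableSet_hasJumps_noise n t), one_mul]

theorem hasSum_poisson (lam t : ℝ) : HasSum
    (fun n : ℕ => Real.exp (-(lam * t)) * (lam * t) ^ n / n.factorial) 1 := by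
  have h := (NormedSpace.expSeries_div_hasSum_exp (𝔸 := ℝ) (lam * t)).mul_left
    (Real.exp (-(lam * t)))
  rw [← Real.exp_eq_exp_ℝ, ← Real.exp_add, neg_add_cancel, Real.exp_zero] at h
  simpa only [mul_div_assoc] using h

/-- Almost surely, there are finitely many jumps up to time `t`. -/
theorem ae_exists_hasJumps {lam : ℝ} (hlam : 0 < lam) (B : Measure ℝ) [IsProbabilityMeasure B]
    {t : ℝ} (ht : 0 ≤ t) :
    ∀ᵐ ω ∂noiseLaw lam B, ∃ n, HasJumps n ω.1 t := by
  have := isProbabilityMeasure_noiseLaw hlam B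
  have hm : MeasurableSet (⋃ n, {ω : Noise | HasJumps n ω.1 t}) :=
    .iUnion fun n => measurableSet_hasJumps_noise n t
  have h1 : noiseLaw lam B (⋃ n, {ω : Noise | HasJumps n ω.1 t}) = 1 := by
    rw [measure_iUnion (fun n m hnm => Set.disjoint_left.2 fun ω h h' => hnm (h.eq h'))
      fun n => measurableSet_hasJumps_noise n t]
    simp only [noiseLaw_hasJumps hlam B _ ht]
    rw [← ENNReal.ofReal_tsum_of_nonneg (fun n => by positivity) (hasSum_poisson lam t).summable,
      (hasSum_poisson lam t).tsum_eq, ENNReal.ofReal_one]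
  filter_upwards [(prob_compl_eq_zero_iff hm).2 h1 |> measure_eq_zero_iff_ae_notMem.1] with ω hω
  simpa using hω

theorem ae_gap_pos {lam : ℝ} (hlam : 0 < lam) (B : Measure ℝ) [IsProbabilityMeasure B] :
    ∀ᵐ ω ∂noiseLaw lam B, ∀ m, 0 < ω.1 m := by
  have := isProbabilityMeasure_expMeasure hlam
  have h : ∀ᵐ u ∂expMeasure lam, 0 < u := by
    filter_upwards [measure_eq_zero_iff_ae_notMem.1 (expMeasure_Iic_zero hlam)] with u hu
    simpa using hu
  refine ae_all_iff.2 fun m => ?_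
  exact Measure.quasiMeasurePreserving_fst.ae
    ((measurePreserving_eval_infinitePi
      (fun _ : ℕ => expMeasure lam) m).quasiMeasurePreserving.ae h)

theorem ae_size {lam : ℝ} (hlam : 0 < lam) (B : Measure ℝ) [IsProbabilityMeasure B]
    {p : ℝ → Prop} (h : ∀ᵐ b ∂B, p b) : ∀ᵐ ω ∂noiseLaw lam B, ∀ m, p (ω.2 m) := by
  have := isProbabilityMeasure_expMeasure hlam
  refine ae_all_iff.2 fun m => ?_
  exact Measure.quasiMeasurePreserving_snd.ae
    ((measurePreserving_eval_infinitePi (fun _ : ℕ => B) m).quasiMeasurePreserving.ae h)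

/-! ### The law of the queue -/

theorem ae_nonneg_of_measure_Iio {ν : Measure ℝ} (hν : ν (Set.Iio 0) = 0) : ∀ᵐ q ∂ν, 0 ≤ q := by
  filter_upwards [measure_eq_zero_iff_ae_notMem.1 hν] with q hq
  simpa using hq

theorem ae_pos_of_measure_Iic {ν : Measure ℝ} (hν : ν (Set.Iic 0) = 0) : ∀ᵐ q ∂ν, 0 < q := by
  filter_upwards [measure_eq_zero_iff_ae_notMem.1 hν] with q hq
  simpa using hq

/-- The noise is regular up to time `t`: all gaps and all sizes are positive, and only finitely
many jumps happen up to time `t`. -/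
structure Noise.Regular (ω : Noise) (t : ℝ) : Prop where
  gap_pos : ∀ m, 0 < ω.1 m
  size_pos : ∀ m, 0 < ω.2 m
  exists_hasJumps : ∃ n, HasJumps n ω.1 t

theorem ae_regular {lam : ℝ} (hlam : 0 < lam) {B : Measure ℝ} [IsProbabilityMeasure B]
    (hB : B (Set.Iic 0) = 0) {t : ℝ} (ht : 0 ≤ t) : ∀ᵐ ω ∂noiseLaw lam B, ω.Regular t := by
  filter_upwards [ae_gap_pos hlam B, ae_size hlam B (ae_pos_of_measure_Iic hB),
    ae_exists_hasJumps hlam B ht] with ω h1 h2 h3 using ⟨h1, h2, h3⟩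

theorem ae_regular_prod {lam : ℝ} (hlam : 0 < lam) {B : Measure ℝ} [IsProbabilityMeasure B]
    (hB : B (Set.Iic 0) = 0) {ν : Measure ℝ} [SFinite ν] (hν : ν (Set.Iio 0) = 0) {t : ℝ}
    (ht : 0 ≤ t) : ∀ᵐ z ∂ν.prod (noiseLaw lam B), 0 ≤ z.1 ∧ Noise.Regular z.2 t := by
  have := isProbabilityMeasure_noiseLaw hlam B
  filter_upwards [Measure.quasiMeasurePreserving_fst.ae (ae_nonneg_of_measure_Iio hν),
    Measure.quasiMeasurePreserving_snd.ae (ae_regular hlam hB ht)] with z h1 h2 using ⟨h1, h2⟩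

theorem aemeasurable_workload (κ : QueueKind) {lam : ℝ} (hlam : 0 < lam) {B : Measure ℝ}
    [IsProbabilityMeasure B] (hB : B (Set.Iic 0) = 0) {ν : Measure ℝ} [SFinite ν]
    (hν : ν (Set.Iio 0) = 0) {t : ℝ} (ht : 0 ≤ t) :
    AEMeasurable (fun z : ℝ × Noise => workload (netInput κ z.2) z.1 t)
      (ν.prod (noiseLaw lam B)) := by
  have hE : ∀ n, MeasurableSet {z : ℝ × Noise | HasJumps n z.2.1 t} := fun n =>
    (measurableSet_hasJumps_noise n t).preimage measurable_snd
  have h := ae_regular_prod hlam hB hν ht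
  have huniv : (⋃ n, {z : ℝ × Noise | HasJumps n z.2.1 t}) =ᵐ[ν.prod (noiseLaw lam B)]
      Set.univ := by
    rw [ae_eq_univ, measure_eq_zero_iff_ae_notMem]
    filter_upwards [h] with z hz
    simpa using hz.2.exists_hasJumps
  rw [← Measure.restrict_univ (μ := ν.prod (noiseLaw lam B)), ← Measure.restrict_congr_set huniv,
    aemeasurable_iUnion_iff]
  intro n
  refine ⟨fun z => afterJumps κ n z.2 z.1 t, (measurable_afterJumps κ n).comp
    (by fun_prop : Measurable fun z : ℝ × Noise => (z.2, z.1, t)), ?_⟩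
  filter_upwards [ae_restrict_mem (hE n), ae_restrict_of_ae h] with z hz hz'
  exact workload_eq_afterJumps κ hz'.2.gap_pos hz'.2.size_pos hz'.1 ht hz

theorem lintegral_workload (κ : QueueKind) {lam : ℝ} (hlam : 0 < lam) {B : Measure ℝ}
    [IsProbabilityMeasure B] (hB : B (Set.Iic 0) = 0) {ν : Measure ℝ} [SFinite ν]
    (hν : ν (Set.Iio 0) = 0) {t : ℝ} (ht : 0 ≤ t) (F : ℝ × Noise → ℝ → ℝ≥0∞) :
    ∫⁻ z, F z (workload (netInput κ z.2) z.1 t) ∂ν.prod (noiseLaw lam B) =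
      ∫⁻ z, ∑' n, {ω : Noise | HasJumps n ω.1 t}.indicator
        (fun ω => F (z.1, ω) (afterJumps κ n ω z.1 t)) z.2 ∂ν.prod (noiseLaw lam B) := by
  refine lintegral_congr_ae ?_
  filter_upwards [ae_regular_prod hlam hB hν ht] with z hz
  obtain ⟨n, hn⟩ := hz.2.exists_hasJumps
  rw [tsum_eq_single n fun m hm => indicator_not_hasJumps (fun h => hm (h.eq hn)) _,
    indicator_hasJumps hn, workload_eq_afterJumps κ hz.2.gap_pos hz.2.size_pos hz.1 ht hn]

/-- The law at time `t`, split according to the number of jumps. -/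
theorem lintegral_queueLaw (κ : QueueKind) {lam : ℝ} (hlam : 0 < lam) {B : Measure ℝ}
    [IsProbabilityMeasure B] (hB : B (Set.Iic 0) = 0) {ν : Measure ℝ} [SFinite ν]
    (hν : ν (Set.Iio 0) = 0) {t : ℝ} (ht : 0 ≤ t) {f : ℝ → ℝ≥0∞} (hf : Measurable f) :
    ∫⁻ x, f x ∂queueLaw κ lam B ν t = ∫⁻ q, ∑' n, jumpOp κ lam B n t f q ∂ν := by
  have := isProbabilityMeasure_noiseLaw hlam B
  have hm : ∀ n, Measurable fun z : ℝ × Noise => {ω : Noise | HasJumps n ω.1 t}.indicator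
      (fun ω => f (afterJumps κ n ω z.1 t)) z.2 := fun n =>
    (measurable_indicator_afterJumps κ n hf).comp
      (by fun_prop : Measurable fun z : ℝ × Noise => ((t, z.1), z.2))
  rw [queueLaw, lintegral_map' hf.aemeasurable (aemeasurable_workload κ hlam hB hν ht),
    lintegral_workload κ hlam hB hν ht fun _ => f,
    lintegral_prod _ (Measurable.tsum hm).aemeasurable]
  refine lintegral_congr fun q => ?_
  rw [lintegral_tsum fun n => (measurable_indicator_afterJumps_right κ n hf t q).aemeasurable]
  rfl

theorem isProbabilityMeasure_queueLaw (κ : QueueKind) {lam : ℝ} (hlam : 0 < lam) {B : Measure ℝ}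
    [IsProbabilityMeasure B] (hB : B (Set.Iic 0) = 0) {ν : Measure ℝ} [IsProbabilityMeasure ν]
    (hν : ν (Set.Iio 0) = 0) {t : ℝ} (ht : 0 ≤ t) :
    IsProbabilityMeasure (queueLaw κ lam B ν t) := by
  have := isProbabilityMeasure_noiseLaw hlam B
  exact Measure.isProbabilityMeasure_map (aemeasurable_workload κ hlam hB hν ht)

theorem workload_nonneg (κ : QueueKind) {ω : Noise} {q t : ℝ} (hω : ω.Regular t) (hq : 0 ≤ q)
    (ht : 0 ≤ t) : 0 ≤ workload (netInput κ ω) q t := by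
  obtain ⟨n, hn⟩ := hω.exists_hasJumps
  rw [workload_eq_afterJumps κ hω.gap_pos hω.size_pos hq ht hn]
  exact afterJumps_nonneg κ (fun m => (hω.gap_pos m).le) (fun m => (hω.size_pos m).le) hq ht hn

theorem queueLaw_Iio_zero (κ : QueueKind) {lam : ℝ} (hlam : 0 < lam) {B : Measure ℝ}
    [IsProbabilityMeasure B] (hB : B (Set.Iic 0) = 0) {ν : Measure ℝ} [SFinite ν]
    (hν : ν (Set.Iio 0) = 0) {t : ℝ} (ht : 0 ≤ t) :
    queueLaw κ lam B ν t (Set.Iio 0) = 0 := by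
  rw [queueLaw, Measure.map_apply_of_aemeasurable (aemeasurable_workload κ hlam hB hν ht)
    measurableSet_Iio, measure_eq_zero_iff_ae_notMem]
  filter_upwards [ae_regular_prod hlam hB hν ht] with z hz
  simpa using workload_nonneg κ hz.2 hz.1 ht

theorem jumpOp_tsum (κ : QueueKind) (lam : ℝ) (B : Measure ℝ) (n : ℕ) (t : ℝ)
    {f : ℕ → ℝ → ℝ≥0∞} (hf : ∀ l, Measurable (f l)) (q : ℝ) :
    jumpOp κ lam B n t (fun x => ∑' l, f l x) q = ∑' l, jumpOp κ lam B n t (f l) q := by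
  unfold jumpOp
  rw [← lintegral_tsum fun l => (measurable_indicator_afterJumps_right κ n (hf l) t q).aemeasurable]
  refine lintegral_congr fun ω => ?_
  by_cases h : HasJumps n ω.1 t
  · simp only [indicator_hasJumps h]
  · simp only [indicator_not_hasJumps h, tsum_zero]

/-- The Markov property of the queue. -/
theorem queueLaw_queueLaw (κ : QueueKind) {lam : ℝ} (hlam : 0 < lam) {B : Measure ℝ}
    [IsProbabilityMeasure B] (hB : B (Set.Iic 0) = 0) {ν : Measure ℝ} [IsProbabilityMeasure ν]
    (hν : ν (Set.Iio 0) = 0) {s t : ℝ} (hs : 0 ≤ s) (ht : 0 ≤ t) :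
    queueLaw κ lam B (queueLaw κ lam B ν s) t = queueLaw κ lam B ν (s + t) := by
  have := isProbabilityMeasure_queueLaw κ hlam hB hν hs
  refine Measure.ext_of_lintegral _ fun f hf => ?_
  have hm := fun l => measurable_jumpOp_right κ hlam B l t hf
  rw [lintegral_queueLaw κ hlam hB (queueLaw_Iio_zero κ hlam hB hν hs) ht hf,
    lintegral_queueLaw κ hlam hB hν (add_nonneg hs ht) hf,
    lintegral_queueLaw κ hlam hB hν hs (Measurable.tsum hm)]
  refine lintegral_congr fun q => ?_
  simp only [jumpOp_add κ hlam B _ hs ht hf]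
  have h1 := fun k => jumpOp_tsum κ lam B k s hm q
  simp only [h1]
  rw [← ENNReal.tsum_prod, ← Finset.HasAntidiagonal.sigmaAntidiagonalEquivProd.tsum_eq,
    ENNReal.tsum_sigma']
  refine tsum_congr fun n => ?_
  rw [tsum_fintype]
  exact Finset.sum_coe_sort (Finset.HasAntidiagonal.antidiagonal n) fun kl =>
    jumpOp κ lam B kl.1 s (jumpOp κ lam B kl.2 t f) q

theorem queueLaw_sum (κ : QueueKind) {lam : ℝ} (hlam : 0 < lam) {B : Measure ℝ}
    [IsProbabilityMeasure B] (hB : B (Set.Iic 0) = 0) {ι : Type*} [Fintype ι] (c : ι → ℝ≥0∞)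
    (ν : ι → Measure ℝ) [∀ i, IsProbabilityMeasure (ν i)] (hν : ∀ i, ν i (Set.Iio 0) = 0)
    [SFinite (∑ i, c i • ν i)] {t : ℝ} (ht : 0 ≤ t) :
    queueLaw κ lam B (∑ i, c i • ν i) t = ∑ i, c i • queueLaw κ lam B (ν i) t := by
  have h0 : (∑ i, c i • ν i) (Set.Iio 0) = 0 := by
    simp [Measure.finsetSum_apply, hν]
  refine Measure.ext_of_lintegral _ fun f hf => ?_
  rw [lintegral_queueLaw κ hlam hB h0 ht hf, lintegral_finsetSum_measure,
    lintegral_finsetSum_measure]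
  refine Finset.sum_congr rfl fun i _ => ?_
  rw [lintegral_smul_measure, lintegral_smul_measure, lintegral_queueLaw κ hlam hB (hν i) ht hf]

theorem queueLaw_zero (κ : QueueKind) {lam : ℝ} (hlam : 0 < lam) {B : Measure ℝ}
    [IsProbabilityMeasure B] (hB : B (Set.Iic 0) = 0) {ν : Measure ℝ} [SFinite ν]
    (hν : ν (Set.Iio 0) = 0) : queueLaw κ lam B ν 0 = ν := by
  refine Measure.ext_of_lintegral _ fun f hf => ?_
  rw [lintegral_queueLaw κ hlam hB hν le_rfl hf]
  refine lintegral_congr_ae ?_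
  filter_upwards [ae_nonneg_of_measure_Iio hν] with q hq
  rw [tsum_eq_single 0]
  · rw [jumpOp_zero κ hlam B _ hf, expMeasure_Ioi hlam le_rfl]
    cases κ <;> simp [drift, hq]
  · intro n hn
    obtain ⟨m, rfl⟩ := Nat.exists_eq_succ_of_ne_zero hn
    rw [jumpOp_succ κ hlam B _ _ hf, setLIntegral_expMeasure_Iic hlam le_rfl _
      (measurable_lintegral_jumpOp κ hlam B m hf _ _)]
    simp

/-- Two queues with the same input never move apart, whatever their initial contents are. -/
theorem wd_queueLaw_le (κ : QueueKind) {lam : ℝ} (hlam : 0 < lam) {B : Measure ℝ}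
    [IsProbabilityMeasure B] (hB : B (Set.Iic 0) = 0) {μ ν : Measure ℝ} [IsProbabilityMeasure μ]
    [IsProbabilityMeasure ν] (hμ : μ (Set.Iio 0) = 0) (hν : ν (Set.Iio 0) = 0) {t : ℝ}
    (ht : 0 ≤ t) : WD (queueLaw κ lam B μ t) (queueLaw κ lam B ν t) ≤ WD μ ν := by
  have := isProbabilityMeasure_noiseLaw hlam B
  refine le_iInf₂ fun γ hγ => ?_
  have : IsProbabilityMeasure γ := by
    constructor
    rw [← Set.preimage_univ (f := Prod.snd), ← Measure.map_apply measurable_snd .univ, hγ.2,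
      measure_univ]
  have h1 : (γ.prod (noiseLaw lam B)).map (Prod.map Prod.fst id) = μ.prod (noiseLaw lam B) := by
    rw [← Measure.map_prod_map _ _ measurable_fst measurable_id, hγ.1, Measure.map_id]
  have h2 : (γ.prod (noiseLaw lam B)).map (Prod.map Prod.snd id) = ν.prod (noiseLaw lam B) := by
    rw [← Measure.map_prod_map _ _ measurable_snd measurable_id, hγ.2, Measure.map_id]
  have m1 := aemeasurable_workload κ hlam hB hμ ht
  have m2 := aemeasurable_workload κ hlam hB hν ht
  rw [← h1] at m1
  rw [← h2] at m2
  rw [queueLaw, queueLaw, ← h1, ← h2, AEMeasurable.map_map_of_aemeasurable m1 (by fun_prop),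
    AEMeasurable.map_map_of_aemeasurable m2 (by fun_prop)]
  refine (wd_map_le _ (m1.comp_aemeasurable (by fun_prop))
    (m2.comp_aemeasurable (by fun_prop))).trans ?_
  calc _ ≤ ∫⁻ z, ENNReal.ofReal |z.1.1 - z.1.2| ∂γ.prod (noiseLaw lam B) := by
        refine lintegral_mono fun z => ENNReal.ofReal_le_ofReal ?_
        simp only [Function.comp_apply, Prod.map_fst, Prod.map_snd, id, workload,
          add_sub_add_left_eq_sub]
        exact (abs_max_sub_max_le_abs _ _ _)
    _ = _ := by
        rw [lintegral_prod _ (by fun_prop)]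
        simp

/-! ### The cells -/

theorem cell_zero (Δ : ℝ) : cell Δ 0 = Measure.dirac 0 := if_pos rfl

theorem lintegral_cell {Δ : ℝ} (hΔ : 0 < Δ) {i : ℕ} (hi : i ≠ 0) (f : ℝ → ℝ≥0∞) :
    ∫⁻ x, f x ∂cell Δ i =
      ENNReal.ofReal Δ⁻¹ * ∫⁻ x in Set.Icc (((i : ℝ) - 1) * Δ) (i * Δ), f x := by
  rw [cell, if_neg hi, ProbabilityTheory.cond, lintegral_smul_measure, Real.volume_Icc,
    smul_eq_mul, ENNReal.ofReal_inv_of_pos hΔ]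
  congr 3
  ring

theorem isProbabilityMeasure_cell {Δ : ℝ} (hΔ : 0 < Δ) (i : ℕ) :
    IsProbabilityMeasure (cell Δ i) := by
  rcases eq_or_ne i 0 with rfl | hi
  · rw [cell_zero]
    infer_instance
  · constructor
    rw [← lintegral_one, lintegral_cell hΔ hi, setLIntegral_one, Real.volume_Icc,
      ← ENNReal.ofReal_mul (by positivity)]
    rw [show Δ⁻¹ * ((i : ℝ) * Δ - ((i : ℝ) - 1) * Δ) = 1 by field_simp; ring, ENNReal.ofReal_one]

theorem ae_cell {Δ : ℝ} (hΔ : 0 < Δ) (i : ℕ) :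
    ∀ᵐ x ∂cell Δ i, 0 ≤ x ∧ ((i : ℝ) - 1) * Δ ≤ x ∧ x ≤ i * Δ := by
  rcases eq_or_ne i 0 with rfl | hi
  · rw [cell_zero, ae_dirac_iff]
    · simp [hΔ.le]
    · exact measurableSet_Ici.inter (measurableSet_Ici.inter measurableSet_Iic)
  · rw [cell, if_neg hi]
    filter_upwards [ae_cond_mem measurableSet_Icc] with x hx
    refine ⟨le_trans ?_ hx.1, hx.1, hx.2⟩
    have : (1 : ℝ) ≤ i := by exact_mod_cast Nat.one_le_iff_ne_zero.2 hi
    exact mul_nonneg (by linarith) hΔ.le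

theorem cell_Iio_zero {Δ : ℝ} (hΔ : 0 < Δ) (i : ℕ) : cell Δ i (Set.Iio 0) = 0 := by
  rw [measure_eq_zero_iff_ae_notMem]
  filter_upwards [ae_cell hΔ i] with x hx
  simpa using hx.1

/-! ### Decomposition by the number of jumps in one step -/

/-- The content of the queue at time `Δ`, if there is exactly one jump up to time `Δ`, at time `u`
and of size `b`. -/
def oneJumpPos (κ : QueueKind) (Δ q u b : ℝ) : ℝ := drift κ (Δ - u) (jump κ (drift κ u q) b)

/-- The law of `Q_Δ` given exactly one jump in `[0, Δ]`, if `Q_0` has law `ν`: the time of the jump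
is uniformly distributed on `[0, Δ]`. -/
def oneJumpLaw (κ : QueueKind) (Δ : ℝ) (B ν : Measure ℝ) : Measure ℝ :=
  (ν.prod ((cell Δ 1).prod B)).map fun z => oneJumpPos κ Δ z.1 z.2.1 z.2.2

/-- The event of at least two jumps up to time `t`. -/
def manyJumps (t : ℝ) : Set Noise :=
  ({ω : Noise | HasJumps 0 ω.1 t} ∪ {ω : Noise | HasJumps 1 ω.1 t})ᶜ

/-- The law of `Q_t` restricted to the event of at least two jumps up to time `t`. -/
def manyJumpsLaw (κ : QueueKind) (lam : ℝ) (B ν : Measure ℝ) (t : ℝ) : Measure ℝ :=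
  (ν.prod ((noiseLaw lam B).restrict (manyJumps t))).map fun z => workload (netInput κ z.2) z.1 t

theorem measurable_oneJumpPos (κ : QueueKind) (Δ : ℝ) :
    Measurable fun z : ℝ × ℝ × ℝ => oneJumpPos κ Δ z.1 z.2.1 z.2.2 := by
  cases κ <;> (unfold oneJumpPos drift jump; fun_prop)

theorem measurableSet_manyJumps (t : ℝ) : MeasurableSet (manyJumps t) :=
  ((measurableSet_hasJumps_noise 0 t).union (measurableSet_hasJumps_noise 1 t)).compl

theorem isProbabilityMeasure_oneJumpLaw (κ : QueueKind) {Δ : ℝ} (hΔ : 0 < Δ) (B ν : Measure ℝ)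
    [IsProbabilityMeasure B] [IsProbabilityMeasure ν] :
    IsProbabilityMeasure (oneJumpLaw κ Δ B ν) := by
  have := isProbabilityMeasure_cell hΔ 1
  exact Measure.isProbabilityMeasure_map (measurable_oneJumpPos κ Δ).aemeasurable

theorem lintegral_oneJumpLaw (κ : QueueKind) {Δ : ℝ} (hΔ : 0 < Δ) (B ν : Measure ℝ)
    [IsProbabilityMeasure B] [SFinite ν] {f : ℝ → ℝ≥0∞} (hf : Measurable f) :
    ∫⁻ x, f x ∂oneJumpLaw κ Δ B ν =
      ∫⁻ q, ∫⁻ u, ∫⁻ b, f (oneJumpPos κ Δ q u b) ∂B ∂cell Δ 1 ∂ν := by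
  have := isProbabilityMeasure_cell hΔ 1
  have hm := hf.comp (measurable_oneJumpPos κ Δ)
  rw [oneJumpLaw, lintegral_map hf (measurable_oneJumpPos κ Δ),
    lintegral_prod _ (by exact hm.aemeasurable)]
  refine lintegral_congr fun q => ?_
  rw [lintegral_prod _ (by exact (hm.comp measurable_prodMk_left).aemeasurable)]

theorem jumpOp_one (κ : QueueKind) {lam : ℝ} (hlam : 0 < lam) (B : Measure ℝ)
    [IsProbabilityMeasure B] {Δ : ℝ} (hΔ : 0 < Δ) {f : ℝ → ℝ≥0∞} (hf : Measurable f) (q : ℝ) :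
    jumpOp κ lam B 1 Δ f q = ENNReal.ofReal (lam * Δ * Real.exp (-(lam * Δ))) *
      ∫⁻ u, ∫⁻ b, f (oneJumpPos κ Δ q u b) ∂B ∂cell Δ 1 := by
  have hm : Measurable fun z : ℝ × ℝ => f (oneJumpPos κ Δ q z.1 z.2) :=
    (hf.comp (measurable_oneJumpPos κ Δ)).comp measurable_prodMk_left
  rw [jumpOp_succ κ hlam B _ _ hf, setLIntegral_expMeasure_Iic hlam hΔ.le _
    (measurable_lintegral_jumpOp κ hlam B 0 hf _ _), lintegral_cell hΔ one_ne_zero, ← mul_assoc,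
    ← ENNReal.ofReal_mul (by positivity), Nat.cast_one, sub_self, zero_mul, one_mul,
    restrict_Ioc_eq_restrict_Icc, ← lintegral_const_mul _ (Measurable.lintegral_prod_right' hm)]
  refine setLIntegral_congr_fun measurableSet_Icc fun u hu => ?_
  simp only [jumpOp_zero κ hlam B _ hf, expMeasure_Ioi hlam (sub_nonneg.2 hu.2)]
  rw [lintegral_const_mul _ (by exact hm.comp measurable_prodMk_left), ← mul_assoc,
    ← ENNReal.ofReal_mul (by positivity), mul_assoc lam, ← Real.exp_add]
  congr 2
  rw [show -(lam * u) + -(lam * (Δ - u)) = -(lam * Δ) by ring]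
  field_simp

/-- `F` may depend on the initial content and on the noise, so that the queue can be compared with
its own starting point. -/
theorem lintegral_manyJumps (κ : QueueKind) {lam : ℝ} (hlam : 0 < lam) {B : Measure ℝ}
    [IsProbabilityMeasure B] (hB : B (Set.Iic 0) = 0) {ν : Measure ℝ} [SFinite ν]
    (hν : ν (Set.Iio 0) = 0) {t : ℝ} (ht : 0 ≤ t) (F : ℝ × Noise → ℝ → ℝ≥0∞)
    (hF : ∀ n, Measurable fun z : ℝ × Noise => F z (afterJumps κ n z.2 z.1 t)) :
    ∫⁻ z, F z (workload (netInput κ z.2) z.1 t)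
        ∂ν.prod ((noiseLaw lam B).restrict (manyJumps t)) =
      ∑' n, ∫⁻ z, {ω : Noise | HasJumps (n + 2) ω.1 t}.indicator
        (fun ω => F (z.1, ω) (afterJumps κ (n + 2) ω z.1 t)) z.2 ∂ν.prod (noiseLaw lam B) := by
  have := isProbabilityMeasure_noiseLaw hlam B
  have hm : ∀ n, Measurable fun z : ℝ × Noise => {ω : Noise | HasJumps n ω.1 t}.indicator
      (fun ω => F (z.1, ω) (afterJumps κ n ω z.1 t)) z.2 := fun n =>
    (hF n).indicator ((measurableSet_hasJumps_noise n t).preimage measurable_snd)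
  rw [← lintegral_tsum fun n => (hm (n + 2)).aemeasurable, ← Measure.restrict_univ (μ := ν),
    Measure.prod_restrict, Measure.restrict_univ,
    ← lintegral_indicator (MeasurableSet.univ.prod (measurableSet_manyJumps t))]
  refine lintegral_congr_ae ?_
  filter_upwards [ae_regular_prod hlam hB hν ht] with z hz
  obtain ⟨n, hn⟩ := hz.2.exists_hasJumps
  by_cases h2 : 2 ≤ n
  · obtain ⟨m, rfl⟩ := Nat.exists_eq_add_of_le' h2
    have hz2 : z ∈ Set.univ ×ˢ manyJumps t := by
      refine ⟨Set.mem_univ _, ?_⟩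
      rintro (h | h)
      · exact absurd (hn.eq h) (by omega)
      · exact absurd (hn.eq h) (by omega)
    rw [Set.indicator_of_mem hz2, tsum_eq_single m fun k hk => indicator_not_hasJumps
      (fun h => hk (by have := h.eq hn; omega)) _, indicator_hasJumps hn,
      workload_eq_afterJumps κ hz.2.gap_pos hz.2.size_pos hz.1 ht hn]
  · have hz2 : z ∉ Set.univ ×ˢ manyJumps t := by
      rintro ⟨-, h⟩
      apply h
      obtain rfl | rfl : n = 0 ∨ n = 1 := by omega
      · exact Or.inl hn
      · exact Or.inr hn
    rw [Set.indicator_of_notMem hz2]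
    refine (ENNReal.tsum_eq_zero.2 fun k => indicator_not_hasJumps (fun h => ?_) _).symm
    have := h.eq hn
    omega

theorem aemeasurable_workload_manyJumps (κ : QueueKind) {lam : ℝ} (hlam : 0 < lam) {B : Measure ℝ}
    [IsProbabilityMeasure B] (hB : B (Set.Iic 0) = 0) {ν : Measure ℝ} [SFinite ν]
    (hν : ν (Set.Iio 0) = 0) {t : ℝ} (ht : 0 ≤ t) :
    AEMeasurable (fun z : ℝ × Noise => workload (netInput κ z.2) z.1 t)
      (ν.prod ((noiseLaw lam B).restrict (manyJumps t))) := by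
  have := isProbabilityMeasure_noiseLaw hlam B
  rw [← Measure.restrict_univ (μ := ν), Measure.prod_restrict]
  exact (aemeasurable_workload κ hlam hB hν ht).restrict

/-- The law of the queue at time `Δ`, split into the cases of no jump, of exactly one jump, and of
two or more jumps. -/
theorem queueLaw_eq_add (κ : QueueKind) {lam : ℝ} (hlam : 0 < lam) {B : Measure ℝ}
    [IsProbabilityMeasure B] (hB : B (Set.Iic 0) = 0) {ν : Measure ℝ} [IsProbabilityMeasure ν]
    (hν : ν (Set.Iio 0) = 0) {Δ : ℝ} (hΔ : 0 < Δ) :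
    queueLaw κ lam B ν Δ = ENNReal.ofReal (Real.exp (-(lam * Δ))) • ν.map (drift κ Δ) +
      ENNReal.ofReal (lam * Δ * Real.exp (-(lam * Δ))) • oneJumpLaw κ Δ B ν +
      manyJumpsLaw κ lam B ν Δ := by
  have := isProbabilityMeasure_noiseLaw hlam B
  have hd : Measurable (drift κ Δ) := (measurable_drift κ).comp measurable_prodMk_left
  refine Measure.ext_of_lintegral _ fun f hf => ?_
  have hm := fun n => measurable_jumpOp_right κ hlam B n Δ hf
  rw [lintegral_add_measure, lintegral_add_measure, lintegral_smul_measure, lintegral_smul_measure,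
    lintegral_queueLaw κ hlam hB hν hΔ.le hf, lintegral_tsum fun n => (hm n).aemeasurable,
    ← (ENNReal.summable.sum_add_tsum_nat_add' (k := 2)), Finset.sum_range_succ,
      Finset.sum_range_one]
  congr 2
  · rw [lintegral_map hf hd, smul_eq_mul, ← lintegral_const_mul _ (by fun_prop)]
    simp only [jumpOp_zero κ hlam B _ hf, expMeasure_Ioi hlam hΔ.le]
  · rw [lintegral_oneJumpLaw κ hΔ B ν hf, smul_eq_mul, ← lintegral_const_mul']
    · simp only [jumpOp_one κ hlam B hΔ hf]
    · exact ENNReal.ofReal_ne_top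
  · rw [manyJumpsLaw, lintegral_map' hf.aemeasurable
      (aemeasurable_workload_manyJumps κ hlam hB hν hΔ.le),
      lintegral_manyJumps κ hlam hB hν hΔ.le (fun _ => f) fun n => ?_]
    · refine tsum_congr fun n => ?_
      rw [lintegral_prod]
      · rfl
      · exact ((measurable_indicator_afterJumps κ (n + 2) hf).comp
          (by fun_prop : Measurable fun z : ℝ × Noise => ((Δ, z.1), z.2))).aemeasurable
    · exact hf.comp ((measurable_afterJumps κ n).comp
        (by fun_prop : Measurable fun z : ℝ × Noise => (z.2, z.1, Δ)))

/-! ### The error of ignoring two or more jumps -/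

theorem afterJumps_mem_mg1 {n : ℕ} {ω : Noise} {q t : ℝ} (hb : ∀ m, 0 ≤ ω.2 m) (hg : ∀ m, 0 ≤ ω.1 m)
    (hq : 0 ≤ q) (ht : 0 ≤ t) (h : HasJumps n ω.1 t) : afterJumps .mg1 n ω q t ∈
      Set.Icc (q - t + ∑ m ∈ Finset.range n, ω.2 m) (q + ∑ m ∈ Finset.range n, ω.2 m) := by
  induction n generalizing ω q t with
  | zero =>
    simp only [afterJumps, drift, Finset.range_zero, Finset.sum_empty, add_zero, Set.mem_Icc,
      le_max_left, max_le_iff, hq, and_true, true_and]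
    linarith
  | succ n ih =>
    have hd0 := drift_nonneg .mg1 (hg 0) hq
    have := ih (ω := (fun m => ω.1 (m + 1), fun m => ω.2 (m + 1))) (fun m => hb (m + 1))
        (fun m => hg (m + 1))
      (jump_nonneg .mg1 hd0 (hb 0)) (sub_nonneg.2 h.1) h.2
    have h1 : q - ω.1 0 ≤ drift .mg1 (ω.1 0) q := le_max_left _ _
    have h2 : drift .mg1 (ω.1 0) q ≤ q := max_le (by have := hg 0; linarith) hq
    rw [Finset.sum_range_succ']
    simp only [jump, Set.mem_Icc] at this
    constructor
    · refine le_trans ?_ this.1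
      linarith
    · refine le_trans this.2 ?_
      linarith

theorem afterJumps_mem_specNeg {n : ℕ} {ω : Noise} {q t : ℝ} (hb : ∀ m, 0 ≤ ω.2 m)
    (hg : ∀ m, 0 ≤ ω.1 m) (hq : 0 ≤ q) (h : HasJumps n ω.1 t) :
    afterJumps .specNeg n ω q t ∈ Set.Icc (q + t - ∑ m ∈ Finset.range n, ω.2 m) (q + t) := by
  induction n generalizing ω q t with
  | zero => simp [afterJumps, drift]
  | succ n ih =>
    have hd0 := drift_nonneg .specNeg (hg 0) hq
    have := ih (ω := (fun m => ω.1 (m + 1), fun m => ω.2 (m + 1))) (fun m => hb (m + 1))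
        (fun m => hg (m + 1))
      (jump_nonneg .specNeg hd0 (hb 0)) h.2
    have h1 : drift .specNeg (ω.1 0) q - ω.2 0 ≤ jump .specNeg (drift .specNeg (ω.1 0) q) (ω.2 0) :=
      le_max_left _ _
    have h2 : jump .specNeg (drift .specNeg (ω.1 0) q) (ω.2 0) ≤ drift .specNeg (ω.1 0) q :=
      max_le (by have := hb 0; linarith) hd0
    rw [Finset.sum_range_succ']
    simp only [drift] at h1 h2
    constructor
    · refine le_trans ?_ this.1
      simp only [drift]
      linarith
    · refine le_trans this.2 ?_
      simp only [drift]
      linarith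

/-- The drift can carry the workload away from `q` by up to `t`. The constant `c` makes up for jump
sizes whose sum may fall short of `t`; it can be `0` if every jump is at least `t / 2` and `2 ≤ n`.
-/
theorem abs_afterJumps_sub_le (κ : QueueKind) {n : ℕ} {ω : Noise} {q t : ℝ} (hb : ∀ m, 0 ≤ ω.2 m)
    (hg : ∀ m, 0 ≤ ω.1 m) (hq : 0 ≤ q) (ht : 0 ≤ t) (h : HasJumps n ω.1 t) {c : ℝ} (hc : 0 ≤ c)
    (htc : t ≤ ∑ m ∈ Finset.range n, ω.2 m + c) :
    |afterJumps κ n ω q t - q| ≤ ∑ m ∈ Finset.range n, ω.2 m + c := by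
  have hS : 0 ≤ ∑ m ∈ Finset.range n, ω.2 m := Finset.sum_nonneg fun m _ => hb m
  cases κ
  · have := afterJumps_mem_mg1 hb hg hq ht h
    rw [abs_le]
    constructor <;> linarith [this.1, this.2]
  · have := afterJumps_mem_specNeg hb hg hq h
    rw [abs_le]
    constructor <;> linarith [this.1, this.2]

theorem noiseLaw_manyJumps {lam : ℝ} (hlam : 0 < lam) (B : Measure ℝ) [IsProbabilityMeasure B]
    {t : ℝ} (ht : 0 ≤ t) : noiseLaw lam B (manyJumps t) =
      ENNReal.ofReal (1 - (1 + lam * t) * Real.exp (-(lam * t))) := by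
  have := isProbabilityMeasure_noiseLaw hlam B
  have hx := mul_nonneg hlam.le ht
  rw [manyJumps, prob_compl_eq_one_sub
    ((measurableSet_hasJumps_noise 0 t).union (measurableSet_hasJumps_noise 1 t)),
    measure_union (Set.disjoint_left.2 fun ω h h' => absurd (h.eq h') (by omega))
      (measurableSet_hasJumps_noise 1 t), noiseLaw_hasJumps hlam B _ ht,
    noiseLaw_hasJumps hlam B _ ht, ← ENNReal.ofReal_add (by positivity) (by positivity),
    ← ENNReal.ofReal_one, ← ENNReal.ofReal_sub _ (by positivity)]
  congr 1
  simp
  ring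

/-- The jump sizes are independent of the number of jumps up to a fixed time. -/
theorem lintegral_sum_sizes {lam : ℝ} (hlam : 0 < lam) (B : Measure ℝ) [IsProbabilityMeasure B]
    (n : ℕ) {t : ℝ} (ht : 0 ≤ t) :
    ∫⁻ ω, {ω : Noise | HasJumps n ω.1 t}.indicator
        (fun ω => ∑ m ∈ Finset.range n, ENNReal.ofReal (ω.2 m)) ω ∂noiseLaw lam B =
      n * ENNReal.ofReal (Real.exp (-(lam * t)) * (lam * t) ^ n / n.factorial) * meanJump B := by
  have := isProbabilityMeasure_expMeasure hlam
  have hms : MeasurableSet {g : ℕ → ℝ | HasJumps n g t} :=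
    (measurableSet_hasJumps n).preimage measurable_prodMk_right
  have h1 : Measurable ({g : ℕ → ℝ | HasJumps n g t}.indicator fun _ => (1 : ℝ≥0∞)) :=
    measurable_const.indicator hms
  have h2 : Measurable fun b : ℕ → ℝ => ∑ m ∈ Finset.range n, ENNReal.ofReal (b m) := by fun_prop
  have hpr : Measure.infinitePi (fun _ : ℕ => expMeasure lam) {g | HasJumps n g t} =
      ENNReal.ofReal (Real.exp (-(lam * t)) * (lam * t) ^ n / n.factorial) := by
    rw [← noiseLaw_hasJumps hlam B n ht, noiseLaw,
      show {ω : Noise | HasJumps n ω.1 t} = {g | HasJumps n g t} ×ˢ Set.univ by ext; simp,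
      Measure.prod_prod, measure_univ, mul_one]
  have hint : ∫⁻ b : ℕ → ℝ, ∑ m ∈ Finset.range n, ENNReal.ofReal (b m)
      ∂Measure.infinitePi (fun _ : ℕ => B) = n * meanJump B := by
    rw [lintegral_finsetSum _ fun m _ => by fun_prop]
    have : ∀ m ∈ Finset.range n, ∫⁻ b : ℕ → ℝ, ENNReal.ofReal (b m)
        ∂Measure.infinitePi (fun _ : ℕ => B) = meanJump B := fun m _ =>
      (measurePreserving_eval_infinitePi (fun _ : ℕ => B) m).lintegral_comp (by fun_prop)
    rw [Finset.sum_congr rfl this, Finset.sum_const, Finset.card_range, nsmul_eq_mul]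
  calc _ = ∫⁻ ω : Noise, {g : ℕ → ℝ | HasJumps n g t}.indicator (fun _ => (1 : ℝ≥0∞)) ω.1 *
        ∑ m ∈ Finset.range n, ENNReal.ofReal (ω.2 m) ∂noiseLaw lam B := by
        refine lintegral_congr fun ω => ?_
        by_cases h : HasJumps n ω.1 t
        · rw [indicator_hasJumps h,
            Set.indicator_of_mem (s := {g : ℕ → ℝ | HasJumps n g t}) h, one_mul]
        · rw [indicator_not_hasJumps h,
            Set.indicator_of_notMem (s := {g : ℕ → ℝ | HasJumps n g t}) h, zero_mul]
    _ = _ := by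
        rw [noiseLaw, lintegral_prod_mul h1.aemeasurable h2.aemeasurable,
          lintegral_indicator_const hms, one_mul, hpr, hint]
        ring

theorem tsum_poisson_mul {lam : ℝ} (hlam : 0 < lam) {t : ℝ} (ht : 0 ≤ t) :
    ∑' n : ℕ, ((n + 2 : ℕ) : ℝ≥0∞) * ENNReal.ofReal
        (Real.exp (-(lam * t)) * (lam * t) ^ (n + 2) / (n + 2).factorial) =
      ENNReal.ofReal (lam * t * (1 - Real.exp (-(lam * t)))) := by
  have hx := mul_nonneg hlam.le ht
  have hs : HasSum (fun n : ℕ => Real.exp (-(lam * t)) * (lam * t) ^ (n + 1) / (n + 1).factorial)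
      (1 - Real.exp (-(lam * t))) := by
    have := (hasSum_nat_add_iff' 1).2 (hasSum_poisson lam t)
    simpa using this
  have hs' := hs.mul_left (lam * t)
  rw [← hs'.tsum_eq, ENNReal.ofReal_tsum_of_nonneg (fun n => by positivity) hs'.summable]
  refine tsum_congr fun n => ?_
  rw [← ENNReal.ofReal_natCast, ← ENNReal.ofReal_mul (by positivity)]
  congr 1
  rw [Nat.factorial_succ (n + 1)]
  push_cast
  field_simp
  ring

/-- On the event of two or more jumps, the queue is compared with its initial content. -/
theorem wd_manyJumpsLaw_le (κ : QueueKind) {lam : ℝ} (hlam : 0 < lam) {B : Measure ℝ}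
    [IsProbabilityMeasure B] (hB : B (Set.Iic 0) = 0) {ν : Measure ℝ} [IsProbabilityMeasure ν]
    (hν : ν (Set.Iio 0) = 0) {t : ℝ} (ht : 0 ≤ t) :
    WD (manyJumpsLaw κ lam B ν t) (noiseLaw lam B (manyJumps t) • ν) ≤
      ∫⁻ z, ENNReal.ofReal |workload (netInput κ z.2) z.1 t - z.1|
        ∂ν.prod ((noiseLaw lam B).restrict (manyJumps t)) := by
  have := isProbabilityMeasure_noiseLaw hlam B
  have h : noiseLaw lam B (manyJumps t) • ν =
      (ν.prod ((noiseLaw lam B).restrict (manyJumps t))).map Prod.fst := by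
    rw [Measure.map_fst_prod, Measure.restrict_apply_univ]
  rw [h]
  exact wd_map_le _ (aemeasurable_workload_manyJumps κ hlam hB hν ht) measurable_fst.aemeasurable

/-- The bound in terms of the mean jump size; `c` is any constant that makes up for small jumps. -/
theorem wd_manyJumpsLaw_le_meanJump (κ : QueueKind) {lam : ℝ} (hlam : 0 < lam) {B : Measure ℝ}
    [IsProbabilityMeasure B] (hB : B (Set.Iic 0) = 0) {ν : Measure ℝ} [IsProbabilityMeasure ν]
    (hν : ν (Set.Iio 0) = 0) {t : ℝ} (ht : 0 ≤ t) {c : ℝ} (hc : 0 ≤ c)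
    (htc : ∀ᵐ b ∂B, t ≤ 2 * b + c) :
    WD (manyJumpsLaw κ lam B ν t) (noiseLaw lam B (manyJumps t) • ν) ≤
      ENNReal.ofReal (lam * t * (1 - Real.exp (-(lam * t)))) * meanJump B +
        ENNReal.ofReal c * noiseLaw lam B (manyJumps t) := by
  have := isProbabilityMeasure_noiseLaw hlam B
  refine (wd_manyJumpsLaw_le κ hlam hB hν ht).trans ?_
  have hmS : ∀ n, Measurable fun z : ℝ × Noise => {ω : Noise | HasJumps n ω.1 t}.indicator
      (fun ω => ∑ m ∈ Finset.range n, ENNReal.ofReal (ω.2 m)) z.2 := fun n =>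
    ((by fun_prop : Measurable fun ω : Noise => ∑ m ∈ Finset.range n,
      ENNReal.ofReal (ω.2 m)).indicator (measurableSet_hasJumps_noise n t)).comp measurable_snd
  rw [lintegral_manyJumps κ hlam hB hν ht (fun z x => ENNReal.ofReal |x - z.1|) fun n => by
    have := (measurable_afterJumps κ n).comp
      (by fun_prop : Measurable fun z : ℝ × Noise => (z.2, z.1, t))
    exact ((this.sub measurable_fst).abs).ennreal_ofReal]
  have hconst : ENNReal.ofReal c * noiseLaw lam B (manyJumps t) = ∑' n,
      ∫⁻ z, {ω : Noise | HasJumps (n + 2) ω.1 t}.indicator (fun _ => ENNReal.ofReal c) z.2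
        ∂ν.prod (noiseLaw lam B) := by
    rw [← lintegral_manyJumps κ hlam hB hν ht (fun _ _ => ENNReal.ofReal c)
      fun n => measurable_const, lintegral_const, ← Set.univ_prod_univ, Measure.prod_prod,
      measure_univ, one_mul, Measure.restrict_apply_univ]
  have hmean : ENNReal.ofReal (lam * t * (1 - Real.exp (-(lam * t)))) * meanJump B = ∑' n,
      ∫⁻ z, {ω : Noise | HasJumps (n + 2) ω.1 t}.indicator
        (fun ω => ∑ m ∈ Finset.range (n + 2), ENNReal.ofReal (ω.2 m)) z.2
        ∂ν.prod (noiseLaw lam B) := by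
    rw [← tsum_poisson_mul hlam ht, ← ENNReal.tsum_mul_right]
    refine tsum_congr fun n => ?_
    rw [← lintegral_sum_sizes hlam B (n + 2) ht, lintegral_prod _ (hmS _).aemeasurable]
    dsimp only
    rw [lintegral_const, measure_univ, mul_one]
  rw [hconst, hmean, ← ENNReal.tsum_add]
  refine ENNReal.tsum_le_tsum fun n => ?_
  rw [← lintegral_add_left (hmS _)]
  refine lintegral_mono_ae ?_
  filter_upwards [ae_regular_prod hlam hB hν ht,
    Measure.quasiMeasurePreserving_snd.ae (ae_size hlam B htc)] with z hz hz'
  by_cases h : HasJumps (n + 2) z.2.1 t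
  · have hb := fun m => (hz.2.size_pos m).le
    rw [indicator_hasJumps h, indicator_hasJumps h, indicator_hasJumps h,
      ← ENNReal.ofReal_sum_of_nonneg fun m _ => hb m,
      ← ENNReal.ofReal_add (Finset.sum_nonneg fun m _ => hb m) hc]
    refine ENNReal.ofReal_le_ofReal (abs_afterJumps_sub_le κ hb (fun m => (hz.2.gap_pos m).le) hz.1
      ht h hc ?_)
    -- two jumps of size at least `(t - c) / 2` add up to at least `t - c`
    have h2 : z.2.2 0 + z.2.2 1 ≤ ∑ m ∈ Finset.range (n + 2), z.2.2 m := by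
      rw [← Finset.sum_range_add_sum_Ico _ (by omega : 2 ≤ n + 2), Finset.sum_range_succ,
        Finset.sum_range_one]
      exact le_add_of_nonneg_right (Finset.sum_nonneg fun m _ => hb m)
    linarith [hz' 0, hz' 1]
  · rw [indicator_not_hasJumps h]
    exact zero_le

/-- The bound in terms of the truncation point, for downward jumps. -/
theorem wd_manyJumpsLaw_specNeg_le {lam : ℝ} (hlam : 0 < lam) {B : Measure ℝ}
    [IsProbabilityMeasure B] (hB : B (Set.Iic 0) = 0) {ν : Measure ℝ} [IsProbabilityMeasure ν]
    (hν : ν (Set.Iio 0) = 0) {t : ℝ} (ht : 0 ≤ t) {M : ℝ} (hM : ∀ᵐ q ∂ν, q ≤ M) :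
    WD (manyJumpsLaw .specNeg lam B ν t) (noiseLaw lam B (manyJumps t) • ν) ≤
      ENNReal.ofReal (M + t) * noiseLaw lam B (manyJumps t) := by
  have := isProbabilityMeasure_noiseLaw hlam B
  refine (wd_manyJumpsLaw_le .specNeg hlam hB hν ht).trans ?_
  have hle : ∀ᵐ z ∂ν.prod ((noiseLaw lam B).restrict (manyJumps t)),
      ENNReal.ofReal |workload (netInput .specNeg z.2) z.1 t - z.1| ≤ ENNReal.ofReal (M + t) := by
    filter_upwards [Measure.quasiMeasurePreserving_fst.ae (ae_nonneg_of_measure_Iio hν),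
      Measure.quasiMeasurePreserving_fst.ae hM,
      Measure.quasiMeasurePreserving_snd.ae (ae_restrict_of_ae (ae_regular hlam hB ht))]
      with z h1 h2 h3
    refine ENNReal.ofReal_le_ofReal ?_
    have h4 := workload_nonneg .specNeg h3 h1 ht
    obtain ⟨n, hn⟩ := h3.exists_hasJumps
    have h5 := (afterJumps_mem_specNeg (fun m => (h3.size_pos m).le) (fun m => (h3.gap_pos m).le)
      h1 hn).2
    rw [← workload_eq_afterJumps .specNeg h3.gap_pos h3.size_pos h1 ht hn] at h5
    rw [abs_le]
    constructor <;> linarith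
  refine (lintegral_mono_ae hle).trans ?_
  rw [lintegral_const, ← Set.univ_prod_univ, Measure.prod_prod, measure_univ, one_mul,
    Measure.restrict_apply_univ]

/-! ### Quantization of a measure -/

/-- The index of the cell that contains `x`. -/
def cellIndex (κ : QueueKind) (Δ x : ℝ) : ℕ := max ⌈x / Δ⌉₊ κ.firstState

theorem measurable_cellIndex (κ : QueueKind) (Δ : ℝ) : Measurable (cellIndex κ Δ) :=
  (Nat.measurable_ceil.comp (measurable_id.div_const Δ)).max measurable_const

theorem QueueKind.firstState_le_one (κ : QueueKind) : κ.firstState ≤ 1 := by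
  cases κ <;> simp [QueueKind.firstState]

theorem cellIndex_le_iff (κ : QueueKind) {Δ : ℝ} (hΔ : 0 < Δ) {N : ℕ} (hN : 1 ≤ N) (x : ℝ) :
    cellIndex κ Δ x ≤ N ↔ x ≤ N * Δ := by
  rw [cellIndex, max_le_iff, Nat.ceil_le, div_le_iff₀ hΔ, and_iff_left]
  exact κ.firstState_le_one.trans hN

theorem mem_cellIndex (κ : QueueKind) {Δ : ℝ} (hΔ : 0 < Δ) {x : ℝ} (hx : 0 ≤ x) :
    ((cellIndex κ Δ x : ℝ) - 1) * Δ ≤ x ∧ x ≤ cellIndex κ Δ x * Δ := by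
  constructor
  · rw [← le_div_iff₀ hΔ, sub_le_iff_le_add, cellIndex, Nat.cast_max, max_le_iff]
    refine ⟨(Nat.ceil_lt_add_one (by positivity)).le, ?_⟩
    have : (κ.firstState : ℝ) ≤ 1 := by exact_mod_cast κ.firstState_le_one
    have : 0 ≤ x / Δ := by positivity
    linarith
  · rw [← div_le_iff₀ hΔ]
    exact (Nat.le_ceil _).trans (by exact_mod_cast le_max_left _ _)

theorem initDist_eq (κ : QueueKind) {Δ : ℝ} (hΔ : 0 < Δ) (N : ℕ) {ρ : Measure ℝ}
    (hρ : ρ (Set.Iio 0) = 0) (i : State κ N) :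
    initDist κ Δ N ρ i = ρ.real (cellIndex κ Δ ⁻¹' {(i : ℕ)}) := by
  have hi := (Finset.mem_Icc.1 i.2).1
  have key : ∀ s : Set ℝ, (∀ x, 0 ≤ x → (x ∈ s ↔ cellIndex κ Δ x = i)) →
      ρ.real s = ρ.real (cellIndex κ Δ ⁻¹' {(i : ℕ)}) := by
    intro s hs
    refine measureReal_congr ?_
    filter_upwards [ae_nonneg_of_measure_Iio hρ] with x hx
    exact propext (hs x hx)
  unfold initDist
  split_ifs with h0 h1
  · refine key _ fun x hx => ?_
    have hf : κ.firstState = 0 := by omega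
    rw [h0, cellIndex, hf, Nat.max_zero, Nat.ceil_eq_zero, Set.mem_singleton_iff]
    constructor
    · rintro rfl
      simp
    · intro h
      rw [div_le_iff₀ hΔ, zero_mul] at h
      exact le_antisymm h hx
  · refine key _ fun x hx => ?_
    have hf : κ.firstState = 1 := by have := κ.firstState_le_one; omega
    rw [h1, cellIndex, hf, max_eq_right_iff, Nat.ceil_le, div_le_iff₀ hΔ, Nat.cast_one, one_mul,
      Set.mem_Icc, and_iff_right hx]
  · refine key _ fun x hx => ?_
    have : cellIndex κ Δ x = i ↔ ⌈x / Δ⌉₊ = i := by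
      unfold cellIndex
      omega
    rw [this, Nat.ceil_eq_iff h0, Set.mem_Ioc, lt_div_iff₀ hΔ, div_le_iff₀ hΔ,
      Nat.cast_sub (Nat.one_le_iff_ne_zero.2 h0), Nat.cast_one]

theorem initDist_nonneg (κ : QueueKind) (Δ : ℝ) (N : ℕ) (ρ : Measure ℝ) (i : State κ N) :
    0 ≤ initDist κ Δ N ρ i := by
  unfold initDist
  split_ifs <;> exact measureReal_nonneg

theorem restrict_Iic_eq_sum (κ : QueueKind) {Δ : ℝ} (hΔ : 0 < Δ) {N : ℕ} (hN : 1 ≤ N)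
    (ρ : Measure ℝ) :
    ρ.restrict (Set.Iic (N * Δ)) =
      ∑ i : State κ N, ρ.restrict (cellIndex κ Δ ⁻¹' {(i : ℕ)}) := by
  have hm : ∀ n, MeasurableSet (cellIndex κ Δ ⁻¹' {n}) := fun n =>
    measurable_cellIndex κ Δ (measurableSet_singleton n)
  have hpre : Set.Iic (N * Δ) = cellIndex κ Δ ⁻¹' (Finset.Icc κ.firstState N : Finset ℕ) := by
    ext x
    simp only [Set.mem_Iic, Set.mem_preimage, Finset.coe_Icc, Set.mem_Icc,
      cellIndex_le_iff κ hΔ hN]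
    exact (and_iff_right (le_max_right _ _)).symm
  ext A hA
  rw [Finset.sum_coe_sort (Finset.Icc κ.firstState N) fun n =>
    ρ.restrict (cellIndex κ Δ ⁻¹' {n}), Measure.finsetSum_apply, hpre, Measure.restrict_apply hA,
    Set.inter_comm, ← Measure.restrict_apply' hA,
    ← sum_measure_preimage_singleton _ fun n _ => hm n]
  refine Finset.sum_congr rfl fun n _ => ?_
  rw [Measure.restrict_apply hA, Measure.restrict_apply' hA, Set.inter_comm]

theorem sum_initDist (κ : QueueKind) {Δ : ℝ} (hΔ : 0 < Δ) {N : ℕ} (hN : 1 ≤ N)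
    {ρ : Measure ℝ} [IsFiniteMeasure ρ] (hρ : ρ (Set.Iio 0) = 0) :
    ∑ i, initDist κ Δ N ρ i = ρ.real (Set.Iic (N * Δ)) := by
  have h := congrArg (fun m => m Set.univ) (restrict_Iic_eq_sum κ hΔ hN ρ)
  simp only [Measure.finsetSum_apply, Measure.restrict_apply_univ] at h
  rw [Measure.real, h, ENNReal.toReal_sum fun _ _ => measure_ne_top _ _]
  exact Finset.sum_congr rfl fun i _ => initDist_eq κ hΔ N hρ i

/-- Replacing a measure by the uniform distributions with the same masses of the cells moves mass
only within the cells. -/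
theorem wd_lift_initDist_le (κ : QueueKind) {Δ : ℝ} (hΔ : 0 < Δ) {N : ℕ} (hN : 1 ≤ N)
    {ρ : Measure ℝ} [IsFiniteMeasure ρ] (hρ : ρ (Set.Iio 0) = 0) :
    WD (ρ.restrict (Set.Iic (N * Δ))) (lift Δ (initDist κ Δ N ρ)) ≤
      ENNReal.ofReal Δ * ρ (Set.Iic (N * Δ)) := by
  have hm : ∀ n, MeasurableSet (cellIndex κ Δ ⁻¹' {n}) := fun n =>
    measurable_cellIndex κ Δ (measurableSet_singleton n)
  have h := congrArg (fun m => m Set.univ) (restrict_Iic_eq_sum κ hΔ hN ρ)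
  simp only [Measure.finsetSum_apply, Measure.restrict_apply_univ] at h
  rw [restrict_Iic_eq_sum κ hΔ hN, h, lift, Finset.mul_sum]
  refine (wd_sum_le _ _ _).trans (Finset.sum_le_sum fun i _ => ?_)
  have := isProbabilityMeasure_cell hΔ i
  rw [initDist_eq κ hΔ N hρ, ofReal_measureReal, ← Measure.restrict_apply_univ]
  refine (wd_prod_le _ _).trans ?_
  rw [← lintegral_const]
  refine lintegral_mono_ae ?_
  filter_upwards [ae_restrict_mem (hm i), ae_restrict_of_ae (ae_nonneg_of_measure_Iio hρ)]
    with x hx hx0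
  calc _ ≤ ∫⁻ _, ENNReal.ofReal Δ ∂cell Δ i := by
        refine lintegral_mono_ae ?_
        filter_upwards [ae_cell hΔ i] with v hv
        refine ENNReal.ofReal_le_ofReal ?_
        have hxi : cellIndex κ Δ x = i := hx
        have h1 := mem_cellIndex κ hΔ hx0
        rw [hxi] at h1
        rw [abs_le]
        constructor <;> linarith [h1.1, h1.2, hv.2.1, hv.2.2]
    _ = _ := by simp

/-- The masses of the cells as increments of the distribution function. For the atom at `0` the
lower endpoint is negative, where the distribution function vanishes. -/
theorem initDist_eq_sub (κ : QueueKind) {Δ : ℝ} (hΔ : 0 < Δ) (N : ℕ) {ρ : Measure ℝ}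
    [IsFiniteMeasure ρ] (hρ : ρ (Set.Iio 0) = 0) (hρ' : κ = .specNeg → ρ {0} = 0) (i : State κ N) :
    initDist κ Δ N ρ i =
      ρ.real (Set.Iic ((i : ℕ) * Δ)) - ρ.real (Set.Iic ((((i : ℕ) : ℝ) - 1) * Δ)) := by
  have hi := (Finset.mem_Icc.1 i.2).1
  have hIoc : ∀ a b : ℝ, a ≤ b → ρ.real (Set.Ioc a b) =
      ρ.real (Set.Iic b) - ρ.real (Set.Iic a) := by
    intro a b hab
    rw [show Set.Ioc a b = Set.Iic b \ Set.Iic a by ext; simp [and_comm],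
      measureReal_sdiff (Set.Iic_subset_Iic.2 hab) measurableSet_Iic]
  have hle : (((i : ℕ) : ℝ) - 1) * Δ ≤ (i : ℕ) * Δ := by
    have : (((i : ℕ) : ℝ) - 1) ≤ (i : ℕ) := by linarith
    exact mul_le_mul_of_nonneg_right this hΔ.le
  rw [← hIoc _ _ hle]
  unfold initDist
  split_ifs with h0 h1
  · refine measureReal_congr ?_
    filter_upwards [ae_nonneg_of_measure_Iio hρ] with x hx
    refine propext ?_
    change x ∈ ({0} : Set ℝ) ↔ x ∈ Set.Ioc _ _
    rw [h0, Set.mem_singleton_iff, Set.mem_Ioc]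
    constructor
    · rintro rfl
      simp [hΔ]
    · rintro ⟨-, h⟩
      exact le_antisymm (by simpa using h) hx
  · have hκ : κ = .specNeg := by
      cases κ
      · exact absurd h1 h0
      · rfl
    have h1' : (i : ℕ) = 1 := by rw [h1, hκ]; rfl
    refine measureReal_congr ?_
    filter_upwards [ae_nonneg_of_measure_Iio hρ, measure_eq_zero_iff_ae_notMem.1 (hρ' hκ)]
      with x hx hx'
    refine propext ?_
    change x ∈ Set.Icc _ _ ↔ x ∈ Set.Ioc _ _
    rw [h1', Set.mem_Icc, Set.mem_Ioc, Nat.cast_one, sub_self, zero_mul, one_mul]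
    exact and_congr_left fun _ => ⟨fun h => lt_of_le_of_ne h fun h' => hx' (by simp [← h']),
      le_of_lt⟩
  · rfl

/-! ### The law of the queue after exactly one jump -/

theorem oneJumpPos_mg1 (Δ q u b : ℝ) :
    oneJumpPos .mg1 Δ q u b = max (max q u + b - Δ) 0 := by
  simp only [oneJumpPos, drift, jump]
  rcases le_total q u with h | h
  · rw [max_eq_right (by linarith : q - u ≤ 0), max_eq_right h]
    congr 1
    ring
  · rw [max_eq_left (by linarith : 0 ≤ q - u), max_eq_left h]
    congr 1
    ring

theorem oneJumpPos_specNeg (Δ q u b : ℝ) :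
    oneJumpPos .specNeg Δ q u b = max (q + Δ - b) (Δ - u) := by
  simp only [oneJumpPos, drift, jump]
  rw [← max_add_add_right]
  congr 1 <;> ring

theorem oneJumpPos_nonneg (κ : QueueKind) {Δ q u b : ℝ} (hq : 0 ≤ q) (hu : 0 ≤ u) (hu' : u ≤ Δ)
    (hb : 0 ≤ b) : 0 ≤ oneJumpPos κ Δ q u b :=
  drift_nonneg κ (sub_nonneg.2 hu') (jump_nonneg κ (drift_nonneg κ hu hq) hb)

/-- One jump at a time `u`, uniform on `[0, Δ]`, started from the cell `i`: the triple of starting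
point, jump time and jump size almost surely satisfies the inequalities one expects. -/
theorem ae_prod_cell (Δ : ℝ) (hΔ : 0 < Δ) {B : Measure ℝ} [IsProbabilityMeasure B]
    (hB : B (Set.Iic 0) = 0) (i : ℕ) : ∀ᵐ z ∂(cell Δ i).prod ((cell Δ 1).prod B),
      (0 ≤ z.1 ∧ ((i : ℝ) - 1) * Δ ≤ z.1 ∧ z.1 ≤ i * Δ) ∧ (0 ≤ z.2.1 ∧ z.2.1 < Δ) ∧ 0 < z.2.2 := by
  have := isProbabilityMeasure_cell hΔ 1
  have := isProbabilityMeasure_cell hΔ i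
  have hne : ∀ᵐ u ∂cell Δ 1, u ≠ Δ := by
    have : cell Δ 1 {Δ} = 0 := by
      rw [← lintegral_indicator_one (measurableSet_singleton Δ), lintegral_cell hΔ one_ne_zero,
        lintegral_indicator_one (measurableSet_singleton Δ)]
      simp
    filter_upwards [measure_eq_zero_iff_ae_notMem.1 this] with u hu
    simpa using hu
  filter_upwards [Measure.quasiMeasurePreserving_fst.ae (ae_cell hΔ i),
    (Measure.quasiMeasurePreserving_fst.comp Measure.quasiMeasurePreserving_snd).ae (ae_cell hΔ 1),
    (Measure.quasiMeasurePreserving_fst.comp Measure.quasiMeasurePreserving_snd).ae hne,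
    (Measure.quasiMeasurePreserving_snd.comp Measure.quasiMeasurePreserving_snd).ae
      (ae_pos_of_measure_Iic hB)] with z h1 h2 h3 h4
  refine ⟨h1, ⟨h2.1, lt_of_le_of_ne ?_ h3⟩, h4⟩
  simpa using h2.2.2

theorem ae_oneJumpLaw (κ : QueueKind) {Δ : ℝ} (B : Measure ℝ) (i : ℕ) {p : ℝ → Prop}
    (hp : MeasurableSet {x | p x})
    (h : ∀ᵐ z ∂(cell Δ i).prod ((cell Δ 1).prod B), p (oneJumpPos κ Δ z.1 z.2.1 z.2.2)) :
    ∀ᵐ x ∂oneJumpLaw κ Δ B (cell Δ i), p x :=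
  (ae_map_iff (measurable_oneJumpPos κ Δ).aemeasurable hp).2 h

theorem oneJumpLaw_Iio_zero (κ : QueueKind) {Δ : ℝ} (hΔ : 0 < Δ) {B : Measure ℝ}
    [IsProbabilityMeasure B] (hB : B (Set.Iic 0) = 0) (i : ℕ) :
    oneJumpLaw κ Δ B (cell Δ i) (Set.Iio 0) = 0 := by
  refine measure_eq_zero_iff_ae_notMem.2 (ae_oneJumpLaw κ B i measurableSet_Iio.compl ?_)
  filter_upwards [ae_prod_cell Δ hΔ hB i] with z hz
  simpa using oneJumpPos_nonneg κ hz.1.1 hz.2.1.1 hz.2.1.2.le hz.2.2.le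

theorem oneJumpLaw_specNeg_zero {Δ : ℝ} (hΔ : 0 < Δ) {B : Measure ℝ}
    [IsProbabilityMeasure B] (hB : B (Set.Iic 0) = 0) (i : ℕ) :
    oneJumpLaw .specNeg Δ B (cell Δ i) {0} = 0 := by
  refine measure_eq_zero_iff_ae_notMem.2
    (ae_oneJumpLaw .specNeg B i (measurableSet_singleton 0).compl ?_)
  filter_upwards [ae_prod_cell Δ hΔ hB i] with z hz
  rw [oneJumpPos_specNeg, Set.mem_singleton_iff]
  exact (lt_max_of_lt_right (sub_pos.2 hz.2.1.2)).ne'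

theorem lintegral_ofReal_cell {Δ : ℝ} (hΔ : 0 < Δ) {i : ℕ} (hi : i ≠ 0) {g : ℝ → ℝ}
    (hg : ∀ x, 0 ≤ g x) (hint : ∀ a b, IntervalIntegrable g volume a b) :
    ∫⁻ x, ENNReal.ofReal (g x) ∂cell Δ i =
      ENNReal.ofReal (Δ⁻¹ * ∫ x in (((i : ℝ) - 1) * Δ)..(i * Δ), g x) := by
  have hle : ((i : ℝ) - 1) * Δ ≤ i * Δ := mul_le_mul_of_nonneg_right (by linarith) hΔ.le
  rw [lintegral_cell hΔ hi, ENNReal.ofReal_mul (by positivity), intervalIntegral.integral_of_le hle,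
    ← restrict_Ioc_eq_restrict_Icc, ofReal_integral_eq_lintegral_ofReal]
  · exact (intervalIntegrable_iff_integrableOn_Ioc_of_le hle).1 (hint _ _)
  · exact Filter.Eventually.of_forall hg

theorem intervalIntegrable_cdf_sub (B : Measure ℝ) (c a b : ℝ) :
    IntervalIntegrable (fun x => cdf B (c - x)) volume a b := by
  refine Antitone.intervalIntegrable fun x y hxy => ?_
  exact monotone_cdf B (by linarith)

theorem cell_one_ae_le {Δ : ℝ} (hΔ : 0 < Δ) : ∀ᵐ u ∂cell Δ 1, 0 ≤ u ∧ u ≤ Δ := by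
  filter_upwards [ae_cell hΔ 1] with u hu
  exact ⟨hu.1, by simpa using hu.2.2⟩

theorem cell_one_apply {Δ : ℝ} (hΔ : 0 < Δ) {s : Set ℝ} (hs : MeasurableSet s) :
    cell Δ 1 s = ENNReal.ofReal Δ⁻¹ * volume (s ∩ Set.Icc 0 Δ) := by
  rw [← lintegral_indicator_one hs, lintegral_cell hΔ one_ne_zero, setLIntegral_indicator hs]
  simp only [Pi.one_apply, Nat.cast_one, sub_self, zero_mul, one_mul, setLIntegral_one]

/-- The larger of two independent uniformly distributed points has density `2 m / Δ²`. -/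
theorem lintegral_cell_max {Δ : ℝ} (hΔ : 0 < Δ) {h : ℝ → ℝ≥0∞} (hh : Measurable h) :
    ∫⁻ q, ∫⁻ u, h (max q u) ∂cell Δ 1 ∂cell Δ 1 =
      ENNReal.ofReal (2 / Δ) * ∫⁻ m, ENNReal.ofReal m * h m ∂cell Δ 1 := by
  have := isProbabilityMeasure_cell hΔ 1
  have hIic : ∀ q, 0 ≤ q → q ≤ Δ → cell Δ 1 (Set.Iic q) = ENNReal.ofReal (Δ⁻¹ * q) := by
    intro q hq hq'
    rw [cell_one_apply hΔ measurableSet_Iic, show Set.Iic q ∩ Set.Icc 0 Δ = Set.Icc 0 q by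
      ext x
      simp only [Set.mem_inter_iff, Set.mem_Iic, Set.mem_Icc]
      exact ⟨fun h => ⟨h.2.1, h.1⟩, fun h => ⟨h.2, h.1, h.2.trans hq'⟩⟩, Real.volume_Icc, sub_zero,
      ENNReal.ofReal_mul (by positivity)]
  have hIio : ∀ q, 0 ≤ q → q ≤ Δ → cell Δ 1 (Set.Iio q) = ENNReal.ofReal (Δ⁻¹ * q) := by
    intro q hq hq'
    rw [cell_one_apply hΔ measurableSet_Iio, show Set.Iio q ∩ Set.Icc 0 Δ = Set.Ico 0 q by
      ext x
      simp only [Set.mem_inter_iff, Set.mem_Iio, Set.mem_Icc, Set.mem_Ico]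
      exact ⟨fun h => ⟨h.2.1, h.1⟩, fun h => ⟨h.2, h.1, h.2.le.trans hq'⟩⟩, Real.volume_Ico,
        sub_zero,
      ENNReal.ofReal_mul (by positivity)]
  have hm : Measurable fun z : ℝ × ℝ => (Set.Ioi z.1).indicator (fun u => h u) z.2 :=
    (hh.comp measurable_snd).indicator (measurableSet_lt measurable_fst measurable_snd)
  calc _ = ∫⁻ q, (∫⁻ u, (Set.Iic q).indicator (fun _ => h q) u ∂cell Δ 1) +
        ∫⁻ u, (Set.Ioi q).indicator (fun u => h u) u ∂cell Δ 1 ∂cell Δ 1 := by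
        refine lintegral_congr fun q => ?_
        rw [← lintegral_add_left (measurable_const.indicator measurableSet_Iic)]
        refine lintegral_congr fun u => ?_
        rcases le_or_gt u q with huq | huq
        · rw [max_eq_left huq, Set.indicator_of_mem (Set.mem_Iic.2 huq),
            Set.indicator_of_notMem (by simpa using huq), add_zero]
        · rw [max_eq_right huq.le, Set.indicator_of_notMem (by simpa using huq),
            Set.indicator_of_mem (Set.mem_Ioi.2 huq), zero_add]
    _ = (∫⁻ q, ∫⁻ u, (Set.Iic q).indicator (fun _ => h q) u ∂cell Δ 1 ∂cell Δ 1) +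
        ∫⁻ u, ∫⁻ q, (Set.Ioi q).indicator (fun u => h u) u ∂cell Δ 1 ∂cell Δ 1 := by
        rw [lintegral_add_right _ (Measurable.lintegral_prod_right' hm)]
        congr 1
        exact lintegral_lintegral_swap hm.aemeasurable
    _ = (∫⁻ q, ENNReal.ofReal (Δ⁻¹ * q) * h q ∂cell Δ 1) +
        ∫⁻ u, ENNReal.ofReal (Δ⁻¹ * u) * h u ∂cell Δ 1 := by
        congr 1
        · refine lintegral_congr_ae ?_
          filter_upwards [cell_one_ae_le hΔ] with q hq
          rw [lintegral_indicator_const measurableSet_Iic, hIic q hq.1 hq.2, mul_comm]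
        · refine lintegral_congr_ae ?_
          filter_upwards [cell_one_ae_le hΔ] with u hu
          have : ∀ q, (Set.Ioi q).indicator (fun u => h u) u =
              (Set.Iio u).indicator (fun _ => h u) q := by
            intro q
            simp only [Set.indicator, Set.mem_Ioi, Set.mem_Iio]
          simp only [this]
          rw [lintegral_indicator_const measurableSet_Iio, hIio u hu.1 hu.2, mul_comm]
    _ = _ := by
        rw [← two_mul, ← lintegral_const_mul' _ _ (by simp), ← lintegral_const_mul' _ _ (by simp)]
        refine lintegral_congr_ae ?_
        filter_upwards [cell_one_ae_le hΔ] with u hu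
        rw [← mul_assoc, ← mul_assoc, ← ENNReal.ofReal_mul (by positivity),
          show (2 : ℝ≥0∞) = ENNReal.ofReal 2 by simp, ← ENNReal.ofReal_mul (by positivity)]
        congr 2
        field_simp

theorem oneJumpLaw_Iic (κ : QueueKind) {Δ : ℝ} (hΔ : 0 < Δ) {B : Measure ℝ}
    [IsProbabilityMeasure B] (i : ℕ) (y : ℝ) :
    oneJumpLaw κ Δ B (cell Δ i) (Set.Iic y) =
      ∫⁻ q, ∫⁻ u, B {b | oneJumpPos κ Δ q u b ≤ y} ∂cell Δ 1 ∂cell Δ i := by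
  have := isProbabilityMeasure_cell hΔ i
  rw [← lintegral_indicator_one measurableSet_Iic,
    lintegral_oneJumpLaw κ hΔ B _ (measurable_one.indicator measurableSet_Iic)]
  refine lintegral_congr fun q => lintegral_congr fun u => ?_
  have hm : MeasurableSet {b | oneJumpPos κ Δ q u b ≤ y} :=
    measurableSet_Iic.preimage ((measurable_oneJumpPos κ Δ).comp
      (by fun_prop : Measurable fun b : ℝ => (q, u, b)))
  rw [← lintegral_indicator_one hm]
  rfl

/-- Given starting point `q` and jump time `u`, the content just after one jump of size `b` and the
remaining drift is `max (max (q - u) 0 + b - (Δ - u)) 0`, which is at most `y` if and only if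
`b ≤ y + Δ - max q u`. -/
theorem oneJumpLaw_mg1_Iic {Δ : ℝ} (hΔ : 0 < Δ) {B : Measure ℝ} [IsProbabilityMeasure B]
    (i : ℕ) {y : ℝ} (hy : 0 ≤ y) :
    (oneJumpLaw .mg1 Δ B (cell Δ i)).real (Set.Iic y) = oneJumpCdf .mg1 Δ B i y := by
  have := isProbabilityMeasure_cell hΔ 1
  have hF := cdf_nonneg B
  have hmeas : Measurable fun m => ENNReal.ofReal (cdf B (y + Δ - m)) :=
    ((monotone_cdf B).measurable.comp (by fun_prop)).ennreal_ofReal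
  have hstep : oneJumpLaw .mg1 Δ B (cell Δ i) (Set.Iic y) =
      ∫⁻ q, ∫⁻ u, ENNReal.ofReal (cdf B (y + Δ - max q u)) ∂cell Δ 1 ∂cell Δ i := by
    rw [oneJumpLaw_Iic .mg1 hΔ]
    refine lintegral_congr fun q => lintegral_congr fun u => ?_
    rw [ofReal_cdf]
    congr 1
    ext b
    change oneJumpPos .mg1 Δ q u b ≤ y ↔ _
    rw [oneJumpPos_mg1, max_le_iff, and_iff_left hy, Set.mem_Iic]
    constructor <;> intro h <;> linarith
  have hcell := fun {j : ℕ} (hj : j ≠ 0) => lintegral_ofReal_cell hΔ hj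
    (g := fun x => cdf B (y + Δ - x)) (fun x => hF _) (intervalIntegrable_cdf_sub B _)
  have hmono : ∀ j : ℕ, ((j : ℝ) - 1) * Δ ≤ j * Δ := fun j =>
    mul_le_mul_of_nonneg_right (by linarith) hΔ.le
  rw [Measure.real, hstep]
  obtain rfl | rfl | hi : i = 0 ∨ i = 1 ∨ 2 ≤ i := by omega
  · rw [cell_zero, lintegral_dirac]
    have h0 : ∀ᵐ u ∂cell Δ 1, ENNReal.ofReal (cdf B (y + Δ - max 0 u)) =
        ENNReal.ofReal (cdf B (y + Δ - u)) := by
      filter_upwards [cell_one_ae_le hΔ] with u hu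
      rw [max_eq_right hu.1]
    rw [lintegral_congr_ae h0, hcell one_ne_zero, ENNReal.toReal_ofReal,
      intervalIntegral.integral_comp_sub_left (fun s => cdf B s)]
    · simp [oneJumpCdf]
    · exact mul_nonneg (by positivity)
        (intervalIntegral.integral_nonneg (hmono 1) fun x _ => hF (y + Δ - x))
  · rw [lintegral_cell_max hΔ (h := fun m => ENNReal.ofReal (cdf B (y + Δ - m))) hmeas]
    have hg0 : ∀ m, 0 ≤ max m 0 * cdf B (y + Δ - m) := fun m =>
      mul_nonneg (le_max_right _ _) (hF _)
    have h0 : ∀ m, ENNReal.ofReal m * ENNReal.ofReal (cdf B (y + Δ - m)) =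
        ENNReal.ofReal (max m 0 * cdf B (y + Δ - m)) := fun m => by
      rw [ENNReal.ofReal_mul (le_max_right _ _), ENNReal.ofReal_max, ENNReal.ofReal_zero,
        max_eq_left zero_le]
    simp only [h0]
    rw [lintegral_ofReal_cell hΔ one_ne_zero hg0 fun a b =>
      (intervalIntegrable_cdf_sub B _ a b).continuousOn_mul (by fun_prop), ENNReal.toReal_mul,
      ENNReal.toReal_ofReal (by positivity), ENNReal.toReal_ofReal]
    · have h1 : ∫ m in (((1 : ℕ) : ℝ) - 1) * Δ..((1 : ℕ) : ℝ) * Δ, max m 0 * cdf B (y + Δ - m) =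
          ∫ m in (((1 : ℕ) : ℝ) - 1) * Δ..((1 : ℕ) : ℝ) * Δ,
            (y + Δ - (y + Δ - m)) * cdf B (y + Δ - m) := by
        refine intervalIntegral.integral_congr fun m hm => ?_
        rw [Set.uIcc_of_le (hmono 1)] at hm
        have hm0 : 0 ≤ m := by simpa using hm.1
        simp only [max_eq_left hm0, sub_sub_cancel]
      rw [h1, intervalIntegral.integral_comp_sub_left (fun s => (y + Δ - s) * cdf B s)]
      simp only [oneJumpCdf, one_ne_zero, if_false, if_true, Nat.cast_one, sub_self, zero_mul,
        sub_zero, one_mul, add_sub_cancel_right]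
      rw [← mul_assoc]
      congr 1
      field_simp
    · exact mul_nonneg (by positivity)
        (intervalIntegral.integral_nonneg (hmono 1) fun x _ => hg0 x)
  · have h0 : ∀ᵐ q ∂cell Δ i, ∫⁻ u, ENNReal.ofReal (cdf B (y + Δ - max q u)) ∂cell Δ 1 =
        ENNReal.ofReal (cdf B (y + Δ - q)) := by
      filter_upwards [ae_cell hΔ i] with q hq
      have hq' : Δ ≤ q := by
        have h2 : (2 : ℝ) ≤ i := by exact_mod_cast hi
        nlinarith [hq.2.1]
      have : ∀ᵐ u ∂cell Δ 1, ENNReal.ofReal (cdf B (y + Δ - max q u)) =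
          ENNReal.ofReal (cdf B (y + Δ - q)) := by
        filter_upwards [cell_one_ae_le hΔ] with u hu
        rw [max_eq_left (hu.2.trans hq')]
      rw [lintegral_congr_ae this, lintegral_const, measure_univ, mul_one]
    rw [lintegral_congr_ae h0, hcell (by omega), ENNReal.toReal_ofReal,
      intervalIntegral.integral_comp_sub_left (fun s => cdf B s)]
    · rw [oneJumpCdf, if_neg (by omega), if_neg (by omega), one_div]
      congr 2 <;> ring
    · exact mul_nonneg (by positivity)
        (intervalIntegral.integral_nonneg (hmono i) fun x _ => hF (y + Δ - x))

/-- The content after one downward jump lies in `[Δ - u, ∞)`, where `u` is the jump time. This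
gives the factor `min 1 (y / Δ)`; the other factor comes from a jump of size at least `q + Δ - y`.
-/
theorem oneJumpLaw_specNeg_Iic {Δ : ℝ} (hΔ : 0 < Δ) {B : Measure ℝ} [IsProbabilityMeasure B]
    {i : ℕ} (hi : i ≠ 0) {y : ℝ} (hy : 0 ≤ y) :
    (oneJumpLaw .specNeg Δ B (cell Δ i)).real (Set.Iic y) = oneJumpCdf .specNeg Δ B i y := by
  have := isProbabilityMeasure_cell hΔ 1
  have hF := cdf_le_one B
  have hle : ((i : ℝ) - 1) * Δ ≤ i * Δ := mul_le_mul_of_nonneg_right (by linarith) hΔ.le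
  have hU : cell Δ 1 (Set.Ici (Δ - y)) = ENNReal.ofReal (min 1 (y / Δ)) := by
    rw [cell_one_apply hΔ measurableSet_Ici, show Set.Ici (Δ - y) ∩ Set.Icc 0 Δ =
      Set.Icc (max 0 (Δ - y)) Δ by
        ext x
        simp only [Set.mem_inter_iff, Set.mem_Ici, Set.mem_Icc, max_le_iff]
        tauto, Real.volume_Icc, ← ENNReal.ofReal_mul (by positivity)]
    congr 1
    rcases le_total y Δ with h | h
    · rw [max_eq_right (by linarith), min_eq_right ((div_le_one hΔ).2 h)]
      field_simp
      ring
    · rw [max_eq_left (by linarith), min_eq_left ((one_le_div hΔ).2 h)]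
      field_simp
      ring
  have hatom : ∀ᵐ q ∂cell Δ i, B (Set.Ici (q + Δ - y)) =
      ENNReal.ofReal (1 - cdf B (q + Δ - y)) := by
    have hcount : {z : ℝ | 0 < B {z}}.Countable := by
      simpa using Measure.countable_meas_level_set_pos (μ := B) (g := fun x : ℝ => x) measurable_id
    have hpre : ((fun q => q + Δ - y) ⁻¹' {z : ℝ | 0 < B {z}}).Countable :=
      hcount.preimage fun a b h => by simpa using h
    have hnull : cell Δ i ((fun q => q + Δ - y) ⁻¹' {z : ℝ | 0 < B {z}}) = 0 := by
      rw [cell, if_neg hi]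
      exact (cond_absolutelyContinuous) (hpre.measure_zero volume)
    filter_upwards [measure_eq_zero_iff_ae_notMem.1 hnull] with q hq
    have hq0 : B {q + Δ - y} = 0 := by simpa using hq
    rw [← measure_congr (Ioi_ae_eq_Ici' hq0), ← Set.compl_Iic,
      prob_compl_eq_one_sub measurableSet_Iic, ← ofReal_cdf, ← ENNReal.ofReal_one,
      ← ENNReal.ofReal_sub _ (cdf_nonneg B _)]
  rw [Measure.real, oneJumpLaw_Iic .specNeg hΔ]
  have hstep : ∀ q, ∫⁻ u, B {b | oneJumpPos .specNeg Δ q u b ≤ y} ∂cell Δ 1 =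
      B (Set.Ici (q + Δ - y)) * cell Δ 1 (Set.Ici (Δ - y)) := by
    intro q
    rw [← lintegral_indicator_const measurableSet_Ici]
    refine lintegral_congr fun u => ?_
    by_cases hu : u ∈ Set.Ici (Δ - y)
    · rw [Set.indicator_of_mem hu]
      congr 1
      ext b
      change oneJumpPos .specNeg Δ q u b ≤ y ↔ _
      rw [Set.mem_Ici] at hu
      rw [oneJumpPos_specNeg, max_le_iff, and_iff_left (by linarith), Set.mem_Ici]
      constructor <;> intro h <;> linarith
    · rw [Set.indicator_of_notMem hu]
      convert measure_empty (μ := B)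
      ext b
      change oneJumpPos .specNeg Δ q u b ≤ y ↔ _
      rw [Set.mem_Ici] at hu
      rw [oneJumpPos_specNeg, max_le_iff]
      simp only [Set.mem_empty_iff_false, iff_false, not_and]
      intro _
      linarith
  simp only [hstep]
  have hint : ∀ a b, IntervalIntegrable (fun q => cdf B (q + Δ - y)) volume a b := fun a b =>
    Monotone.intervalIntegrable fun x z hxz => monotone_cdf B (by linarith)
  rw [lintegral_mul_const' _ _ (measure_ne_top _ _), hU, lintegral_congr_ae hatom,
    lintegral_ofReal_cell hΔ hi (fun q => sub_nonneg.2 (hF _))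
      (fun a b => intervalIntegrable_const.sub (hint a b)), ENNReal.toReal_mul,
    ENNReal.toReal_ofReal, ENNReal.toReal_ofReal (le_min zero_le_one (by positivity)),
    intervalIntegral.integral_sub intervalIntegrable_const (hint _ _),
    intervalIntegral.integral_const, mul_comm, oneJumpCdf]
  · congr 1
    have : ∫ q in ((i : ℝ) - 1) * Δ..i * Δ, cdf B (q + Δ - y) =
        ∫ s in (i * Δ - y)..(((i : ℝ) + 1) * Δ - y), cdf B s := by
      simp only [add_sub_assoc]
      rw [intervalIntegral.integral_comp_add_right (fun s => cdf B s)]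
      congr 1 <;> ring
    rw [this, smul_eq_mul, mul_sub]
    congr 1
    · field_simp
      ring
    · rw [one_div]
  · exact mul_nonneg (by positivity)
      (intervalIntegral.integral_nonneg hle fun x _ => sub_nonneg.2 (hF _))

theorem oneJumpCdf_mg1_of_le {Δ : ℝ} (hΔ : 0 < Δ) {B : Measure ℝ} [IsProbabilityMeasure B]
    (hB : B (Set.Iic 0) = 0) (i : ℕ) {y : ℝ} (hy : y ≤ -Δ) : oneJumpCdf .mg1 Δ B i y = 0 := by
  have h0 : ∀ s ≤ 0, cdf B s = 0 := by
    intro s hs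
    have : ENNReal.ofReal (cdf B s) = 0 := by
      rw [ofReal_cdf]
      exact measure_mono_null (Set.Iic_subset_Iic.2 hs) hB
    exact le_antisymm (ENNReal.ofReal_eq_zero.1 this) (cdf_nonneg B s)
  have hint : ∀ (g : ℝ → ℝ) (a b : ℝ), a ≤ 0 → b ≤ 0 → ∫ s in a..b, g s * cdf B s = 0 := by
    intro g a b ha hb
    refine intervalIntegral.integral_zero_ae (Filter.Eventually.of_forall fun s hs => ?_)
    rw [h0 s (hs.2.trans (max_le ha hb)), mul_zero]
  have hint1 : ∀ a b : ℝ, a ≤ 0 → b ≤ 0 → ∫ s in a..b, cdf B s = 0 := fun a b ha hb => by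
    simpa using hint (fun _ => 1) a b ha hb
  simp only [oneJumpCdf]
  split_ifs with hi0 hi1
  · rw [hint1 _ _ (by linarith) (by linarith), mul_zero]
  · rw [hint _ _ _ (by linarith) (by linarith), mul_zero]
  · have h2 : (2 : ℝ) ≤ i := by exact_mod_cast (by omega : 2 ≤ i)
    rw [hint1, mul_zero] <;> nlinarith

/-- The increments of `oneJumpCdf` are the cell masses of the law of `Q_Δ` given one jump. -/
theorem oneJumpCdf_sub_eq_initDist (κ : QueueKind) {Δ : ℝ} (hΔ : 0 < Δ) {B : Measure ℝ}
    [IsProbabilityMeasure B] (hB : B (Set.Iic 0) = 0) {N : ℕ} (i j : State κ N) :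
    oneJumpCdf κ Δ B i ((j : ℕ) * Δ) - oneJumpCdf κ Δ B i ((((j : ℕ) : ℝ) - 1) * Δ) =
      initDist κ Δ N (oneJumpLaw κ Δ B (cell Δ i)) j := by
  have := isProbabilityMeasure_cell hΔ i
  have := isProbabilityMeasure_oneJumpLaw κ hΔ B (cell Δ i)
  have h0 := oneJumpLaw_Iio_zero κ hΔ hB i
  have hj : 0 ≤ ((j : ℕ) : ℝ) * Δ := by positivity
  have hj1 : (j : ℕ) ≠ 0 → 0 ≤ (((j : ℕ) : ℝ) - 1) * Δ := fun h =>
    mul_nonneg (sub_nonneg.2 (by exact_mod_cast Nat.one_le_iff_ne_zero.2 h)) hΔ.le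
  cases κ
  · rw [initDist_eq_sub .mg1 hΔ N h0 (by simp), oneJumpLaw_mg1_Iic hΔ _ hj]
    congr 1
    by_cases h : (j : ℕ) = 0
    · have hneg : (((j : ℕ) : ℝ) - 1) * Δ = -Δ := by simp [h]
      rw [hneg, oneJumpCdf_mg1_of_le hΔ hB _ le_rfl, Measure.real, measure_mono_null _ h0,
        ENNReal.toReal_zero]
      exact Set.Iic_subset_Iio.2 (by linarith)
    · rw [oneJumpLaw_mg1_Iic hΔ _ (hj1 h)]
  · have hi := (Finset.mem_Icc.1 i.2).1
    have hjs := (Finset.mem_Icc.1 j.2).1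
    rw [initDist_eq_sub .specNeg hΔ N h0 fun _ => oneJumpLaw_specNeg_zero hΔ hB i,
      oneJumpLaw_specNeg_Iic hΔ (Nat.one_le_iff_ne_zero.1 hi) hj,
      oneJumpLaw_specNeg_Iic hΔ (Nat.one_le_iff_ne_zero.1 hi)
        (hj1 (Nat.one_le_iff_ne_zero.1 hjs))]

/-! ### The error of truncation -/

/-- The mass beyond `M` is coupled with an independent return to the starting cell. -/
theorem wd_restrict_Ioi_le (κ : QueueKind) {Δ : ℝ} (hΔ : 0 < Δ) {B : Measure ℝ}
    [IsProbabilityMeasure B] (i : ℕ) (M : ℝ) :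
    WD ((oneJumpLaw κ Δ B (cell Δ i)).restrict (Set.Ioi M))
        (oneJumpLaw κ Δ B (cell Δ i) (Set.Ioi M) • cell Δ i) ≤
      ∫⁻ z, {z : ℝ × ℝ × ℝ | M < oneJumpPos κ Δ z.1 z.2.1 z.2.2}.indicator
        (fun z => ∫⁻ v, ENNReal.ofReal |oneJumpPos κ Δ z.1 z.2.1 z.2.2 - v| ∂cell Δ i) z
        ∂(cell Δ i).prod ((cell Δ 1).prod B) := by
  have := isProbabilityMeasure_cell hΔ i
  have := isProbabilityMeasure_oneJumpLaw κ hΔ B (cell Δ i)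
  have hm : Measurable fun x => ∫⁻ v, ENNReal.ofReal |x - v| ∂cell Δ i :=
    Measurable.lintegral_prod_right' (f := fun w : ℝ × ℝ => ENNReal.ofReal |w.1 - w.2|)
      (by fun_prop)
  have h := wd_prod_le ((oneJumpLaw κ Δ B (cell Δ i)).restrict (Set.Ioi M)) (cell Δ i)
  rw [Measure.restrict_apply_univ, ← lintegral_indicator measurableSet_Ioi] at h
  refine h.trans_eq ?_
  conv_lhs => rw [oneJumpLaw]
  rw [lintegral_map (hm.indicator measurableSet_Ioi) (measurable_oneJumpPos κ Δ)]
  rfl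

/-- An upward jump beyond `M` from cell `i` is larger than the distance of the cell from `M`, and
the queue is at most the jump size away from any point of the cell. -/
theorem wd_excess_mg1_le {Δ : ℝ} (hΔ : 0 < Δ) {B : Measure ℝ} [IsProbabilityMeasure B]
    (hB : B (Set.Iic 0) = 0) {N i : ℕ} (hi : i ≤ N) :
    WD ((oneJumpLaw .mg1 Δ B (cell Δ i)).restrict (Set.Ioi (N * Δ)))
        (oneJumpLaw .mg1 Δ B (cell Δ i) (Set.Ioi (N * Δ)) • cell Δ i) ≤
      ∫⁻ b in Set.Ioi (N * Δ - i * Δ), ENNReal.ofReal b ∂B := by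
  have := isProbabilityMeasure_cell hΔ i
  have := isProbabilityMeasure_cell hΔ 1
  have hiN : (i : ℝ) * Δ ≤ N * Δ := mul_le_mul_of_nonneg_right (by exact_mod_cast hi) hΔ.le
  refine (wd_restrict_Ioi_le .mg1 hΔ i _).trans ?_
  calc _ ≤ ∫⁻ z, (Set.Ioi (N * Δ - i * Δ)).indicator (fun b => ENNReal.ofReal b) z.2.2
        ∂(cell Δ i).prod ((cell Δ 1).prod B) := by
        refine lintegral_mono_ae ?_
        filter_upwards [ae_prod_cell Δ hΔ hB i] with z hz
        obtain ⟨⟨hq0, hq1, hq2⟩, ⟨hu0, hu1⟩, hb⟩ := hz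
        by_cases hz : z ∈ {z : ℝ × ℝ × ℝ | N * Δ < oneJumpPos .mg1 Δ z.1 z.2.1 z.2.2}
        swap
        · rw [Set.indicator_of_notMem hz]
          exact zero_le
        rw [Set.indicator_of_mem hz]
        have hz' : N * Δ < oneJumpPos .mg1 Δ z.1 z.2.1 z.2.2 := hz
        rw [oneJumpPos_mg1] at hz' ⊢
        have hNΔ : 0 ≤ (N : ℝ) * Δ := by positivity
        have hiΔ : 0 ≤ (i : ℝ) * Δ := by positivity
        have hpos : N * Δ < max z.1 z.2.1 + z.2.2 - Δ := by
          rcases lt_max_iff.1 hz' with h | h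
          · exact h
          · linarith
        have hbM : z.2.2 ∈ Set.Ioi (N * Δ - i * Δ) := by
          rw [Set.mem_Ioi]
          rcases max_cases z.1 z.2.1 with ⟨h, _⟩ | ⟨h, _⟩ <;> rw [h] at hpos <;> linarith
        rw [Set.indicator_of_mem hbM]
        calc _ ≤ ∫⁻ _, ENNReal.ofReal z.2.2 ∂cell Δ i := by
              refine lintegral_mono_ae ?_
              filter_upwards [ae_cell hΔ i] with v hv
              refine ENNReal.ofReal_le_ofReal ?_
              rw [max_eq_left (by linarith), abs_of_nonneg (by linarith [hv.2.2])]
              rcases max_cases z.1 z.2.1 with ⟨h, _⟩ | ⟨h, _⟩ <;> rw [h] <;>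
                linarith [hv.1, hv.2.1]
          _ = _ := by simp
    _ = _ := by
        have hmp : MeasurePreserving (fun z : ℝ × ℝ × ℝ => z.2.2)
            ((cell Δ i).prod ((cell Δ 1).prod B)) B :=
          measurePreserving_snd.comp measurePreserving_snd
        rw [hmp.lintegral_comp (ENNReal.measurable_ofReal.indicator measurableSet_Ioi),
          lintegral_indicator measurableSet_Ioi]

theorem oneJumpLaw_specNeg_Ioi_of_lt {Δ : ℝ} (hΔ : 0 < Δ) {B : Measure ℝ} [IsProbabilityMeasure B]
    (hB : B (Set.Iic 0) = 0) {N i : ℕ} (hi : i < N) :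
    oneJumpLaw .specNeg Δ B (cell Δ i) (Set.Ioi (N * Δ)) = 0 := by
  refine measure_eq_zero_iff_ae_notMem.2 (ae_oneJumpLaw .specNeg B i measurableSet_Ioi.compl ?_)
  filter_upwards [ae_prod_cell Δ hΔ hB i] with z hz
  obtain ⟨⟨hq0, hq1, hq2⟩, ⟨hu0, hu1⟩, hb⟩ := hz
  rw [oneJumpPos_specNeg, Set.mem_Ioi, not_lt]
  have h1 : ((i : ℝ) + 1) * Δ ≤ N * Δ :=
    mul_le_mul_of_nonneg_right (by exact_mod_cast hi) hΔ.le
  have h2 : 0 ≤ (i : ℝ) * Δ := by positivity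
  exact max_le (by linarith) (by linarith)

theorem setLIntegral_ofReal_add {a b c : ℝ} (hab : a ≤ b) (hc : 0 ≤ a + c) :
    ∫⁻ x in Set.Icc a b, ENNReal.ofReal (x + c) =
      ENNReal.ofReal ((b - a) * ((a + b) / 2 + c)) := by
  rw [← restrict_Ioc_eq_restrict_Icc, ← ofReal_integral_eq_lintegral_ofReal,
    ← intervalIntegral.integral_of_le hab, intervalIntegral.integral_add
      (Continuous.intervalIntegrable (by fun_prop) _ _)
      (Continuous.intervalIntegrable (by fun_prop) _ _), integral_id,
    intervalIntegral.integral_const]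
  · congr 1
    rw [smul_eq_mul]
    ring
  · exact (Continuous.integrableOn_Icc (by fun_prop)).mono_set Set.Ioc_subset_Icc_self
  · filter_upwards [ae_restrict_mem measurableSet_Ioc] with x hx
    have : a < x := hx.1
    change 0 ≤ x + c
    linarith

theorem setLIntegral_ofReal_sub {a b c : ℝ} (hab : a ≤ b) (hc : 0 ≤ c - b) :
    ∫⁻ x in Set.Icc a b, ENNReal.ofReal (c - x) =
      ENNReal.ofReal ((b - a) * (c - (a + b) / 2)) := by
  rw [← restrict_Ioc_eq_restrict_Icc, ← ofReal_integral_eq_lintegral_ofReal,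
    ← intervalIntegral.integral_of_le hab, intervalIntegral.integral_sub
      (Continuous.intervalIntegrable (by fun_prop) _ _)
      (Continuous.intervalIntegrable (by fun_prop) _ _), integral_id,
    intervalIntegral.integral_const]
  · congr 1
    rw [smul_eq_mul]
    ring
  · exact (Continuous.integrableOn_Icc (by fun_prop)).mono_set Set.Ioc_subset_Icc_self
  · filter_upwards [ae_restrict_mem measurableSet_Ioc] with x hx
    have : x ≤ b := hx.2
    change 0 ≤ c - x
    linarith

/-- With downward jumps, the queue exceeds `M` after one jump only from the last cell. Given the
jump size `b < Δ`, it is then uniformly distributed on `[M, M + Δ - b]`, whose mean is at distance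
`Δ - b / 2` from the mean of the last cell. -/
theorem wd_excess_specNeg_le {Δ : ℝ} (hΔ : 0 < Δ) {B : Measure ℝ} [IsProbabilityMeasure B]
    (hB : B (Set.Iic 0) = 0) {N : ℕ} (hN : 1 ≤ N) :
    WD ((oneJumpLaw .specNeg Δ B (cell Δ N)).restrict (Set.Ioi (N * Δ)))
        (oneJumpLaw .specNeg Δ B (cell Δ N) (Set.Ioi (N * Δ)) • cell Δ N) ≤
      ENNReal.ofReal Δ * oneJumpLaw .specNeg Δ B (cell Δ N) (Set.Ioi (N * Δ)) := by
  have := isProbabilityMeasure_cell hΔ N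
  have := isProbabilityMeasure_cell hΔ 1
  have hN0 : N ≠ 0 := by omega
  set M : ℝ := N * Δ with hM
  have hM1 : ((N : ℝ) - 1) * Δ = M - Δ := by rw [hM]; ring
  have hΔM : Δ ≤ M := by
    have : (1 : ℝ) ≤ N := by exact_mod_cast hN
    nlinarith
  -- the queue exceeds `M` exactly if `q + Δ - b` does
  have hae : ∀ᵐ z ∂(cell Δ N).prod ((cell Δ 1).prod B),
      (M < oneJumpPos .specNeg Δ z.1 z.2.1 z.2.2 ↔ z.1 ∈ Set.Ioi (M - Δ + z.2.2)) ∧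
      (M < oneJumpPos .specNeg Δ z.1 z.2.1 z.2.2 →
        oneJumpPos .specNeg Δ z.1 z.2.1 z.2.2 = z.1 + Δ - z.2.2) := by
    filter_upwards [ae_prod_cell Δ hΔ hB N] with z hz
    obtain ⟨⟨hq0, hq1, hq2⟩, ⟨hu0, hu1⟩, hb⟩ := hz
    rw [oneJumpPos_specNeg, Set.mem_Ioi, lt_max_iff]
    refine ⟨⟨fun h => ?_, fun h => Or.inl (by linarith)⟩, fun h => max_eq_left ?_⟩
    · rcases h with h | h <;> linarith
    · rcases h with h | h <;> linarith
  have hmean : ∀ x, M ≤ x → ∫⁻ v, ENNReal.ofReal |x - v| ∂cell Δ N =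
      ENNReal.ofReal (x + (Δ / 2 - M)) := by
    intro x hx
    have h1 : ∀ᵐ v ∂cell Δ N, ENNReal.ofReal |x - v| = ENNReal.ofReal (x - v) := by
      filter_upwards [ae_cell hΔ N] with v hv
      rw [abs_of_nonneg (by linarith [hv.2.2])]
    rw [lintegral_congr_ae h1, lintegral_cell hΔ hN0, hM1, setLIntegral_ofReal_sub (by linarith)
      (by linarith), ← ENNReal.ofReal_mul (by positivity)]
    congr 1
    field_simp
    ring
  have hG : oneJumpLaw .specNeg Δ B (cell Δ N) (Set.Ioi M) =
      ∫⁻ z, (Set.Ioi (M - Δ + z.2.2)).indicator (fun _ => 1) z.1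
        ∂(cell Δ N).prod ((cell Δ 1).prod B) := by
    rw [oneJumpLaw, Measure.map_apply (measurable_oneJumpPos _ _) measurableSet_Ioi,
      ← lintegral_indicator_one (measurableSet_Ioi.preimage (measurable_oneJumpPos _ _))]
    refine lintegral_congr_ae ?_
    filter_upwards [hae] with z hz
    simp only [Set.indicator, Set.mem_preimage, Pi.one_apply]
    exact if_congr hz.1 rfl rfl
  refine (wd_restrict_Ioi_le .specNeg hΔ N _).trans ?_
  have hlhs : ∫⁻ z, {z : ℝ × ℝ × ℝ | M < oneJumpPos .specNeg Δ z.1 z.2.1 z.2.2}.indicator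
        (fun z => ∫⁻ v, ENNReal.ofReal |oneJumpPos .specNeg Δ z.1 z.2.1 z.2.2 - v| ∂cell Δ N) z
        ∂(cell Δ N).prod ((cell Δ 1).prod B) =
      ∫⁻ z, (Set.Ioi (M - Δ + z.2.2)).indicator
        (fun q => ENNReal.ofReal (q + (3 / 2 * Δ - z.2.2 - M))) z.1
        ∂(cell Δ N).prod ((cell Δ 1).prod B) := by
    refine lintegral_congr_ae ?_
    filter_upwards [hae] with z hz
    by_cases h : M < oneJumpPos .specNeg Δ z.1 z.2.1 z.2.2
    · rw [Set.indicator_of_mem (s := {z : ℝ × ℝ × ℝ | M < oneJumpPos .specNeg Δ z.1 z.2.1 z.2.2}) h,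
        Set.indicator_of_mem (hz.1.1 h), hmean _ h.le, hz.2 h]
      congr 1
      ring
    · rw [Set.indicator_of_notMem
        (s := {z : ℝ × ℝ × ℝ | M < oneJumpPos .specNeg Δ z.1 z.2.1 z.2.2}) h,
        Set.indicator_of_notMem (mt hz.1.2 h)]
  have hmS : MeasurableSet {z : ℝ × ℝ × ℝ | M - Δ + z.2.2 < z.1} :=
    measurableSet_lt (by fun_prop) (by fun_prop)
  have hm1 : Measurable fun z : ℝ × ℝ × ℝ => (Set.Ioi (M - Δ + z.2.2)).indicator
      (fun q => ENNReal.ofReal (q + (3 / 2 * Δ - z.2.2 - M))) z.1 :=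
    (by fun_prop : Measurable fun z : ℝ × ℝ × ℝ =>
      ENNReal.ofReal (z.1 + (3 / 2 * Δ - z.2.2 - M))).indicator hmS
  have hm2 : Measurable fun z : ℝ × ℝ × ℝ => (Set.Ioi (M - Δ + z.2.2)).indicator
      (fun _ => (1 : ℝ≥0∞)) z.1 := measurable_const.indicator hmS
  rw [hlhs, hG, lintegral_prod_symm' _ hm1, lintegral_prod_symm' _ hm2,
    ← lintegral_const_mul _ (Measurable.lintegral_prod_left' hm2)]
  have hpos : ∀ᵐ w ∂(cell Δ 1).prod B, 0 < w.2 :=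
    Measure.quasiMeasurePreserving_snd.ae (ae_pos_of_measure_Iic hB)
  refine lintegral_mono_ae ?_
  filter_upwards [hpos] with w hw
  rw [lintegral_cell hΔ hN0, lintegral_cell hΔ hN0, setLIntegral_indicator measurableSet_Ioi,
    setLIntegral_indicator measurableSet_Ioi, hM1,
    show Set.Ioi (M - Δ + w.2) ∩ Set.Icc (M - Δ) (N * Δ) = Set.Ioc (M - Δ + w.2) M by
      ext x
      simp only [Set.mem_inter_iff, Set.mem_Ioi, Set.mem_Icc, Set.mem_Ioc, ← hM]
      exact ⟨fun h => ⟨h.1, h.2.2⟩, fun h => ⟨h.1, by linarith [h.1], h.2⟩⟩]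
  rcases le_total Δ w.2 with hwΔ | hwΔ
  · rw [Set.Ioc_eq_empty (by linarith)]
    simp
  · rw [restrict_Ioc_eq_restrict_Icc, setLIntegral_ofReal_add (by linarith) (by linarith),
      setLIntegral_one, Real.volume_Icc, mul_left_comm, ← ENNReal.ofReal_mul hΔ.le]
    refine mul_le_mul' le_rfl (ENNReal.ofReal_le_ofReal ?_)
    nlinarith [mul_nonneg hw.le (sub_nonneg.2 hwΔ)]

/-! ### One step of the chain -/

theorem map_add_cell {Δ : ℝ} (hΔ : 0 < Δ) {i : ℕ} (hi : i ≠ 0) :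
    (cell Δ i).map (· + Δ) = cell Δ (i + 1) := by
  refine Measure.ext_of_lintegral _ fun f hf => ?_
  rw [lintegral_map hf (by fun_prop), lintegral_cell hΔ hi, lintegral_cell hΔ (Nat.succ_ne_zero i),
    ← lintegral_indicator measurableSet_Icc, ← lintegral_indicator measurableSet_Icc,
    ← lintegral_add_right_eq_self (μ := volume)
      ((Set.Icc ((((i + 1 : ℕ) : ℝ) - 1) * Δ) ((i + 1 : ℕ) * Δ)).indicator f) Δ]
  congr 1
  refine lintegral_congr fun x => ?_
  have : x + Δ ∈ Set.Icc ((((i + 1 : ℕ) : ℝ) - 1) * Δ) ((i + 1 : ℕ) * Δ) ↔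
      x ∈ Set.Icc (((i : ℝ) - 1) * Δ) (i * Δ) := by
    rw [Set.mem_Icc, Set.mem_Icc]
    push_cast
    constructor <;> rintro ⟨h1, h2⟩ <;> constructor <;> linarith
  by_cases hx : x ∈ Set.Icc (((i : ℝ) - 1) * Δ) (i * Δ)
  · rw [Set.indicator_of_mem hx, Set.indicator_of_mem (this.2 hx)]
  · rw [Set.indicator_of_notMem hx, Set.indicator_of_notMem (mt this.1 hx)]

theorem map_drift_mg1_cell {Δ : ℝ} (hΔ : 0 < Δ) (i : ℕ) :
    (cell Δ i).map (drift .mg1 Δ) = cell Δ (i - 1) := by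
  have := isProbabilityMeasure_cell hΔ i
  have hd : Measurable (drift .mg1 Δ) := (measurable_drift .mg1).comp measurable_prodMk_left
  by_cases hi : i ≤ 1
  · have h0 : drift .mg1 Δ =ᵐ[cell Δ i] fun _ => 0 := by
      filter_upwards [ae_cell hΔ i] with x hx
      have h1 : (i : ℝ) * Δ ≤ 1 * Δ := mul_le_mul_of_nonneg_right (by exact_mod_cast hi) hΔ.le
      exact max_eq_right (by linarith [hx.2.2])
    rw [Measure.map_congr h0, Measure.map_const, measure_univ, one_smul,
      show i - 1 = 0 by omega, cell_zero]
  · obtain ⟨j, rfl⟩ : ∃ j, i = j + 1 := ⟨i - 1, by omega⟩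
    rw [← map_add_cell hΔ (by omega : j ≠ 0), Measure.map_map hd (by fun_prop), Nat.add_sub_cancel]
    have h0 : drift .mg1 Δ ∘ (· + Δ) =ᵐ[cell Δ j] id := by
      filter_upwards [ae_cell hΔ j] with x hx
      simp [drift, hx.1]
    rw [Measure.map_congr h0, Measure.map_id]

/-- Without jumps, a cell is moved to the adjacent one (the atom at `0` stays), except for the
last cell in the spectrally negative case. -/
theorem noJumpMove_cases (κ : QueueKind) {Δ : ℝ} (hΔ : 0 < Δ) {N : ℕ} (i : State κ N) :
    (∃ j₀ : State κ N, (∀ j : State κ N, NoJumpMove κ i j ↔ j = j₀) ∧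
      (cell Δ i).map (drift κ Δ) = cell Δ j₀) ∨
    (κ = .specNeg ∧ (i : ℕ) = N ∧ ∀ j : State κ N, ¬NoJumpMove κ i j) := by
  have hi := Finset.mem_Icc.1 i.2
  cases κ
  · refine Or.inl ⟨⟨i - 1, Finset.mem_Icc.2 ⟨Nat.zero_le _, by omega⟩⟩, fun j => ?_,
      map_drift_mg1_cell hΔ i⟩
    rw [Subtype.ext_iff]
    simp only [NoJumpMove]
    omega
  · have h1 : 1 ≤ (i : ℕ) := hi.1
    by_cases hN : (i : ℕ) = N
    · refine Or.inr ⟨rfl, hN, fun j hj => ?_⟩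
      have := (Finset.mem_Icc.1 j.2).2
      simp only [NoJumpMove] at hj
      omega
    · refine Or.inl ⟨⟨i + 1, Finset.mem_Icc.2 ⟨Nat.le_add_left _ _, by omega⟩⟩, fun j => ?_,
        map_add_cell hΔ (by omega)⟩
      rw [Subtype.ext_iff]
      rfl

open Classical in
/-- The number of moves without a jump that stay in the truncated space. -/
def moveSum (κ : QueueKind) {N : ℕ} (i : State κ N) : ℝ :=
  ∑ j : State κ N, if NoJumpMove κ i j then 1 else 0

theorem moveSum_le_one (κ : QueueKind) {N : ℕ} (i : State κ N) : moveSum κ i ≤ 1 := by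
  rcases noJumpMove_cases κ one_pos i with ⟨j₀, hj, -⟩ | ⟨-, -, hj⟩ <;> simp [moveSum, hj]

section
variable (κ : QueueKind) {N : ℕ}

open Classical in
theorem subMatrix_eq (lam : ℝ) {Δ : ℝ} (hΔ : 0 < Δ) {B : Measure ℝ} [IsProbabilityMeasure B]
    (hB : B (Set.Iic 0) = 0) (i j : State κ N) :
    subMatrix κ lam Δ B N i j =
      Real.exp (-(lam * Δ)) * (if NoJumpMove κ i j then 1 else 0) +
        lam * Δ * Real.exp (-(lam * Δ)) * initDist κ Δ N (oneJumpLaw κ Δ B (cell Δ i)) j := by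
  rw [subMatrix, Matrix.of_apply, oneJumpCdf_sub_eq_initDist κ hΔ hB]
  ring

/-- The mass added on the diagonal consists of the mass of two or more jumps, of the exits by one
jump, and of the exits without a jump. -/
theorem one_sub_sum_subMatrix (lam : ℝ) {Δ : ℝ} (hΔ : 0 < Δ) {B : Measure ℝ}
    [IsProbabilityMeasure B]
    (hB : B (Set.Iic 0) = 0) (hN : 1 ≤ N) (i : State κ N) :
    1 - ∑ j, subMatrix κ lam Δ B N i j =
      (1 - (1 + lam * Δ) * Real.exp (-(lam * Δ))) +
        lam * Δ * Real.exp (-(lam * Δ)) *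
          (oneJumpLaw κ Δ B (cell Δ i)).real (Set.Ioi (N * Δ)) +
        Real.exp (-(lam * Δ)) * (1 - moveSum κ i) := by
  have := isProbabilityMeasure_cell hΔ i
  have := isProbabilityMeasure_oneJumpLaw κ hΔ B (cell Δ i)
  simp only [subMatrix_eq κ lam hΔ hB, Finset.sum_add_distrib, ← Finset.mul_sum]
  rw [sum_initDist κ hΔ hN (oneJumpLaw_Iio_zero κ hΔ hB i), ← Set.compl_Iic,
    probReal_compl_eq_one_sub measurableSet_Iic]
  unfold moveSum
  ring

theorem one_sub_mul_exp_nonneg {x : ℝ} : 0 ≤ 1 - (1 + x) * Real.exp (-x) := by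
  have h1 := Real.add_one_le_exp x
  have h2 : (1 + x) * Real.exp (-x) ≤ Real.exp x * Real.exp (-x) :=
    mul_le_mul_of_nonneg_right (by linarith) (Real.exp_nonneg _)
  rw [← Real.exp_add, add_neg_cancel, Real.exp_zero] at h2
  linarith

theorem transMatrix_apply (lam Δ : ℝ) (B : Measure ℝ) (i j : State κ N) :
    transMatrix κ lam Δ B N i j =
    subMatrix κ lam Δ B N i j + if i = j then 1 - ∑ j, subMatrix κ lam Δ B N i j else 0 := by
  rw [transMatrix, Matrix.add_apply, Matrix.diagonal_apply]

theorem subMatrix_nonneg {lam : ℝ} (hlam : 0 < lam) {Δ : ℝ} (hΔ : 0 < Δ) {B : Measure ℝ}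
    [IsProbabilityMeasure B] (hB : B (Set.Iic 0) = 0) (i j : State κ N) :
    0 ≤ subMatrix κ lam Δ B N i j := by
  rw [subMatrix_eq κ lam hΔ hB]
  have := initDist_nonneg κ Δ N (oneJumpLaw κ Δ B (cell Δ i)) j
  split_ifs <;> positivity

theorem transMatrix_nonneg {lam : ℝ} (hlam : 0 < lam) {Δ : ℝ} (hΔ : 0 < Δ) {B : Measure ℝ}
    [IsProbabilityMeasure B] (hB : B (Set.Iic 0) = 0) (hN : 1 ≤ N) (i j : State κ N) :
    0 ≤ transMatrix κ lam Δ B N i j := by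
  rw [transMatrix_apply]
  refine add_nonneg (subMatrix_nonneg κ hlam hΔ hB i j) ?_
  split_ifs
  · rw [one_sub_sum_subMatrix κ lam hΔ hB hN]
    have h1 := one_sub_mul_exp_nonneg (x := lam * Δ)
    have h2 := sub_nonneg.2 (moveSum_le_one κ i)
    positivity
  · exact le_rfl

theorem sum_transMatrix (lam Δ : ℝ) (B : Measure ℝ) (i : State κ N) :
    ∑ j, transMatrix κ lam Δ B N i j = 1 := by
  simp [transMatrix_apply, Finset.sum_add_distrib]

open Classical in
/-- The row of the transition matrix, split in the same way as the law of the queue. The diagonal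
correction is distributed over the three parts so that each of them has the mass of its
counterpart. -/
theorem lift_transMatrix {lam : ℝ} (hlam : 0 < lam) {Δ : ℝ} (hΔ : 0 < Δ) {B : Measure ℝ}
    [IsProbabilityMeasure B] (hB : B (Set.Iic 0) = 0) (hN : 1 ≤ N) (i : State κ N) :
    lift Δ (transMatrix κ lam Δ B N i) =
      ENNReal.ofReal (Real.exp (-(lam * Δ))) •
        (∑ j : State κ N, (if NoJumpMove κ i j then (1 : ℝ≥0∞) else 0) • cell Δ j +
          ENNReal.ofReal (1 - moveSum κ i) • cell Δ i) +
      ENNReal.ofReal (lam * Δ * Real.exp (-(lam * Δ))) •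
        (lift Δ (initDist κ Δ N (oneJumpLaw κ Δ B (cell Δ i))) +
          oneJumpLaw κ Δ B (cell Δ i) (Set.Ioi (N * Δ)) • cell Δ i) +
      noiseLaw lam B (manyJumps Δ) • cell Δ i := by
  have := isProbabilityMeasure_cell hΔ i
  have := isProbabilityMeasure_oneJumpLaw κ hΔ B (cell Δ i)
  set G := oneJumpLaw κ Δ B (cell Δ i) with hG
  have h1 := one_sub_mul_exp_nonneg (x := lam * Δ)
  have h2 := sub_nonneg.2 (moveSum_le_one κ i)
  have hD : ENNReal.ofReal (1 - ∑ j, subMatrix κ lam Δ B N i j) =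
      noiseLaw lam B (manyJumps Δ) +
        ENNReal.ofReal (lam * Δ * Real.exp (-(lam * Δ))) * G (Set.Ioi (N * Δ)) +
        ENNReal.ofReal (Real.exp (-(lam * Δ))) * ENNReal.ofReal (1 - moveSum κ i) := by
    rw [one_sub_sum_subMatrix κ lam hΔ hB hN, noiseLaw_manyJumps hlam B hΔ.le,
      ENNReal.ofReal_add (by positivity) (by positivity), ENNReal.ofReal_add h1 (by positivity),
      ENNReal.ofReal_mul (Real.exp_nonneg _), ENNReal.ofReal_mul (q := G.real _) (by positivity),
      ofReal_measureReal]
  have hd0 : 0 ≤ 1 - ∑ j, subMatrix κ lam Δ B N i j := by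
    rw [one_sub_sum_subMatrix κ lam hΔ hB hN]
    positivity
  have hrow : ∀ j : State κ N, ENNReal.ofReal (transMatrix κ lam Δ B N i j) • cell Δ j =
      ENNReal.ofReal (Real.exp (-(lam * Δ))) •
        ((if NoJumpMove κ i j then (1 : ℝ≥0∞) else 0) • cell Δ j) +
      ENNReal.ofReal (lam * Δ * Real.exp (-(lam * Δ))) •
        (ENNReal.ofReal (initDist κ Δ N G j) • cell Δ j) +
      if i = j then ENNReal.ofReal (1 - ∑ j, subMatrix κ lam Δ B N i j) • cell Δ j else 0 := by
    intro j
    have hj := initDist_nonneg κ Δ N G j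
    rw [transMatrix_apply, ENNReal.ofReal_add (subMatrix_nonneg κ hlam hΔ hB i j)
      (by split_ifs; exacts [hd0, le_rfl]), subMatrix_eq κ lam hΔ hB,
      ENNReal.ofReal_add (by split_ifs <;> positivity) (by positivity),
      ENNReal.ofReal_mul (Real.exp_nonneg _), ENNReal.ofReal_mul (q := initDist _ _ _ _ _)
      (by positivity), add_smul, add_smul, mul_smul, mul_smul]
    congr 2
    · congr 2
      split_ifs <;> simp
    · split_ifs <;> simp
  rw [lift, Finset.sum_congr rfl fun j _ => hrow j, Finset.sum_add_distrib, Finset.sum_add_distrib,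
    ← Finset.smul_sum, ← Finset.smul_sum, Finset.sum_ite_eq, if_pos (Finset.mem_univ i), hD,
      add_smul,
    add_smul, mul_smul, mul_smul, smul_add, smul_add, lift]
  abel

/-- Without a jump the cell is moved exactly to another cell; only the last cell in the spectrally
negative case is left where it is, at the cost of a shift by `Δ`. -/
theorem wd_noJump_le {lam : ℝ} {Δ : ℝ} (hΔ : 0 < Δ) (B : Measure ℝ) (i : State κ N)
    [DecidablePred fun j : State κ N => NoJumpMove κ i j] :
    ENNReal.ofReal (Real.exp (-(lam * Δ))) * WD ((cell Δ i).map (drift κ Δ))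
        (∑ j : State κ N, (if NoJumpMove κ i j then (1 : ℝ≥0∞) else 0) • cell Δ j +
          ENNReal.ofReal (1 - moveSum κ i) • cell Δ i) ≤
      match κ with
      | .mg1 => 0
      | .specNeg => trunc .specNeg lam Δ B N i := by
  have := isProbabilityMeasure_cell hΔ i
  rcases noJumpMove_cases κ hΔ i with ⟨j₀, hj, hmap⟩ | ⟨rfl, hi, hj⟩
  · have : WD ((cell Δ i).map (drift κ Δ))
        (∑ j : State κ N, (if NoJumpMove κ i j then (1 : ℝ≥0∞) else 0) • cell Δ j +
          ENNReal.ofReal (1 - moveSum κ i) • cell Δ i) = 0 := by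
      rw [hmap]
      simp [hj, moveSum, wd_self]
    rw [this, mul_zero]
    exact zero_le
  · simp only [trunc, if_pos hi]
    rw [mul_comm Δ, ENNReal.ofReal_mul (Real.exp_nonneg _)]
    refine mul_le_mul' le_rfl ?_
    have h : ∑ j : State .specNeg N,
        (if NoJumpMove .specNeg i j then (1 : ℝ≥0∞) else 0) • cell Δ j +
          ENNReal.ofReal (1 - moveSum .specNeg i) • cell Δ i = (cell Δ i).map id := by
      simp [hj, moveSum]
    rw [h]
    refine (wd_map_le _ ((measurable_drift .specNeg).comp measurable_prodMk_left).aemeasurable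
      aemeasurable_id).trans ?_
    simp [drift, abs_of_pos hΔ]

/-- With one jump, the error comes from making the mass uniform within the cells and, in the M/G/1
case, from truncation. -/
theorem wd_oneJump_le (lam : ℝ) {Δ : ℝ} (hΔ : 0 < Δ) {B : Measure ℝ}
    [IsProbabilityMeasure B] (hB : B (Set.Iic 0) = 0) (hN : 1 ≤ N) (i : State κ N) :
    ENNReal.ofReal (lam * Δ * Real.exp (-(lam * Δ))) * WD (oneJumpLaw κ Δ B (cell Δ i))
        (lift Δ (initDist κ Δ N (oneJumpLaw κ Δ B (cell Δ i))) +
          oneJumpLaw κ Δ B (cell Δ i) (Set.Ioi (N * Δ)) • cell Δ i) ≤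
      ENNReal.ofReal (lam * Δ * Real.exp (-(lam * Δ))) * ENNReal.ofReal Δ +
      match κ with
      | .mg1 => trunc .mg1 lam Δ B N i
      | .specNeg => 0 := by
  have := isProbabilityMeasure_cell hΔ i
  have := isProbabilityMeasure_oneJumpLaw κ hΔ B (cell Δ i)
  set G := oneJumpLaw κ Δ B (cell Δ i) with hG
  have hi := Finset.mem_Icc.1 i.2
  have hsplit : G = G.restrict (Set.Iic (N * Δ)) + G.restrict (Set.Ioi (N * Δ)) := by
    rw [← Set.compl_Iic, Measure.restrict_add_restrict_compl measurableSet_Iic]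
  have htot : G (Set.Iic (N * Δ)) + G (Set.Ioi (N * Δ)) = 1 := by
    rw [← Set.compl_Iic, measure_add_measure_compl measurableSet_Iic, measure_univ]
  have hle : G (Set.Iic (N * Δ)) ≤ 1 := prob_le_one
  have hwd : WD G (lift Δ (initDist κ Δ N G) + G (Set.Ioi (N * Δ)) • cell Δ i) ≤
      ENNReal.ofReal Δ * G (Set.Iic (N * Δ)) +
        WD (G.restrict (Set.Ioi (N * Δ))) (G (Set.Ioi (N * Δ)) • cell Δ i) := by
    conv_lhs => enter [1]; rw [hsplit]
    exact (wd_add_le _ _ _ _).trans (add_le_add_left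
      (wd_lift_initDist_le κ hΔ hN (oneJumpLaw_Iio_zero κ hΔ hB i)) _)
  cases κ
  · dsimp only [trunc]
    rw [← mul_add]
    refine mul_le_mul' le_rfl (hwd.trans (add_le_add ?_ (wd_excess_mg1_le hΔ hB hi.2)))
    exact mul_le_of_le_one_right' hle
  · dsimp only
    rw [add_zero]
    refine mul_le_mul' le_rfl (hwd.trans ?_)
    have hexc : WD (G.restrict (Set.Ioi (N * Δ))) (G (Set.Ioi (N * Δ)) • cell Δ i) ≤
        ENNReal.ofReal Δ * G (Set.Ioi (N * Δ)) := by
      rcases hi.2.eq_or_lt with h | h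
      · rw [hG, h]
        exact wd_excess_specNeg_le hΔ hB hN
      · have h0 : G (Set.Ioi (N * Δ)) = 0 := oneJumpLaw_specNeg_Ioi_of_lt hΔ hB h
        rw [h0, zero_smul, Measure.restrict_eq_zero.2 h0, wd_self]
        exact zero_le
    refine (add_le_add le_rfl hexc).trans_eq ?_
    rw [← mul_add, htot, mul_one]

/-- The first summand is the error of one jump. Together with the extra `Δ` of the case of two or
more jumps it makes up the aggregation error, which is why the two are estimated jointly. -/
theorem wd_manyJumps_le {lam : ℝ} (hlam : 0 < lam) {Δ : ℝ} (hΔ : 0 < Δ) {B : Measure ℝ}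
    [IsProbabilityMeasure B] (hB : B (Set.Iic 0) = 0) (i : State κ N) {e : ℝ}
    (he : IsJmpAgg lam Δ B e) :
    ENNReal.ofReal (lam * Δ * Real.exp (-(lam * Δ))) * ENNReal.ofReal Δ +
      WD (manyJumpsLaw κ lam B (cell Δ i) Δ) (noiseLaw lam B (manyJumps Δ) • cell Δ i) ≤
      ENNReal.ofReal e + jmpCut κ lam Δ B N := by
  have := isProbabilityMeasure_cell hΔ i
  have hi := Finset.mem_Icc.1 i.2
  have h0 := cell_Iio_zero hΔ i
  have hx : 0 < lam * Δ := mul_pos hlam hΔ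
  have h1e : lam * Δ ^ 2 * Real.exp (-(lam * Δ)) ≤ lam * Δ ^ 2 :=
    mul_le_of_le_one_right (by positivity) (Real.exp_le_one_iff.2 (by linarith))
  have hfst : ENNReal.ofReal (lam * Δ * Real.exp (-(lam * Δ))) * ENNReal.ofReal Δ =
      ENNReal.ofReal (lam * Δ ^ 2 * Real.exp (-(lam * Δ))) := by
    rw [← ENNReal.ofReal_mul (by positivity)]
    congr 1
    ring
  have hle : ENNReal.ofReal (lam * Δ * Real.exp (-(lam * Δ))) * ENNReal.ofReal Δ ≤
      ENNReal.ofReal e := by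
    rw [hfst]
    rcases he with rfl | ⟨rfl, -⟩
    · exact ENNReal.ofReal_le_ofReal h1e
    · exact le_rfl
  have hmean : ENNReal.ofReal (lam * Δ * Real.exp (-(lam * Δ))) * ENNReal.ofReal Δ +
      WD (manyJumpsLaw κ lam B (cell Δ i) Δ) (noiseLaw lam B (manyJumps Δ) • cell Δ i) ≤
      ENNReal.ofReal e + ENNReal.ofReal (lam * Δ * (1 - Real.exp (-(lam * Δ)))) * meanJump B := by
    rcases he with rfl | ⟨rfl, hb⟩
    · have hpos : ∀ᵐ b ∂B, Δ ≤ 2 * b + Δ := by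
        filter_upwards [ae_pos_of_measure_Iic hB] with b hb
        linarith
      refine (add_le_add le_rfl
        (wd_manyJumpsLaw_le_meanJump κ hlam hB h0 hΔ.le hΔ.le hpos)).trans ?_
      rw [add_left_comm, add_comm]
      refine add_le_add ?_ le_rfl
      rw [hfst, noiseLaw_manyJumps hlam B hΔ.le, ← ENNReal.ofReal_mul hΔ.le,
        ← ENNReal.ofReal_add (by positivity) (mul_nonneg hΔ.le one_sub_mul_exp_nonneg)]
      refine ENNReal.ofReal_le_ofReal ?_
      -- the two terms add up to `Δ * (1 - exp (-(lam * Δ)))`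
      have h2 := mul_le_mul_of_nonneg_left (Real.add_one_le_exp (-(lam * Δ))) hΔ.le
      nlinarith
    · have hb' : ∀ᵐ b ∂B, Δ ≤ 2 * b + 0 := by
        filter_upwards [hb] with b hb
        linarith
      have := wd_manyJumpsLaw_le_meanJump κ hlam hB h0 hΔ.le le_rfl hb'
      rw [ENNReal.ofReal_zero, zero_mul, add_zero] at this
      exact add_le_add hle this
  cases κ
  · exact hmean
  · rw [jmpCut, ← min_add_add_left]
    refine le_min hmean (add_le_add hle ?_)
    have hM : ∀ᵐ q ∂cell Δ i, q ≤ N * Δ := by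
      filter_upwards [ae_cell hΔ i] with q hq
      exact hq.2.2.trans (mul_le_mul_of_nonneg_right (by exact_mod_cast hi.2) hΔ.le)
    refine (wd_manyJumpsLaw_specNeg_le hlam hB h0 hΔ.le hM).trans_eq ?_
    rw [noiseLaw_manyJumps hlam B hΔ.le, ← ENNReal.ofReal_mul (by positivity), mul_comm]

/-- The error of one step of the chain started from a single cell. -/
theorem wd_queueLaw_cell_le {lam : ℝ} (hlam : 0 < lam) {Δ : ℝ} (hΔ : 0 < Δ) {B : Measure ℝ}
    [IsProbabilityMeasure B] (hB : B (Set.Iic 0) = 0) (hN : 1 ≤ N) (i : State κ N) {e : ℝ}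
    (he : IsJmpAgg lam Δ B e) :
    WD (queueLaw κ lam B (cell Δ i) Δ) (lift Δ (transMatrix κ lam Δ B N i)) ≤
      ENNReal.ofReal e + jmpCut κ lam Δ B N + trunc κ lam Δ B N i := by
  classical
  have := isProbabilityMeasure_cell hΔ i
  rw [queueLaw_eq_add κ hlam hB (cell_Iio_zero hΔ i) hΔ, lift_transMatrix κ hlam hΔ hB hN]
  have hA := (wd_smul_le ENNReal.ofReal_ne_top _ _).trans (wd_noJump_le κ (lam := lam) hΔ B i)
  have hG := (wd_smul_le ENNReal.ofReal_ne_top _ _).trans (wd_oneJump_le κ lam hΔ hB hN i)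
  have hC := wd_manyJumps_le κ hlam hΔ hB i he
  refine (wd_add_le _ _ _ _).trans ((add_le_add ((wd_add_le _ _ _ _).trans (add_le_add hA hG))
    le_rfl).trans ?_)
  cases κ
  · dsimp only
    rw [zero_add, add_right_comm]
    exact add_le_add hC le_rfl
  · dsimp only
    rw [add_zero, add_assoc, add_comm]
    exact add_le_add hC le_rfl

end

/-! ### The chain -/

section
variable (κ : QueueKind) {N : ℕ}

theorem chainDist_zero (lam Δ : ℝ) (B : Measure ℝ) (p : State κ N → ℝ) :
    chainDist κ lam Δ B N p 0 = p := by
  simp [chainDist]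

theorem chainDist_succ (lam Δ : ℝ) (B : Measure ℝ) (p : State κ N → ℝ) (k : ℕ) :
    chainDist κ lam Δ B N p (k + 1) =
      Matrix.vecMul (chainDist κ lam Δ B N p k) (transMatrix κ lam Δ B N) := by
  rw [chainDist, chainDist, Matrix.vecMul_vecMul, pow_succ]

theorem vecMul_transMatrix_mem_stdSimplex {lam : ℝ} (hlam : 0 < lam) {Δ : ℝ} (hΔ : 0 < Δ)
    {B : Measure ℝ} [IsProbabilityMeasure B] (hB : B (Set.Iic 0) = 0) (hN : 1 ≤ N)
    {p : State κ N → ℝ} (hp : p ∈ stdSimplex ℝ (State κ N)) :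
    Matrix.vecMul p (transMatrix κ lam Δ B N) ∈ stdSimplex ℝ (State κ N) := by
  refine ⟨fun j => ?_, ?_⟩ <;> simp only [Matrix.vecMul, dotProduct]
  · exact Finset.sum_nonneg fun i _ =>
      mul_nonneg (hp.1 i) (transMatrix_nonneg κ hlam hΔ hB hN i j)
  · rw [Finset.sum_comm]
    simp only [← Finset.mul_sum, sum_transMatrix, mul_one, hp.2]

theorem chainDist_mem_stdSimplex {lam : ℝ} (hlam : 0 < lam) {Δ : ℝ} (hΔ : 0 < Δ)
    {B : Measure ℝ} [IsProbabilityMeasure B] (hB : B (Set.Iic 0) = 0) (hN : 1 ≤ N)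
    {p : State κ N → ℝ} (hp : p ∈ stdSimplex ℝ (State κ N)) (k : ℕ) :
    chainDist κ lam Δ B N p k ∈ stdSimplex ℝ (State κ N) := by
  induction k with
  | zero => rwa [chainDist_zero]
  | succ k ih =>
    rw [chainDist_succ]
    exact vecMul_transMatrix_mem_stdSimplex κ hlam hΔ hB hN ih

theorem sum_ofReal_of_mem_stdSimplex {ι : Type*} [Fintype ι] {p : ι → ℝ}
    (hp : p ∈ stdSimplex ℝ ι) : ∑ i, ENNReal.ofReal (p i) = 1 := by
  rw [← ENNReal.ofReal_sum_of_nonneg fun i _ => hp.1 i, hp.2, ENNReal.ofReal_one]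

theorem isProbabilityMeasure_lift {Δ : ℝ} (hΔ : 0 < Δ) {p : State κ N → ℝ}
    (hp : p ∈ stdSimplex ℝ (State κ N)) : IsProbabilityMeasure (lift Δ p) := by
  constructor
  have := fun i => isProbabilityMeasure_cell hΔ i
  rw [← sum_ofReal_of_mem_stdSimplex hp, lift, Measure.finsetSum_apply]
  simp

theorem lift_Iio_zero {Δ : ℝ} (hΔ : 0 < Δ) (p : State κ N → ℝ) : lift Δ p (Set.Iio 0) = 0 := by
  simp [lift, Measure.finsetSum_apply, cell_Iio_zero hΔ]

theorem lift_vecMul {Δ : ℝ} {p : State κ N → ℝ} (hp : ∀ i, 0 ≤ p i)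
    {P : Matrix (State κ N) (State κ N) ℝ} (hP : ∀ i j, 0 ≤ P i j) :
    lift Δ (Matrix.vecMul p P) = ∑ i, ENNReal.ofReal (p i) • lift Δ (P i) := by
  simp only [lift, Finset.smul_sum]
  rw [Finset.sum_comm]
  refine Finset.sum_congr rfl fun j _ => ?_
  rw [Matrix.vecMul, dotProduct, ENNReal.ofReal_sum_of_nonneg fun i _ => mul_nonneg (hp i) (hP i j),
    Finset.sum_smul]
  refine Finset.sum_congr rfl fun i _ => ?_
  rw [ENNReal.ofReal_mul (hp i), mul_smul]

theorem wd_queueLaw_lift_le {lam : ℝ} (hlam : 0 < lam) {Δ : ℝ} (hΔ : 0 < Δ) {B : Measure ℝ}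
    [IsProbabilityMeasure B] (hB : B (Set.Iic 0) = 0) (hN : 1 ≤ N) {e : ℝ}
    (he : IsJmpAgg lam Δ B e) {p : State κ N → ℝ} (hp : p ∈ stdSimplex ℝ (State κ N)) :
    WD (queueLaw κ lam B (lift Δ p) Δ) (lift Δ (Matrix.vecMul p (transMatrix κ lam Δ B N))) ≤
      ∑ i, ENNReal.ofReal (p i) *
        (ENNReal.ofReal e + jmpCut κ lam Δ B N + trunc κ lam Δ B N i) := by
  have := fun i => isProbabilityMeasure_cell hΔ i
  have hprob := isProbabilityMeasure_lift κ hΔ hp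
  have : SFinite (∑ i : State κ N, ENNReal.ofReal (p i) • cell Δ i) :=
    inferInstanceAs (SFinite (lift Δ p))
  rw [lift_vecMul κ hp.1 (transMatrix_nonneg κ hlam hΔ hB hN)]
  conv_lhs => enter [1]; rw [lift, queueLaw_sum κ hlam hB _ (fun i : State κ N => cell Δ i)
    (fun i => cell_Iio_zero hΔ i) hΔ.le]
  refine (wd_sum_le _ _ _).trans (Finset.sum_le_sum fun i _ => ?_)
  refine (wd_smul_le ENNReal.ofReal_ne_top _ _).trans (mul_le_mul' le_rfl ?_)
  exact wd_queueLaw_cell_le κ hlam hΔ hB hN i he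

/-- In one more step, the error of the previous steps does not grow, by the Markov property and the
contraction of the queue, and the error of one step is added. -/
theorem wd_queueLaw_succ_le {lam : ℝ} (hlam : 0 < lam) {Δ : ℝ} (hΔ : 0 < Δ) {B : Measure ℝ}
    [IsProbabilityMeasure B] (hB : B (Set.Iic 0) = 0) (hN : 1 ≤ N) {e : ℝ}
    (he : IsJmpAgg lam Δ B e) {μ₀ : Measure ℝ} [IsProbabilityMeasure μ₀] (hμ₀ : μ₀ (Set.Iio 0) = 0)
    {p : State κ N → ℝ} (hp : p ∈ stdSimplex ℝ (State κ N)) (k : ℕ) :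
    WD (queueLaw κ lam B μ₀ (((k + 1 : ℕ) : ℝ) * Δ)) (lift Δ (chainDist κ lam Δ B N p (k + 1))) ≤
      WD (queueLaw κ lam B μ₀ (k * Δ)) (lift Δ (chainDist κ lam Δ B N p k)) +
        ∑ i, ENNReal.ofReal (chainDist κ lam Δ B N p k i) *
          (ENNReal.ofReal e + jmpCut κ lam Δ B N + trunc κ lam Δ B N i) := by
  have hpk := chainDist_mem_stdSimplex κ hlam hΔ hB hN hp k
  have hk : 0 ≤ (k : ℝ) * Δ := by positivity
  have hl0 := lift_Iio_zero κ hΔ (chainDist κ lam Δ B N p k)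
  have hq0 := queueLaw_Iio_zero κ hlam hB hμ₀ hk
  have := isProbabilityMeasure_lift κ hΔ hpk
  have := isProbabilityMeasure_queueLaw κ hlam hB hμ₀ hk
  have := isProbabilityMeasure_queueLaw κ hlam hB hl0 hΔ.le
  rw [show ((k + 1 : ℕ) : ℝ) * Δ = k * Δ + Δ by push_cast; ring,
    ← queueLaw_queueLaw κ hlam hB hμ₀ hk hΔ.le, chainDist_succ]
  refine (wd_triangle _ (queueLaw κ lam B (lift Δ (chainDist κ lam Δ B N p k)) Δ) _).trans ?_
  exact add_le_add (wd_queueLaw_le κ hlam hB hq0 hl0 hΔ.le)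
    (wd_queueLaw_lift_le κ hlam hΔ hB hN he hpk)

/-- The errors of the steps add up, since the queue does not increase an error made before. -/
theorem wd_queueLaw_iterate_le {lam : ℝ} (hlam : 0 < lam) {Δ : ℝ} (hΔ : 0 < Δ) {B : Measure ℝ}
    [IsProbabilityMeasure B] (hB : B (Set.Iic 0) = 0) (hN : 1 ≤ N) {e : ℝ}
    (he : IsJmpAgg lam Δ B e) {μ₀ : Measure ℝ} [IsProbabilityMeasure μ₀] (hμ₀ : μ₀ (Set.Iio 0) = 0)
    {p : State κ N → ℝ} (hp : p ∈ stdSimplex ℝ (State κ N)) (k : ℕ) :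
    WD (queueLaw κ lam B μ₀ (k * Δ)) (lift Δ (chainDist κ lam Δ B N p k)) ≤
      WD μ₀ (lift Δ p) + k * (ENNReal.ofReal e + jmpCut κ lam Δ B N) +
        ∑ m ∈ Finset.range k, ∑ i,
          ENNReal.ofReal (chainDist κ lam Δ B N p m i) * trunc κ lam Δ B N i := by
  induction k with
  | zero => simp [chainDist_zero, queueLaw_zero κ hlam hB hμ₀]
  | succ k ih =>
    refine (wd_queueLaw_succ_le κ hlam hΔ hB hN he hμ₀ hp k).trans
      ((add_le_add ih le_rfl).trans_eq ?_)
    have hsum := sum_ofReal_of_mem_stdSimplex (chainDist_mem_stdSimplex κ hlam hΔ hB hN hp k)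
    simp only [mul_add _ (ENNReal.ofReal e + _), Finset.sum_add_distrib]
    rw [← Finset.sum_mul, hsum, one_mul, Finset.sum_range_succ]
    push_cast
    ring

end

/-! ### The order of the error and the initial error -/

/-- `k ≤ T / Δ` steps with an error of order `Δ ^ 2` each. -/
theorem mul_error_le (κ : QueueKind) {lam : ℝ} (hlam : 0 < lam) (B : Measure ℝ)
    (hB : meanJump B ≠ ⊤) {T Δ : ℝ} (N : ℕ) {k : ℕ} (hΔ : 0 < Δ) (hk : k * Δ ≤ T) :
    k * (ENNReal.ofReal (lam * Δ ^ 2) + jmpCut κ lam Δ B N) ≤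
      ENNReal.ofReal ((T * (lam + lam ^ 2 * (meanJump B).toReal)) * Δ) := by
  have hm : 0 ≤ (meanJump B).toReal := ENNReal.toReal_nonneg
  have hx : 0 < lam * Δ := mul_pos hlam hΔ
  have h1 : 1 - Real.exp (-(lam * Δ)) ≤ lam * Δ := by
    have := Real.add_one_le_exp (-(lam * Δ))
    linarith
  have hcut : jmpCut κ lam Δ B N ≤ ENNReal.ofReal (lam ^ 2 * Δ ^ 2 * (meanJump B).toReal) := by
    have h : ENNReal.ofReal (lam * Δ * (1 - Real.exp (-(lam * Δ)))) * meanJump B ≤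
        ENNReal.ofReal (lam ^ 2 * Δ ^ 2 * (meanJump B).toReal) := by
      rw [ENNReal.ofReal_mul (p := lam ^ 2 * Δ ^ 2) (by positivity), ENNReal.ofReal_toReal hB]
      refine mul_le_mul' (ENNReal.ofReal_le_ofReal ?_) le_rfl
      nlinarith
    cases κ
    · exact h
    · exact (min_le_left _ _).trans h
  refine (mul_le_mul' le_rfl (add_le_add le_rfl hcut)).trans ?_
  rw [← ENNReal.ofReal_add (by positivity) (by positivity), ← ENNReal.ofReal_natCast,
    ← ENNReal.ofReal_mul (by positivity)]
  refine ENNReal.ofReal_le_ofReal ?_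
  have : (k : ℝ) * (lam * Δ ^ 2 + lam ^ 2 * Δ ^ 2 * (meanJump B).toReal) =
      k * Δ * ((lam + lam ^ 2 * (meanJump B).toReal) * Δ) := by ring
  rw [this, mul_assoc T]
  exact mul_le_mul_of_nonneg_right hk (by positivity)

/-- Without a mean, the cap of the error at `M + Δ ≤ 2 * M` is used. Two or more jumps have a
probability of at most `(lam * Δ) ^ 2`. -/
theorem mul_error_specNeg_le {lam : ℝ} (hlam : 0 < lam) (B : Measure ℝ)
    {T M Δ : ℝ} {N k : ℕ} (hΔ : 0 < Δ) (hN : 1 ≤ N) (hM : N * Δ = M) (hk : k * Δ ≤ T) :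
    k * (ENNReal.ofReal (lam * Δ ^ 2) + jmpCut .specNeg lam Δ B N) ≤
      ENNReal.ofReal ((T * (lam + lam ^ 2 * (2 * M))) * Δ) := by
  have hx : 0 < lam * Δ := mul_pos hlam hΔ
  have hΔM : Δ ≤ M := by
    have : (1 : ℝ) ≤ N := by exact_mod_cast hN
    nlinarith
  have hM0 : 0 ≤ M := hΔ.le.trans hΔM
  have h1 : 1 - (1 + lam * Δ) * Real.exp (-(lam * Δ)) ≤ (lam * Δ) ^ 2 := by
    have := mul_le_mul_of_nonneg_left (Real.add_one_le_exp (-(lam * Δ)))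
      (by linarith : 0 ≤ 1 + lam * Δ)
    nlinarith
  have hcut : jmpCut .specNeg lam Δ B N ≤ ENNReal.ofReal ((lam * Δ) ^ 2 * (2 * M)) := by
    refine (min_le_right _ _).trans (ENNReal.ofReal_le_ofReal ?_)
    rw [hM]
    exact mul_le_mul h1 (by linarith) (by linarith) (by positivity)
  refine (mul_le_mul' le_rfl (add_le_add le_rfl hcut)).trans ?_
  rw [← ENNReal.ofReal_add (by positivity) (by positivity), ← ENNReal.ofReal_natCast,
    ← ENNReal.ofReal_mul (by positivity)]
  refine ENNReal.ofReal_le_ofReal ?_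
  have : (k : ℝ) * (lam * Δ ^ 2 + (lam * Δ) ^ 2 * (2 * M)) =
      k * Δ * ((lam + lam ^ 2 * (2 * M)) * Δ) := by ring
  rw [this, mul_assoc T]
  exact mul_le_mul_of_nonneg_right hk (by positivity)

theorem initDist_mem_and_wd_le (κ : QueueKind) {μ₀ : Measure ℝ} [IsProbabilityMeasure μ₀]
    (hμ₀ : μ₀ (Set.Iio 0) = 0) {Δ : ℝ} {N : ℕ} (hΔ : 0 < Δ) (hN : 1 ≤ N)
    (hM : μ₀ (Set.Ioi (N * Δ)) = 0) :
    initDist κ Δ N μ₀ ∈ stdSimplex ℝ (State κ N) ∧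
      WD μ₀ (lift Δ (initDist κ Δ N μ₀)) ≤ ENNReal.ofReal Δ := by
  have h1 : μ₀ (Set.Iic (N * Δ)) = 1 := by
    rwa [← prob_compl_eq_zero_iff measurableSet_Iic, Set.compl_Iic]
  refine ⟨⟨initDist_nonneg κ Δ N μ₀, ?_⟩, ?_⟩
  · rw [sum_initDist κ hΔ hN hμ₀, Measure.real, h1, ENNReal.toReal_one]
  · have h := wd_lift_initDist_le κ hΔ hN hμ₀
    have hr : μ₀.restrict (Set.Iic (N * Δ)) = μ₀ := by
      refine Measure.restrict_eq_self_of_ae_mem ?_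
      filter_upwards [measure_eq_zero_iff_ae_notMem.1 hM] with x hx
      simpa using hx
    rwa [hr, h1, mul_one] at h

end

end LevyQueue

open LevyQueue in
theorem mainTheorem1 (κ : QueueKind) (lam : ℝ) (hlam : 0 < lam)
    (B : Measure ℝ) [IsProbabilityMeasure B] (hB : B (Set.Iic 0) = 0)
    (μ₀ : Measure ℝ) [IsProbabilityMeasure μ₀] (hμ₀ : μ₀ (Set.Iio 0) = 0) :
    -- the initial error does not grow under the dynamics of the queue
    (∀ ν : Measure ℝ, IsProbabilityMeasure ν → ν (Set.Iio 0) = 0 → ∀ t : ℝ, 0 ≤ t →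
      WD (queueLaw κ lam B μ₀ t) (queueLaw κ lam B ν t) ≤ WD μ₀ ν) ∧
    (∀ (Δ : ℝ) (N : ℕ) (e : ℝ), 0 < Δ → 1 ≤ N → IsJmpAgg lam Δ B e →
      ∀ p ∈ stdSimplex ℝ (State κ N),
        -- the error of one step of the chain, started from the piecewise uniform measure
        WD (queueLaw κ lam B (lift Δ p) Δ) (lift Δ (chainDist κ lam Δ B N p 1)) ≤
          ∑ i, ENNReal.ofReal (p i) *
            (ENNReal.ofReal e + jmpCut κ lam Δ B N + trunc κ lam Δ B N i) ∧
        -- the growth of the error in every step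
        (∀ k : ℕ,
          WD (queueLaw κ lam B μ₀ (((k + 1 : ℕ) : ℝ) * Δ))
              (lift Δ (chainDist κ lam Δ B N p (k + 1))) ≤
            WD (queueLaw κ lam B μ₀ (k * Δ)) (lift Δ (chainDist κ lam Δ B N p k)) +
              ∑ i, ENNReal.ofReal (chainDist κ lam Δ B N p k i) *
                (ENNReal.ofReal e + jmpCut κ lam Δ B N + trunc κ lam Δ B N i)) ∧
        -- the accumulated error after `k` steps
        (∀ k : ℕ,
          WD (queueLaw κ lam B μ₀ (k * Δ)) (lift Δ (chainDist κ lam Δ B N p k)) ≤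
            WD μ₀ (lift Δ p) + k * (ENNReal.ofReal e + jmpCut κ lam Δ B N) +
              ∑ m ∈ Finset.range k, ∑ i,
                ENNReal.ofReal (chainDist κ lam Δ B N p m i) * trunc κ lam Δ B N i)) ∧
    -- truncation aside, the bound is of order `Δ` up to a fixed time `T`, uniformly in `N`
    (meanJump B ≠ ⊤ → ∀ T : ℝ, ∃ C : ℝ, ∀ (Δ : ℝ) (N k : ℕ), 0 < Δ → 1 ≤ N → k * Δ ≤ T →
      k * (ENNReal.ofReal (lam * Δ ^ 2) + jmpCut κ lam Δ B N) ≤ ENNReal.ofReal (C * Δ)) ∧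
    -- in the spectrally negative case also without a finite mean, for a fixed truncation point
    (κ = QueueKind.specNeg → ∀ T M : ℝ, ∃ C : ℝ, ∀ (Δ : ℝ) (N k : ℕ), 0 < Δ → 1 ≤ N →
      N * Δ = M → k * Δ ≤ T →
        k * (ENNReal.ofReal (lam * Δ ^ 2) + jmpCut κ lam Δ B N) ≤ ENNReal.ofReal (C * Δ)) ∧
    -- the initial error is at most `Δ` for the canonical initial vector
    (∀ (Δ : ℝ) (N : ℕ), 0 < Δ → 1 ≤ N → μ₀ (Set.Ioi (N * Δ)) = 0 →
      initDist κ Δ N μ₀ ∈ stdSimplex ℝ (State κ N) ∧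
        WD μ₀ (lift Δ (initDist κ Δ N μ₀)) ≤ ENNReal.ofReal Δ) := by
  refine ⟨fun ν _ hν t ht => wd_queueLaw_le κ hlam hB hμ₀ hν ht, fun Δ N e hΔ hN he p hp =>
    ⟨?_, wd_queueLaw_succ_le κ hlam hΔ hB hN he hμ₀ hp,
      wd_queueLaw_iterate_le κ hlam hΔ hB hN he hμ₀ hp⟩, fun hm T =>
    ⟨_, fun Δ N k hΔ _ hk => mul_error_le κ hlam B hm N hΔ hk⟩, ?_,
    fun Δ N hΔ hN hM => initDist_mem_and_wd_le κ hμ₀ hΔ hN hM⟩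
  · rw [← zero_add 1, chainDist_succ, chainDist_zero]
    exact wd_queueLaw_lift_le κ hlam hΔ hB hN he hp
  · rintro rfl T M
    exact ⟨_, fun Δ N k hΔ hN hM hk => mul_error_specNeg_le hlam B hΔ hN hM hk⟩
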